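/- Let $\rho_0>0$ and let $\mathcal D=\{(\rho,\zeta)\in\mathbb R^2:\rho>0\}\setminus\{(\rho,0):0<\rho<\rho_0\}$ be the exterior of a finite disk, in cylindrical coordinates. Let $U:\mathcal D\to\mathbb R$ be continuous, of class $C^2$ on $\mathcal D\setminus\{(\rho_0,0)\}$, and a solution there of the axisymmetric Laplace equation $$U_{\rho\rho}+U_{\zeta\zeta}+\tfrac1\rho U_\rho=0 .$$ Assume that * $U(\rho,\zeta)\to0$ as $\rho^2+\zeta^2\to\infty$ in $\mathcal D$; * $U$ is regular on the axis: $U_\rho(+0,\zeta)=0$ for $\zeta\ne0$, i.e. $U_\rho(\rho',\zeta')\to0$ as $(\rho',\zeta')\to(0,\zeta)$, $\rho'>0$; * $U$ is equatorially symmetric: $U(\rho,\zeta)=U(\rho,-\zeta)$; * $U$ has boundary values on the upper side of the disk: the limit $U(+i0)$ of $U$ at $(0,0)$ from $\{\rho>0,\ \zeta>0\}$ exists and, for every $0<\rho<\rho_0$, the limits $U_\rho(\rho+i0)$ and $U_\zeta(\rho+i0)$ of $U_\rho$ and $U_\zeta$ at $(\rho,0)$ from $\{\zeta>0\}$ exist;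 moreover $\rho\mapsto U_\rho(\rho+i0)$ is integrable on $(0,a)$ for every $a<\rho_0$ and $\rho\mapsto U_\zeta(\rho+i0)$ is integrable on $(0,\rho_0)$. Then for $k=ik_2$, $-\rho_0<k_2<\rho_0$, the integrals in the two expressions $$-4\left(U(+i0)+|k_2|\int_0^{|k_2|}\frac{U_\rho(\rho+i0)}{\sqrt{k_2^2-\rho^2}}\,d\rho\right),\qquad 4\int_{|k_2|}^{\rho_0}\frac{\rho\,U_\zeta(\rho+i0)}{\sqrt{\rho^2-k_2^2}}\,d\rho$$ converge absolutely, the two expressions (in terms of the Dirichlet data and of the Neumann data, respectively) are equal, and with $D(k)$ denoting their common value, $$U(\rho,\zeta)=-\frac1{4\pi i}\int_{-i\rho_0}^{i\rho_0}\frac{D(k)}{\sqrt{(k-\zeta)^2+\rho^2}}\,dk,\qquad(\rho,\zeta)\in\mathcal D,$$ where the integral is along the imaginary segment and the square root is the branch with positive real part. The integral converges absolutely at every point of $\mathcal D$ other than the rim point $(\rho_0,0)$; at the rim point the formula holds whenever the integral converges absolutely there. -/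

import Mathlib

open Set Filter Topology MeasureTheory

noncomputable section

/-- The exterior `𝒟` of a finite disk of radius `ρ₀` in the half-plane of cylindrical coordinates
`(ρ, ζ)`, `ρ > 0`. The rim `(ρ₀, 0)` belongs to `𝒟` but is not an interior point of it. -/
def exteriorDisk (ρ₀ : ℝ) : Set (ℝ × ℝ) :=
  {p | 0 < p.1} \ {p | 0 < p.1 ∧ p.1 < ρ₀ ∧ p.2 = 0}

/-- The partial derivative `U_ρ`. -/
def partialRho (U : ℝ × ℝ → ℝ) (p : ℝ × ℝ) : ℝ := deriv (fun r => U (r, p.2)) p.1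

/-- The partial derivative `U_ζ`. -/
def partialZeta (U : ℝ × ℝ → ℝ) (p : ℝ × ℝ) : ℝ := deriv (fun z => U (p.1, z)) p.2

/-- `U` is a classical (`C²`) solution on the open set `Ω ⊆ {ρ > 0}` of the axisymmetric Laplace
equation `U_ρρ + U_ζζ + U_ρ / ρ = 0`. -/
def IsAxisymmetricHarmonicOn (U : ℝ × ℝ → ℝ) (Ω : Set (ℝ × ℝ)) : Prop :=
  ContDiffOn ℝ 2 U Ω ∧
    ∀ p ∈ Ω, partialRho (partialRho U) p + partialZeta (partialZeta U) p
      + 1 / p.1 * partialRho U p = 0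

/-- The density expressed through the Dirichlet data: `Uc` is the value `U(+i0)` and `Ur` the
tangential derivative `ρ ↦ U_ρ(ρ + i0)` on the upper side of the disk; `k₂ = Im k`. -/
def dirichletDensity (Uc : ℝ) (Ur : ℝ → ℝ) (k₂ : ℝ) : ℝ :=
  -4 * (Uc + |k₂| * ∫ ρ in (0 : ℝ)..|k₂|, Ur ρ / √(k₂ ^ 2 - ρ ^ 2))

/-- The density expressed through the Neumann data `Uz = (ρ ↦ U_ζ(ρ + i0))` on the upper side of
the disk; `k₂ = Im k`. -/
def neumannDensity (ρ₀ : ℝ) (Uz : ℝ → ℝ) (k₂ : ℝ) : ℝ :=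
  4 * ∫ ρ in |k₂|..ρ₀, ρ * Uz ρ / √(ρ ^ 2 - k₂ ^ 2)

/-- The integrand `D(k) / √((k - ζ)² + ρ²)`. The power `1/2` is the principal square root, whose
real part is positive off the half-line `(-∞, 0]`. -/
def reprIntegrand (D : ℂ → ℂ) (p : ℝ × ℝ) (k : ℂ) : ℂ :=
  D k / ((k - (p.2 : ℂ)) ^ 2 + (p.1 : ℂ) ^ 2) ^ (1 / 2 : ℂ)

/-- The contour integral `∫ f(k) dk` over the straight segment from `-iρ₀` to `iρ₀`, parametrized
by `k = i k₂`. -/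
def imagSegmentIntegral (ρ₀ : ℝ) (f : ℂ → ℂ) : ℂ :=
  ∫ k₂ in (-ρ₀)..ρ₀, f (Complex.I * (k₂ : ℂ)) * Complex.I

/-- Absolute convergence of the contour integral over the segment from `-iρ₀` to `iρ₀`. -/
def ImagSegmentIntegrable (ρ₀ : ℝ) (f : ℂ → ℂ) : Prop :=
  IntervalIntegrable (fun k₂ : ℝ => f (Complex.I * (k₂ : ℂ)) * Complex.I) volume (-ρ₀) ρ₀

end

/-! ### Injectivity of generalized Stieltjes transforms -/

section StieltjesInjectivity

variable {E : Type*} [NormedAddCommGroup E] [NormedSpace ℝ E]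

/-! Everything is read off from Poisson transforms at axis points, `∫ ρ g(ρ) K(ρ, w) dρ` with `K(ρ,
w) = w (ρ² + w²)^(-3/2)`. With `A = w²` this is a generalized Stieltjes transform of exponent `3/2`,
hence determines `g` (`ae_eq_zero_of_stieltjes_eq_zero`). No uniqueness theorem for a boundary value
problem is needed.

Let `N` be `U_ζ(ρ + i0)` on the disk and zero outside it, as symmetry demands. The hypotheses make
`U` bounded in the quarter-plane `ρ, ζ > 0`. Green's identity against a Neumann-symmetrized kernel
with sources on the axis, integrated once in `w`, gives `∫ ρ U(ρ, ε) K(ρ, w) dρ = P(ε + w)`, where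
`P(s) = -∫ ρ N(ρ) / √(ρ² + s²) dρ` (`half_space_green_identity`, `integral_level_poissonKer`).
Neither the gradient of `U` near the rim nor any rate of decay is controlled. The identity survives
because the axis and the rim have codimension two in space, so a bounded function ignores them:
iterated-logarithm cutoffs have a commutator of size `O(1/Λ)` against an integrable majorant.

Equality of the two densities: letting `ε → 0` gives the same identity for the boundary values `u`
at height `0+`. The Poisson transform of `u` is a transform of its lower Abel transform, and `P` is
one of the upper Abel transform of `N`. Stieltjes injectivity with exponent `2` shows that the lower
Abel transform of `u` is the primitive of minus the upper one of `N`
(`lower_abelTransform_eq_primitive`). Writing `u = U(+i0) + ∫ U_ρ` and differentiating yields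
`density_eq`; the point `k = 0` is the limit `w → 0`.

Representation: the complex source `1 / √((it - ζ)² + ρ²)` has Poisson transform `1 / (ζ + w - it)`
at level `ζ > 0`. Superposing such sources with the even density `F = -(upper Abel transform of
N)(|t|)` therefore gives Poisson transform `π P(ζ + w)`, which is `π` times that of `U(·, ζ)`.
Injectivity gives the formula for `ζ > 0` with `D = -4F` (`eq_sourcePotential`). Symmetry covers `ζ
< 0`, and a limit `ζ → 0+` covers the plane outside the disk, including the rim. -/

lemma sq_add_rpow_neg_le {A μ ν x : ℝ} (hA : 0 < A) (hν : 0 < ν) (hμ : ν ≤ μ) :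
    (x ^ 2 + A) ^ (-μ) ≤ A ^ (-(μ - ν)) * (min 1 A) ^ (-ν) * (x ^ 2 + 1) ^ (-ν) := by
  have h1 : 0 < x ^ 2 + A := by positivity
  have hm : 0 < min 1 A := lt_min one_pos hA
  have h2 : (x ^ 2 + A) ^ (-μ) = (x ^ 2 + A) ^ (-(μ - ν)) * (x ^ 2 + A) ^ (-ν) := by
    rw [← Real.rpow_add h1]; congr 1; ring
  rw [h2, mul_assoc, ← Real.mul_rpow hm.le (by positivity)]
  have h3 : (x ^ 2 + A) ^ (-(μ - ν)) ≤ A ^ (-(μ - ν)) :=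
    Real.rpow_le_rpow_of_nonpos hA (by nlinarith [sq_nonneg x]) (by linarith)
  have h4 : (x ^ 2 + A) ^ (-ν) ≤ (min 1 A * (x ^ 2 + 1)) ^ (-ν) := by
    refine Real.rpow_le_rpow_of_nonpos (by positivity) ?_ (by linarith)
    nlinarith [min_le_left 1 A, min_le_right 1 A, sq_nonneg x]
  gcongr

lemma aestronglyMeasurable_of_rpow_smul {f : ℝ → E} {ν : ℝ}
    (hf : IntegrableOn (fun x => (x ^ 2 + 1) ^ (-ν) • f x) (Ioi 0)) :
    AEStronglyMeasurable f (volume.restrict (Ioi 0)) := by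
  have h : AEStronglyMeasurable (fun x : ℝ => (x ^ 2 + 1) ^ ν • ((x ^ 2 + 1) ^ (-ν) • f x))
      (volume.restrict (Ioi 0)) := by
    refine AEStronglyMeasurable.smul (Measurable.aestronglyMeasurable (by fun_prop))
      hf.aestronglyMeasurable
  refine h.congr (ae_of_all _ fun x => ?_)
  have h1 : 0 < x ^ 2 + 1 := by positivity
  simp only [smul_smul]
  rw [← Real.rpow_add h1]; simp

lemma integrableOn_sq_add_rpow_smul {f : ℝ → E} {ν μ A : ℝ} (hν : 0 < ν) (hμ : ν ≤ μ) (hA : 0 < A)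
    (hf : IntegrableOn (fun x => (x ^ 2 + 1) ^ (-ν) • f x) (Ioi 0)) :
    IntegrableOn (fun x => (x ^ 2 + A) ^ (-μ) • f x) (Ioi 0) := by
  refine Integrable.mono' (hf.norm.const_mul (A ^ (-(μ - ν)) * (min 1 A) ^ (-ν))) ?_ ?_
  · exact AEStronglyMeasurable.smul (Measurable.aestronglyMeasurable (by fun_prop))
      (aestronglyMeasurable_of_rpow_smul hf)
  · refine ae_of_all _ fun x => ?_
    rw [norm_smul, norm_smul, Real.norm_of_nonneg (by positivity),
      Real.norm_of_nonneg (by positivity), ← mul_assoc]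
    exact mul_le_mul_of_nonneg_right (sq_add_rpow_neg_le hA hν hμ) (norm_nonneg _)

/-- Differentiating in the parameter raises the exponent by one. For `a > A / 2` the derivative is
dominated by its size at `A / 2`. -/
lemma hasDerivAt_integral_sq_add_rpow {f : ℝ → E} {ν μ A : ℝ} (hν : 0 < ν) (hμ : ν ≤ μ)
    (hA : 0 < A) (hf : IntegrableOn (fun x => (x ^ 2 + 1) ^ (-ν) • f x) (Ioi 0)) :
    HasDerivAt (fun a => ∫ x in Ioi 0, (x ^ 2 + a) ^ (-μ) • f x)
      (∫ x in Ioi 0, (-μ * (x ^ 2 + A) ^ (-(μ + 1))) • f x) A := by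
  have hmeas := aestronglyMeasurable_of_rpow_smul hf
  refine (hasDerivAt_integral_of_dominated_loc_of_deriv_le (μ := volume.restrict (Ioi 0))
    (F := fun a x => (x ^ 2 + a) ^ (-μ) • f x)
    (F' := fun a x => (-μ * (x ^ 2 + a) ^ (-(μ + 1))) • f x)
    (bound := fun x => μ * ‖(x ^ 2 + A / 2) ^ (-(μ + 1)) • f x‖)
    (s := Ioi (A / 2)) (Ioi_mem_nhds (by linarith)) ?_
    (integrableOn_sq_add_rpow_smul hν hμ hA hf) ?_ ?_ ?_ ?_).2
  · exact Eventually.of_forall fun a =>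
      AEStronglyMeasurable.smul (Measurable.aestronglyMeasurable (by fun_prop)) hmeas
  · exact AEStronglyMeasurable.smul (Measurable.aestronglyMeasurable (by fun_prop)) hmeas
  · refine ae_of_all _ fun x a ha => ?_
    have ha' : A / 2 < a := ha
    have hpos : 0 < x ^ 2 + A / 2 := by positivity
    have hμ0 : 0 ≤ μ := by linarith
    have hpos' : 0 ≤ x ^ 2 + a := by linarith
    rw [norm_smul, norm_smul, ← mul_assoc, norm_mul, norm_neg, Real.norm_of_nonneg hμ0,
      Real.norm_of_nonneg (Real.rpow_nonneg hpos' _),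
      Real.norm_of_nonneg (Real.rpow_nonneg hpos.le _)]
    gcongr ?_ * ?_ * _
    exact Real.rpow_le_rpow_of_nonpos hpos (by linarith) (by linarith)
  · exact (integrableOn_sq_add_rpow_smul hν (by linarith) (by linarith) hf).norm.const_mul _
  · refine ae_of_all _ fun x a ha => ?_
    have ha' : A / 2 < a := ha
    have hpos : 0 < x ^ 2 + a := by nlinarith [sq_nonneg x]
    have := ((hasDerivAt_id a).const_add (x ^ 2)).rpow_const (p := -μ) (Or.inl hpos.ne')
    simp only [id] at this
    convert this.smul_const (f x) using 2
    rw [show -(μ + 1) = -μ - 1 by ring]; ring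

/-- A generalized Stieltjes transform of exponent `ν > 0` determines the function. -/
theorem ae_eq_zero_of_stieltjes_eq_zero [CompleteSpace E] {f : ℝ → E} {ν : ℝ} (hν : 0 < ν)
    (hf : IntegrableOn (fun x => (x ^ 2 + 1) ^ (-ν) • f x) (Ioi 0))
    (h : ∀ A > 0, ∫ x in Ioi 0, (x ^ 2 + A) ^ (-ν) • f x = 0) :
    ∀ᵐ x : ℝ, x ∈ Ioi 0 → f x = 0 := by
  -- A transform that vanishes for all `A` has vanishing derivatives, so all the exponents `ν + n`
  -- vanish too. At `A = 1` these are the moments of `H` with respect to `q`, and the Weierstrass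
  -- theorem applies.
  have hpow : ∀ n : ℕ, ∀ A > 0, ∫ x in Ioi 0, (x ^ 2 + A) ^ (-(ν + n)) • f x = 0 := by
    intro n
    induction n with
    | zero => simpa using h
    | succ n ih =>
      intro A hA
      have hn : (0 : ℝ) ≤ n := n.cast_nonneg
      have h1 := hasDerivAt_integral_sq_add_rpow (μ := ν + n) hν (by linarith) hA hf
      have h2 : HasDerivAt (fun a => ∫ x in Ioi 0, (x ^ 2 + a) ^ (-(ν + n)) • f x) 0 A := by
        refine (hasDerivAt_const A (0 : E)).congr_of_eventuallyEq ?_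
        filter_upwards [Ioi_mem_nhds hA] with a ha using ih a ha
      have h3 := h1.unique h2
      simp_rw [mul_smul] at h3
      rw [integral_smul, smul_eq_zero] at h3
      rcases h3 with h3 | h3
      · exact absurd h3 (by linarith)
      · rw [Nat.cast_succ, ← add_assoc]; exact h3
  set H : ℝ → E := fun x => (x ^ 2 + 1) ^ (-ν) • f x with hH
  set q : ℝ → ℝ := fun x => 1 / (x ^ 2 + 1) with hq
  have hqmem : ∀ x, q x ∈ Icc (0 : ℝ) 1 := fun x => by
    refine ⟨by positivity, ?_⟩
    rw [hq]; simp only; rw [div_le_one (by positivity)]; nlinarith [sq_nonneg x]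
  have hqc : Continuous q := by
    refine continuous_const.div (by fun_prop) fun x => by positivity
  have hint : ∀ φ : ℝ → ℝ, (Measurable fun x => φ (q x)) → (∃ C, ∀ y ∈ Icc (0 : ℝ) 1, |φ y| ≤ C) →
      IntegrableOn (fun x => φ (q x) • H x) (Ioi 0) := by
    rintro φ hφ ⟨C, hC⟩
    exact Integrable.bdd_smul hf C hφ.aestronglyMeasurable
      (ae_of_all _ fun x => hC _ (hqmem x))
  have hbdd : ∀ φ : ℝ → ℝ, Continuous φ → ∃ C, ∀ y ∈ Icc (0 : ℝ) 1, |φ y| ≤ C := fun φ hφ =>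
    isCompact_Icc.exists_bound_of_continuousOn hφ.continuousOn
  have hmono : ∀ n : ℕ, ∫ x in Ioi 0, (q x) ^ n • H x = 0 := by
    intro n
    rw [← hpow n 1 one_pos]
    refine setIntegral_congr_fun measurableSet_Ioi fun x _ => ?_
    have hx : 0 < x ^ 2 + 1 := by positivity
    simp only [hH, hq, smul_smul]
    rw [neg_add, Real.rpow_add hx, Real.rpow_neg hx.le (n : ℝ), Real.rpow_natCast, one_div,
      inv_pow, mul_comm]
  have hpoly : ∀ p : Polynomial ℝ, ∫ x in Ioi 0, p.eval (q x) • H x = 0 := by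
    intro p
    simp_rw [Polynomial.eval_eq_sum_range, Finset.sum_smul]
    rw [integral_finsetSum]
    · refine Finset.sum_eq_zero fun i _ => ?_
      simp_rw [mul_smul]
      rw [integral_smul, hmono, smul_zero]
    · intro i _
      refine hint (fun y => p.coeff i * y ^ i) (by fun_prop) (hbdd _ (by fun_prop))
  have hcont : ∀ φ : ℝ → ℝ, Continuous φ → ∫ x in Ioi 0, φ (q x) • H x = 0 := by
    intro φ hφ
    rw [← norm_le_zero_iff]
    refine le_of_forall_pos_le_add fun e he => ?_
    have hK : 0 ≤ ∫ x in Ioi 0, ‖H x‖ := integral_nonneg fun _ => norm_nonneg _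
    obtain ⟨p, hp⟩ := exists_polynomial_near_of_continuousOn 0 1 φ hφ.continuousOn
      (e / ((∫ x in Ioi 0, ‖H x‖) + 1)) (by positivity)
    have h1 : ∫ x in Ioi 0, φ (q x) • H x = ∫ x in Ioi 0, (φ (q x) - p.eval (q x)) • H x := by
      simp_rw [sub_smul]
      rw [integral_sub (hint φ (by fun_prop) (hbdd _ hφ))
        (hint (fun y => p.eval y) (by fun_prop) (hbdd _ (by fun_prop))), hpoly, sub_zero]
    rw [h1, zero_add]
    calc ‖∫ x in Ioi 0, (φ (q x) - p.eval (q x)) • H x‖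
        ≤ ∫ x in Ioi 0, (e / ((∫ x in Ioi 0, ‖H x‖) + 1)) * ‖H x‖ := by
          refine norm_integral_le_of_norm_le (hf.norm.const_mul _) (ae_of_all _ fun x => ?_)
          rw [norm_smul]
          refine mul_le_mul_of_nonneg_right ?_ (norm_nonneg _)
          rw [Real.norm_eq_abs, abs_sub_comm]
          exact (hp _ (hqmem x)).le
      _ = (e / ((∫ x in Ioi 0, ‖H x‖) + 1)) * ∫ x in Ioi 0, ‖H x‖ := integral_const_mul _ _
      _ ≤ e := by
          rw [div_mul_eq_mul_div, div_le_iff₀ (by positivity)]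
          nlinarith
  have hae : ∀ᵐ x : ℝ, x ∈ Ioi 0 → H x = 0 := by
    refine isOpen_Ioi.ae_eq_zero_of_integral_contDiff_smul_eq_zero hf.locallyIntegrableOn
      fun g hg hgc hgs => ?_
    -- On `(0, ∞)` the map `q` has inverse `y ↦ √(1 / y - 1)`. Clamping `y` from below at `c` keeps
    -- `φ` continuous; the clamped argument is `√((max R 0)² + 1)`, already outside the support of
    -- `g`.
    obtain ⟨φ, hφ, hφq⟩ : ∃ φ : ℝ → ℝ, Continuous φ ∧ ∀ x ∈ Ioi (0 : ℝ), φ (q x) = g x := by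
      obtain ⟨R, hR⟩ := hgc.isCompact.isBounded.subset_closedBall 0
      set c : ℝ := 1 / ((max R 0) ^ 2 + 2) with hcdef
      have hc : 0 < c := by positivity
      have hg0 : ∀ y, max R 0 < y → g y = 0 := by
        intro y hy
        apply image_eq_zero_of_notMem_tsupport
        intro hmem
        have := hR hmem
        rw [mem_closedBall_zero_iff, Real.norm_of_nonneg ((le_max_right R 0).trans hy.le)] at this
        linarith [le_max_left R 0]
      refine ⟨fun y => g (√(1 / max y c - 1)), ?_, ?_⟩
      · refine hg.continuous.comp (Real.continuous_sqrt.comp (Continuous.sub ?_ continuous_const))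
        exact continuous_const.div (by fun_prop) fun y => (lt_max_of_lt_right hc).ne'
      · intro x hx
        have hx0 : 0 < x := hx
        rcases le_total (q x) c with hy | hy
        · simp only [max_eq_right hy]
          rw [hg0, hg0]
          · simp only [hq, hcdef] at hy
            rw [div_le_div_iff_of_pos_left one_pos (by positivity) (by positivity)] at hy
            nlinarith [le_max_right R 0]
          · rw [hcdef, one_div_one_div]
            exact Real.lt_sqrt_of_sq_lt (by linarith)
        · have hsq : √(1 / q x - 1) = x := by
            simp only [hq, one_div_one_div, add_sub_cancel_right]
            exact Real.sqrt_sq hx0.le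
          simp only [max_eq_left hy, hsq]
    have hzero : ∫ x in Ioi 0, g x • H x = 0 := by
      rw [← hcont φ hφ]
      exact setIntegral_congr_fun measurableSet_Ioi fun x hx => by simp only [hφq x hx]
    rw [← hzero]
    symm
    apply setIntegral_eq_integral_of_forall_compl_eq_zero
    intro x hx
    rw [image_eq_zero_of_notMem_tsupport fun hmem => hx (hgs hmem), zero_smul]
  filter_upwards [hae] with x hx hx0
  have h1 : 0 < (x ^ 2 + 1) ^ (-ν) := by positivity
  exact (smul_eq_zero.1 (hx hx0)).resolve_left h1.ne'

end StieltjesInjectivity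

/-! ### Explicit integrals behind the Abel and Poisson transforms -/

section ExplicitIntegrals

/-- A nonnegative derivative of a function continuous up to the endpoints is automatically
integrable, which handles the inverse square root singularities below. -/
lemma integrableOn_and_integral_Ioo_of_deriv_nonneg {g g' : ℝ → ℝ} {a b : ℝ} (hab : a ≤ b)
    (hc : ContinuousOn g (Icc a b)) (hd : ∀ x ∈ Ioo a b, HasDerivAt g (g' x) x)
    (h0 : ∀ x ∈ Ioo a b, 0 ≤ g' x) :
    IntegrableOn g' (Ioo a b) ∧ ∫ x in Ioo a b, g' x = g b - g a := by
  have h1 := intervalIntegral.integrableOn_deriv_of_nonneg hc hd h0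
  refine ⟨h1.mono_set Ioo_subset_Ioc_self, ?_⟩
  rw [← integral_Ioc_eq_integral_Ioo, ← intervalIntegral.integral_of_le hab]
  exact intervalIntegral.integral_eq_sub_of_hasDerivAt_of_le hab hc hd
    ((intervalIntegrable_iff_integrableOn_Ioc_of_le hab).2 h1)

lemma integral_Ioi_of_deriv_nonneg {g g' : ℝ → ℝ} {a l : ℝ}
    (hc : ContinuousWithinAt g (Ici a) a) (hd : ∀ x ∈ Ioi a, HasDerivAt g (g' x) x)
    (h0 : ∀ x ∈ Ioi a, 0 ≤ g' x) (hl : Tendsto g atTop (𝓝 l)) :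
    IntegrableOn g' (Ioi a) ∧ ∫ x in Ioi a, g' x = l - g a :=
  ⟨integrableOn_Ioi_deriv_of_nonneg hc hd h0 hl, integral_Ioi_of_hasDerivAt_of_nonneg hc hd h0 hl⟩

/-- An antiderivative is `arcsin (t R / (ρ √(s² + t²))) / R` with `R = √(ρ² + s²)`. This is the
inner integral when a one-dimensional Poisson kernel meets an upper Abel transform. -/
lemma integral_poisson_div_sqrt_sq_sub_sq {ρ s : ℝ} (hρ : 0 < ρ) (hs : 0 < s) :
    IntegrableOn (fun t => s / (s ^ 2 + t ^ 2) / √(ρ ^ 2 - t ^ 2)) (Ioo 0 ρ) ∧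
      ∫ t in Ioo 0 ρ, s / (s ^ 2 + t ^ 2) / √(ρ ^ 2 - t ^ 2) = Real.pi / 2 / √(ρ ^ 2 + s ^ 2) := by
  set R := √(ρ ^ 2 + s ^ 2) with hR
  have hRpos : 0 < R := by positivity
  have hR2 : R ^ 2 = ρ ^ 2 + s ^ 2 := Real.sq_sqrt (by positivity)
  have h := integrableOn_and_integral_Ioo_of_deriv_nonneg
    (g := fun t => Real.arcsin (t * R / (ρ * √(s ^ 2 + t ^ 2))) / R)
    (g' := fun t => s / (s ^ 2 + t ^ 2) / √(ρ ^ 2 - t ^ 2)) hρ.le ?_ ?_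
    (fun t _ => by positivity)
  · refine ⟨h.1, h.2.trans ?_⟩
    simp only [zero_mul, zero_div, Real.arcsin_zero, sub_zero]
    rw [add_comm (s ^ 2), ← hR, div_self (by positivity), Real.arcsin_one]
  · refine Continuous.continuousOn ?_
    refine Continuous.div_const (Real.continuous_arcsin.comp ?_) _
    refine Continuous.div (by fun_prop) (by fun_prop) fun t => by positivity
  · rintro t ⟨ht0, ht1⟩
    set S := √(s ^ 2 + t ^ 2) with hS
    have hSpos : 0 < S := by positivity
    have hS2 : S ^ 2 = s ^ 2 + t ^ 2 := Real.sq_sqrt (by positivity)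
    set T := √(ρ ^ 2 - t ^ 2) with hT
    have hTarg : 0 < ρ ^ 2 - t ^ 2 := by nlinarith
    have hTpos : 0 < T := Real.sqrt_pos.2 hTarg
    have hT2 : T ^ 2 = ρ ^ 2 - t ^ 2 := Real.sq_sqrt hTarg.le
    have hlt : t * R / (ρ * S) < 1 := by
      rw [div_lt_one (by positivity)]
      refine lt_of_pow_lt_pow_left₀ 2 (by positivity) ?_
      rw [mul_pow, mul_pow, hR2, hS2]
      nlinarith [mul_pos hTarg (pow_pos hs 2)]
    have hgt : 0 < t * R / (ρ * S) := by positivity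
    have hsq : √(1 - (t * R / (ρ * S)) ^ 2) = s * T / (ρ * S) := by
      rw [Real.sqrt_eq_iff_mul_self_eq_of_pos (by positivity)]
      field_simp
      rw [hT2, hS2, hR2]; ring
    have hdS : HasDerivAt (fun x => √(s ^ 2 + x ^ 2)) (t / S) t := by
      convert ((hasDerivAt_pow 2 t).const_add (s ^ 2)).sqrt (by positivity) using 1
      simp only [Nat.cast_ofNat]; rw [← hS]; field_simp; simp
    have hd := (((hasDerivAt_id t).mul_const R).div (hdS.const_mul ρ) (by positivity))
    refine (((Real.hasDerivAt_arcsin (by linarith) hlt.ne).comp t hd).div_const R).congr_deriv ?_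
    simp only [id]
    rw [hsq, ← hS]
    field_simp
    rw [hS2]; ring

/-- With `T = √(t² - ρ²)` and `R = √(ρ² + w²)` one has `w² + t² = T² + R²`, and the integral becomes
that of `(T² + R²)⁻²` in `T`: a rational part and an arctangent. The cube of `R` is what produces
the Poisson kernel in space. -/
lemma integral_Ioi_abel_kernel {ρ w : ℝ} (hρ : 0 < ρ) (hw : 0 < w) :
    IntegrableOn (fun t => t / (w ^ 2 + t ^ 2) ^ 2 / √(t ^ 2 - ρ ^ 2)) (Ioi ρ) ∧
      ∫ t in Ioi ρ, t / (w ^ 2 + t ^ 2) ^ 2 / √(t ^ 2 - ρ ^ 2) =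
        Real.pi / 4 / √(ρ ^ 2 + w ^ 2) ^ 3 := by
  set R := √(ρ ^ 2 + w ^ 2) with hR
  have hRpos : 0 < R := by positivity
  have hR2 : R ^ 2 = ρ ^ 2 + w ^ 2 := Real.sq_sqrt (by positivity)
  have h := integral_Ioi_of_deriv_nonneg (a := ρ) (l := Real.pi / 4 / R ^ 3)
    (g := fun t => √(t ^ 2 - ρ ^ 2) / (w ^ 2 + t ^ 2) / (2 * R ^ 2) +
      Real.arctan (√(t ^ 2 - ρ ^ 2) / R) / (2 * R ^ 3))
    (g' := fun t => t / (w ^ 2 + t ^ 2) ^ 2 / √(t ^ 2 - ρ ^ 2)) ?_ ?_ ?_ ?_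
  · refine ⟨h.1, h.2.trans ?_⟩
    simp
  · refine Continuous.continuousWithinAt ?_
    refine Continuous.add (Continuous.div_const (Continuous.div (by fun_prop) (by fun_prop)
      fun t => by positivity) _) (by fun_prop)
  · intro t ht
    have ht' : ρ < t := ht
    have ht0 : 0 < t := hρ.trans ht'
    set T := √(t ^ 2 - ρ ^ 2) with hT
    have hTarg : 0 < t ^ 2 - ρ ^ 2 := by nlinarith
    have hTpos : 0 < T := Real.sqrt_pos.2 hTarg
    have hT2 : T ^ 2 = t ^ 2 - ρ ^ 2 := Real.sq_sqrt hTarg.le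
    have hdT : HasDerivAt (fun x => √(x ^ 2 - ρ ^ 2)) (t / T) t := by
      convert ((hasDerivAt_pow 2 t).sub_const (ρ ^ 2)).sqrt hTarg.ne' using 1
      simp only [Nat.cast_ofNat]; rw [← hT]; field_simp; simp
    have hd1 := (hdT.div ((hasDerivAt_pow 2 t).const_add (w ^ 2)) (by positivity)).div_const
      (2 * R ^ 2)
    have hd2 := ((hdT.div_const R).arctan).div_const (2 * R ^ 3)
    refine (hd1.add hd2).congr_deriv ?_
    simp only [Nat.cast_ofNat, ← hT]
    have hTw : w ^ 2 + t ^ 2 = T ^ 2 + R ^ 2 := by rw [hT2, hR2]; ring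
    have e1 : 1 + (T / R) ^ 2 = (w ^ 2 + t ^ 2) / R ^ 2 := by rw [hTw]; field_simp; ring
    rw [e1]
    have : 0 < w ^ 2 + t ^ 2 := by positivity
    field_simp
    rw [hTw]; ring
  · intro t ht
    have : 0 < t := hρ.trans ht
    positivity
  · have h1 : Tendsto (fun t : ℝ => √(t ^ 2 - ρ ^ 2) / (w ^ 2 + t ^ 2)) atTop (𝓝 0) := by
      refine squeeze_zero' (Eventually.of_forall fun t => by positivity)
        (g := fun t => t⁻¹) ?_ tendsto_inv_atTop_zero
      filter_upwards [eventually_gt_atTop 0] with t ht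
      rw [div_le_iff₀ (by positivity)]
      calc √(t ^ 2 - ρ ^ 2) ≤ √(t ^ 2) := Real.sqrt_le_sqrt (by nlinarith)
        _ = t := Real.sqrt_sq ht.le
        _ ≤ t⁻¹ * (w ^ 2 + t ^ 2) := by
          have : t⁻¹ * (w ^ 2 + t ^ 2) = w ^ 2 / t + t := by field_simp
          rw [this]; have : 0 ≤ w ^ 2 / t := by positivity
          linarith
    have h2 : Tendsto (fun t : ℝ => √(t ^ 2 - ρ ^ 2) / R) atTop atTop := by
      refine Tendsto.atTop_div_const hRpos (Real.tendsto_sqrt_atTop.comp ?_)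
      exact tendsto_atTop_add_const_right _ _ (tendsto_pow_atTop two_ne_zero)
    have h3 := (Real.tendsto_arctan_atTop.mono_right nhdsWithin_le_nhds).comp h2
    have := (h1.div_const (2 * R ^ 2)).add (h3.div_const (2 * R ^ 3))
    rw [show Real.pi / 4 / R ^ 3 = 0 / (2 * R ^ 2) + Real.pi / 2 / (2 * R ^ 3) by ring]
    exact this

lemma integral_Ioi_poisson_kernel {τ w : ℝ} (hτ : 0 ≤ τ) (hw : 0 < w) :
    IntegrableOn (fun t => t / (w ^ 2 + t ^ 2) ^ 2) (Ioi τ) ∧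
      ∫ t in Ioi τ, t / (w ^ 2 + t ^ 2) ^ 2 = 1 / (2 * (w ^ 2 + τ ^ 2)) := by
  have h := integral_Ioi_of_deriv_nonneg (a := τ) (l := 0)
    (g := fun t => - (1 / (2 * (w ^ 2 + t ^ 2))))
    (g' := fun t => t / (w ^ 2 + t ^ 2) ^ 2) ?_ ?_ ?_ ?_
  · exact ⟨h.1, h.2.trans (by ring)⟩
  · refine Continuous.continuousWithinAt ?_
    exact (continuous_const.div (by fun_prop) fun t => by positivity).neg
  · intro t ht
    have h0 : 0 < w ^ 2 + t ^ 2 := by positivity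
    refine ((((hasDerivAt_pow 2 t).const_add (w ^ 2)).const_mul 2).inv
      (by positivity)).neg.congr_deriv ?_ |>.congr_of_eventuallyEq ?_
    · simp only [Nat.cast_ofNat]; field_simp; norm_num
    · exact Eventually.of_forall fun x => by simp
  · intro t ht
    have : 0 < t := hτ.trans_lt ht
    positivity
  · rw [← neg_zero]
    refine Tendsto.neg ?_
    refine Tendsto.const_div_atTop ?_ _
    refine Tendsto.const_mul_atTop two_pos ?_
    exact tendsto_atTop_add_const_left _ _ (tendsto_pow_atTop two_ne_zero)

lemma integral_div_sqrt_sq_sub_lower {r t : ℝ} (hr : 0 < r) (hrt : r ≤ t) :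
    IntegrableOn (fun τ => τ / √(τ ^ 2 - r ^ 2)) (Ioo r t) ∧
      ∫ τ in Ioo r t, τ / √(τ ^ 2 - r ^ 2) = √(t ^ 2 - r ^ 2) := by
  have h := integrableOn_and_integral_Ioo_of_deriv_nonneg (g := fun τ => √(τ ^ 2 - r ^ 2))
    (g' := fun τ => τ / √(τ ^ 2 - r ^ 2)) hrt (by fun_prop) ?_ ?_
  · simpa using h
  · rintro τ ⟨h1, h2⟩
    have hTarg : 0 < τ ^ 2 - r ^ 2 := by nlinarith
    convert ((hasDerivAt_pow 2 τ).sub_const (r ^ 2)).sqrt hTarg.ne' using 1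
    simp only [Nat.cast_ofNat]; field_simp; simp
  · rintro τ ⟨h1, h2⟩
    have : 0 < τ := hr.trans h1
    positivity

lemma integral_div_sqrt_sq_sub_upper {r t : ℝ} (hr : 0 ≤ r) (hrt : r ≤ t) :
    IntegrableOn (fun ρ => ρ / √(t ^ 2 - ρ ^ 2)) (Ioo r t) ∧
      ∫ ρ in Ioo r t, ρ / √(t ^ 2 - ρ ^ 2) = √(t ^ 2 - r ^ 2) := by
  have h := integrableOn_and_integral_Ioo_of_deriv_nonneg (g := fun τ => -√(t ^ 2 - τ ^ 2))
    (g' := fun τ => τ / √(t ^ 2 - τ ^ 2)) hrt (by fun_prop) ?_ ?_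
  · simpa using h
  · rintro τ ⟨h1, h2⟩
    have hTarg : 0 < t ^ 2 - τ ^ 2 := by nlinarith
    refine (((hasDerivAt_pow 2 τ).const_sub (t ^ 2)).sqrt hTarg.ne').neg.congr_deriv ?_
    simp only [Nat.cast_ofNat]; field_simp; simp
  · rintro τ ⟨h1, h2⟩
    have : 0 < τ := hr.trans_lt h1
    positivity

end ExplicitIntegrals

/-- A function of `(ρ, ζ)` together with candidates for its first and its pure second partial
derivatives. -/
structure PartialJet where
  f : ℝ × ℝ → ℝ
  r : ℝ × ℝ → ℝ
  z : ℝ × ℝ → ℝ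
  rr : ℝ × ℝ → ℝ
  zz : ℝ × ℝ → ℝ

/-! ### Calculus of jets and Green's second identity -/

namespace PartialJet

/-- The entries of the jet are continuous and are the partial derivatives on `Ω`. -/
structure IsOn (J : PartialJet) (Ω : Set (ℝ × ℝ)) : Prop where
  hr : ∀ p ∈ Ω, HasDerivAt (fun x => J.f (x, p.2)) (J.r p) p.1
  hz : ∀ p ∈ Ω, HasDerivAt (fun x => J.f (p.1, x)) (J.z p) p.2
  hrr : ∀ p ∈ Ω, HasDerivAt (fun x => J.r (x, p.2)) (J.rr p) p.1
  hzz : ∀ p ∈ Ω, HasDerivAt (fun x => J.z (p.1, x)) (J.zz p) p.2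
  cf : ContinuousOn J.f Ω
  cr : ContinuousOn J.r Ω
  cz : ContinuousOn J.z Ω
  crr : ContinuousOn J.rr Ω
  czz : ContinuousOn J.zz Ω

/-- The axisymmetric Laplacian. -/
noncomputable def lap (J : PartialJet) (p : ℝ × ℝ) : ℝ := J.rr p + J.zz p + 1 / p.1 * J.r p

def add (J K : PartialJet) : PartialJet where
  f p := J.f p + K.f p
  r p := J.r p + K.r p
  z p := J.z p + K.z p
  rr p := J.rr p + K.rr p
  zz p := J.zz p + K.zz p

def mul (J K : PartialJet) : PartialJet where
  f p := J.f p * K.f p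
  r p := J.r p * K.f p + J.f p * K.r p
  z p := J.z p * K.f p + J.f p * K.z p
  rr p := J.rr p * K.f p + 2 * (J.r p * K.r p) + J.f p * K.rr p
  zz p := J.zz p * K.f p + 2 * (J.z p * K.z p) + J.f p * K.zz p

def comp (φ φ' φ'' : ℝ → ℝ) (J : PartialJet) : PartialJet where
  f p := φ (J.f p)
  r p := φ' (J.f p) * J.r p
  z p := φ' (J.f p) * J.z p
  rr p := φ'' (J.f p) * J.r p ^ 2 + φ' (J.f p) * J.rr p
  zz p := φ'' (J.f p) * J.z p ^ 2 + φ' (J.f p) * J.zz p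

variable {J K : PartialJet} {Ω Ω' : Set (ℝ × ℝ)}

lemma IsOn.mono (hJ : J.IsOn Ω) (h : Ω' ⊆ Ω) : J.IsOn Ω' where
  hr p hp := hJ.hr p (h hp)
  hz p hp := hJ.hz p (h hp)
  hrr p hp := hJ.hrr p (h hp)
  hzz p hp := hJ.hzz p (h hp)
  cf := hJ.cf.mono h
  cr := hJ.cr.mono h
  cz := hJ.cz.mono h
  crr := hJ.crr.mono h
  czz := hJ.czz.mono h

lemma IsOn.add (hJ : J.IsOn Ω) (hK : K.IsOn Ω) : (J.add K).IsOn Ω where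
  hr p hp := (hJ.hr p hp).add (hK.hr p hp)
  hz p hp := (hJ.hz p hp).add (hK.hz p hp)
  hrr p hp := (hJ.hrr p hp).add (hK.hrr p hp)
  hzz p hp := (hJ.hzz p hp).add (hK.hzz p hp)
  cf := hJ.cf.add hK.cf
  cr := hJ.cr.add hK.cr
  cz := hJ.cz.add hK.cz
  crr := hJ.crr.add hK.crr
  czz := hJ.czz.add hK.czz

lemma IsOn.mul (hJ : J.IsOn Ω) (hK : K.IsOn Ω) : (J.mul K).IsOn Ω where
  hr p hp := (hJ.hr p hp).mul (hK.hr p hp)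
  hz p hp := (hJ.hz p hp).mul (hK.hz p hp)
  hrr p hp := by
    refine (((hJ.hrr p hp).mul (hK.hr p hp)).add ((hJ.hr p hp).mul (hK.hrr p hp))).congr_deriv ?_
    simp only [PartialJet.mul]; ring
  hzz p hp := by
    refine (((hJ.hzz p hp).mul (hK.hz p hp)).add ((hJ.hz p hp).mul (hK.hzz p hp))).congr_deriv ?_
    simp only [PartialJet.mul]; ring
  cf := hJ.cf.mul hK.cf
  cr := (hJ.cr.mul hK.cf).add (hJ.cf.mul hK.cr)
  cz := (hJ.cz.mul hK.cf).add (hJ.cf.mul hK.cz)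
  crr := ((hJ.crr.mul hK.cf).add (continuousOn_const.mul (hJ.cr.mul hK.cr))).add
    (hJ.cf.mul hK.crr)
  czz := ((hJ.czz.mul hK.cf).add (continuousOn_const.mul (hJ.cz.mul hK.cz))).add
    (hJ.cf.mul hK.czz)

lemma IsOn.comp {φ φ' φ'' : ℝ → ℝ} (hJ : J.IsOn Ω) (h1 : ∀ x, HasDerivAt φ (φ' x) x)
    (h2 : ∀ x, HasDerivAt φ' (φ'' x) x) (h3 : Continuous φ'') :
    (comp φ φ' φ'' J).IsOn Ω where
  hr p hp := (h1 (J.f p)).comp p.1 (hJ.hr p hp)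
  hz p hp := (h1 (J.f p)).comp p.2 (hJ.hz p hp)
  hrr p hp := by
    refine (((h2 (J.f p)).comp p.1 (hJ.hr p hp)).mul (hJ.hrr p hp)).congr_deriv ?_
    simp only [PartialJet.comp, Function.comp]; ring
  hzz p hp := by
    refine (((h2 (J.f p)).comp p.2 (hJ.hz p hp)).mul (hJ.hzz p hp)).congr_deriv ?_
    simp only [PartialJet.comp, Function.comp]; ring
  cf := (continuous_iff_continuousAt.2 fun x => (h1 x).continuousAt).comp_continuousOn hJ.cf
  cr := ((continuous_iff_continuousAt.2 fun x => (h2 x).continuousAt).comp_continuousOn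
    hJ.cf).mul hJ.cr
  cz := ((continuous_iff_continuousAt.2 fun x => (h2 x).continuousAt).comp_continuousOn
    hJ.cf).mul hJ.cz
  crr := ((h3.comp_continuousOn hJ.cf).mul (hJ.cr.pow 2)).add
    (((continuous_iff_continuousAt.2 fun x => (h2 x).continuousAt).comp_continuousOn
      hJ.cf).mul hJ.crr)
  czz := ((h3.comp_continuousOn hJ.cf).mul (hJ.cz.pow 2)).add
    (((continuous_iff_continuousAt.2 fun x => (h2 x).continuousAt).comp_continuousOn
      hJ.cf).mul hJ.czz)

lemma lap_add (p : ℝ × ℝ) : (J.add K).lap p = J.lap p + K.lap p := by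
  simp only [lap, add]; ring

lemma lap_mul (p : ℝ × ℝ) : (J.mul K).lap p =
    J.lap p * K.f p + 2 * (J.r p * K.r p + J.z p * K.z p) + J.f p * K.lap p := by
  simp only [lap, mul]; ring

lemma lap_comp (φ φ' φ'' : ℝ → ℝ) (p : ℝ × ℝ) : (comp φ φ' φ'' J).lap p =
    φ' (J.f p) * J.lap p + φ'' (J.f p) * (J.r p ^ 2 + J.z p ^ 2) := by
  simp only [lap, comp]; ring

lemma IsOn.continuousOn_lap (hJ : J.IsOn Ω) (h : ∀ p ∈ Ω, p.1 ≠ 0) : ContinuousOn J.lap Ω :=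
  (hJ.crr.add hJ.czz).add ((continuousOn_const.div continuousOn_fst h).mul hJ.cr)

/-- Green's second identity on a rectangle, for a solution `J` and a function `K` that vanishes
to first order on the two vertical sides. -/
theorem green_rectangle {a b c d : ℝ} (ha : 0 < a) (hab : a ≤ b) (hcd : c ≤ d)
    (hJ : J.IsOn (Icc a b ×ˢ Icc c d)) (hK : K.IsOn (Icc a b ×ˢ Icc c d))
    (hlap : ∀ p ∈ Icc a b ×ˢ Icc c d, J.lap p = 0)
    (hside : ∀ ζ ∈ Icc c d, K.f (a, ζ) = 0 ∧ K.r (a, ζ) = 0 ∧ K.f (b, ζ) = 0 ∧ K.r (b, ζ) = 0) :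
    ∫ ζ in c..d, ∫ ρ in a..b, ρ * (J.f (ρ, ζ) * K.lap (ρ, ζ)) =
      (∫ ρ in a..b, ρ * (J.f (ρ, d) * K.z (ρ, d) - J.z (ρ, d) * K.f (ρ, d))) -
      ∫ ρ in a..b, ρ * (J.f (ρ, c) * K.z (ρ, c) - J.z (ρ, c) * K.f (ρ, c)) := by
  -- `ρ (J ΔK - K ΔJ) = A + B`, where `A = ∂_ρ [ρ (J K_ρ - K J_ρ)]` and `B = ∂_ζ [ρ (J K_ζ - K
  -- J_ζ)]`. The integral of `A` in `ρ` vanishes by the conditions on the vertical sides; that of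
  -- `B` in `ζ` gives the horizontal ones.
  set A : ℝ × ℝ → ℝ := fun p => p.1 * (J.f p * K.rr p - K.f p * J.rr p) +
    (J.f p * K.r p - K.f p * J.r p) with hA
  set B : ℝ × ℝ → ℝ := fun p => p.1 * (J.f p * K.zz p - K.f p * J.zz p) with hB
  have cA : ContinuousOn A (Icc a b ×ˢ Icc c d) :=
    (continuousOn_fst.mul ((hJ.cf.mul hK.crr).sub (hK.cf.mul hJ.crr))).add
      ((hJ.cf.mul hK.cr).sub (hK.cf.mul hJ.cr))
  have cB : ContinuousOn B (Icc a b ×ˢ Icc c d) :=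
    continuousOn_fst.mul ((hJ.cf.mul hK.czz).sub (hK.cf.mul hJ.czz))
  have sliceρ : ∀ {F : ℝ × ℝ → ℝ}, ContinuousOn F (Icc a b ×ˢ Icc c d) → ∀ ζ ∈ Icc c d,
      ContinuousOn (fun ρ => F (ρ, ζ)) (Icc a b) := fun hF ζ hζ =>
    hF.comp (by fun_prop) fun ρ hρ => ⟨hρ, hζ⟩
  have sliceζ : ∀ {F : ℝ × ℝ → ℝ}, ContinuousOn F (Icc a b ×ˢ Icc c d) → ∀ ρ ∈ Icc a b,
      ContinuousOn (fun ζ => F (ρ, ζ)) (Icc c d) := fun hF ρ hρ =>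
    hF.comp (by fun_prop) fun ζ hζ => ⟨hρ, hζ⟩
  have hint : ∀ {F : ℝ × ℝ → ℝ}, ContinuousOn F (Icc a b ×ˢ Icc c d) →
      Integrable (Function.uncurry fun ζ ρ => F (ρ, ζ))
        ((volume.restrict (Ioc c d)).prod (volume.restrict (Ioc a b))) := by
    intro F hF
    rw [Measure.prod_restrict]
    have h1 : ContinuousOn (Function.uncurry fun ζ ρ => F (ρ, ζ)) (Icc c d ×ˢ Icc a b) :=
      hF.comp (by fun_prop : ContinuousOn (fun q : ℝ × ℝ => (q.2, q.1)) _) fun q hq => ⟨hq.2, hq.1⟩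
    exact (h1.integrableOn_compact (isCompact_Icc.prod isCompact_Icc)).mono_set
      (prod_mono Ioc_subset_Icc_self Ioc_subset_Icc_self)
  have h1 : ∀ ζ ∈ Icc c d, ∫ ρ in a..b, ρ * (J.f (ρ, ζ) * K.lap (ρ, ζ)) =
      (∫ ρ in a..b, A (ρ, ζ)) + ∫ ρ in a..b, B (ρ, ζ) := by
    intro ζ hζ
    rw [← intervalIntegral.integral_add
      ((sliceρ cA ζ hζ).intervalIntegrable_of_Icc hab)
      ((sliceρ cB ζ hζ).intervalIntegrable_of_Icc hab)]
    refine intervalIntegral.integral_congr fun ρ hρ => ?_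
    rw [uIcc_of_le hab] at hρ
    have h0 : ρ ≠ 0 := (ha.trans_le hρ.1).ne'
    have h2 := hlap (ρ, ζ) ⟨hρ, hζ⟩
    simp only [lap, hA, hB] at h2 ⊢
    have h3 : J.rr (ρ, ζ) = -(J.zz (ρ, ζ) + 1 / ρ * J.r (ρ, ζ)) := by linarith
    rw [h3]; field_simp; ring
  have h2 : ∀ ζ ∈ Icc c d, ∫ ρ in a..b, A (ρ, ζ) = 0 := by
    intro ζ hζ
    have h := intervalIntegral.integral_eq_sub_of_hasDerivAt (a := a) (b := b)
      (f := fun ρ => ρ * (J.f (ρ, ζ) * K.r (ρ, ζ) - K.f (ρ, ζ) * J.r (ρ, ζ)))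
      (f' := fun ρ => A (ρ, ζ)) ?_ ((sliceρ cA ζ hζ).intervalIntegrable_of_Icc hab)
    · rw [h]
      obtain ⟨e1, e2, e3, e4⟩ := hside ζ hζ
      simp [e1, e2, e3, e4]
    · intro ρ hρ
      rw [uIcc_of_le hab] at hρ
      have hp : ((ρ, ζ) : ℝ × ℝ) ∈ Icc a b ×ˢ Icc c d := ⟨hρ, hζ⟩
      refine ((hasDerivAt_id ρ).mul (((hJ.hr _ hp).mul (hK.hrr _ hp)).sub
        ((hK.hr _ hp).mul (hJ.hrr _ hp)))).congr_deriv ?_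
      simp only [hA, id, Pi.sub_apply, Pi.mul_apply]; ring
  have h3 : ∀ ρ ∈ Icc a b, ∫ ζ in c..d, B (ρ, ζ) =
      ρ * (J.f (ρ, d) * K.z (ρ, d) - J.z (ρ, d) * K.f (ρ, d)) -
      ρ * (J.f (ρ, c) * K.z (ρ, c) - J.z (ρ, c) * K.f (ρ, c)) := by
    intro ρ hρ
    refine intervalIntegral.integral_eq_sub_of_hasDerivAt
      (f := fun ζ => ρ * (J.f (ρ, ζ) * K.z (ρ, ζ) - J.z (ρ, ζ) * K.f (ρ, ζ)))
      (f' := fun ζ => B (ρ, ζ)) ?_ ((sliceζ cB ρ hρ).intervalIntegrable_of_Icc hcd)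
    intro ζ hζ
    rw [uIcc_of_le hcd] at hζ
    have hp : ((ρ, ζ) : ℝ × ℝ) ∈ Icc a b ×ˢ Icc c d := ⟨hρ, hζ⟩
    refine ((((hJ.hz _ hp).mul (hK.hzz _ hp)).sub
      ((hJ.hzz _ hp).mul (hK.hz _ hp))).const_mul ρ).congr_deriv ?_
    simp only [hB]; ring
  have hend : ∀ e ∈ Icc c d, IntervalIntegrable (fun ρ =>
      ρ * (J.f (ρ, e) * K.z (ρ, e) - J.z (ρ, e) * K.f (ρ, e))) volume a b := by
    intro e he
    exact (sliceρ (F := fun p => p.1 * (J.f p * K.z p - J.z p * K.f p))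
      (continuousOn_fst.mul ((hJ.cf.mul hK.cz).sub (hJ.cz.mul hK.cf))) e
      he).intervalIntegrable_of_Icc hab
  rw [← intervalIntegral.integral_sub (hend d ⟨hcd, le_rfl⟩) (hend c ⟨le_rfl, hcd⟩)]
  have h4 : ∫ ζ in c..d, ∫ ρ in a..b, ρ * (J.f (ρ, ζ) * K.lap (ρ, ζ)) =
      ∫ ζ in c..d, ∫ ρ in a..b, B (ρ, ζ) := by
    refine intervalIntegral.integral_congr fun ζ hζ => ?_
    rw [uIcc_of_le hcd] at hζ
    simp only [h1 ζ hζ, h2 ζ hζ, zero_add]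
  rw [h4]
  have h5 : ∫ ζ in c..d, ∫ ρ in a..b, B (ρ, ζ) = ∫ ρ in a..b, ∫ ζ in c..d, B (ρ, ζ) := by
    simp_rw [intervalIntegral.integral_of_le hcd, intervalIntegral.integral_of_le hab]
    exact integral_integral_swap (hint cB)
  rw [h5]
  refine intervalIntegral.integral_congr fun ρ hρ => ?_
  rw [uIcc_of_le hab] at hρ
  exact h3 ρ hρ

end PartialJet

/-! ### Slow cutoffs near the axis, the rim and infinity -/

section Cutoff

/-- From the second power on, the positive part is differentiable at its corner as well. Using this
twice makes the cubic cutoff twice continuously differentiable. -/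
lemma hasDerivAt_max_zero_pow (n : ℕ) (x : ℝ) :
    HasDerivAt (fun y : ℝ => max 0 y ^ (n + 2)) ((n + 2) * max 0 x ^ (n + 1)) x := by
  rcases lt_trichotomy x 0 with hx | rfl | hx
  · rw [max_eq_left hx.le, zero_pow (by omega), mul_zero]
    refine (hasDerivAt_const x (0 : ℝ)).congr_of_eventuallyEq ?_
    filter_upwards [Iio_mem_nhds hx] with y hy
    rw [max_eq_left (le_of_lt hy), zero_pow (by omega)]
  · rw [max_self, zero_pow (by omega), mul_zero, hasDerivAt_iff_isLittleO_nhds_zero]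
    simp only [zero_add, max_self, smul_zero, sub_zero]
    rw [zero_pow (by omega)]
    simp only [sub_zero]
    refine Asymptotics.IsBigO.trans_isLittleO (g := fun h : ℝ => h ^ (n + 2)) ?_
      (Asymptotics.isLittleO_pow_id (by omega))
    refine Asymptotics.IsBigO.of_bound 1 (Eventually.of_forall fun h => ?_)
    rw [norm_pow, norm_pow, one_mul]
    refine pow_le_pow_left₀ (norm_nonneg _) ?_ _
    rw [Real.norm_of_nonneg (le_max_left _ _), Real.norm_eq_abs]
    exact max_le (abs_nonneg _) (le_abs_self _)
  · rw [max_eq_right hx.le]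
    refine ((hasDerivAt_pow (n + 2) x).congr_deriv ?_).congr_of_eventuallyEq ?_
    · push_cast; simp
    · filter_upwards [Ioi_mem_nhds hx] with y hy
      rw [max_eq_right (le_of_lt hy)]

/-- The cutoff profile `(1 - x / Λ)₊³` and its first two derivatives. -/
noncomputable def cutoff (Λ x : ℝ) : ℝ := max 0 (1 - x / Λ) ^ 3
noncomputable def cutoffDeriv (Λ x : ℝ) : ℝ := -(3 / Λ) * max 0 (1 - x / Λ) ^ 2
noncomputable def cutoffDeriv₂ (Λ x : ℝ) : ℝ := 6 / Λ ^ 2 * max 0 (1 - x / Λ)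

lemma hasDerivAt_cutoff (Λ x : ℝ) : HasDerivAt (cutoff Λ) (cutoffDeriv Λ x) x := by
  have h := (hasDerivAt_max_zero_pow 1 (1 - x / Λ)).comp x
    (((hasDerivAt_id x).div_const Λ).const_sub 1)
  refine h.congr_deriv ?_
  simp only [cutoffDeriv]; push_cast; ring

lemma hasDerivAt_cutoffDeriv (Λ x : ℝ) : HasDerivAt (cutoffDeriv Λ) (cutoffDeriv₂ Λ x) x := by
  have h := ((hasDerivAt_max_zero_pow 0 (1 - x / Λ)).comp x
    (((hasDerivAt_id x).div_const Λ).const_sub 1)).const_mul (-(3 / Λ))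
  refine h.congr_deriv ?_
  simp only [cutoffDeriv₂]; push_cast; ring

lemma continuous_cutoffDeriv₂ (Λ : ℝ) : Continuous (cutoffDeriv₂ Λ) := by
  unfold cutoffDeriv₂; fun_prop

variable {Λ x : ℝ}

lemma max_zero_one_sub_div_mem (hΛ : 1 ≤ Λ) (hx : 0 ≤ x) : max 0 (1 - x / Λ) ∈ Icc (0 : ℝ) 1 :=
  ⟨le_max_left _ _, max_le zero_le_one (by have : 0 ≤ x / Λ := by positivity
                                           linarith)⟩

lemma cutoff_mem (hΛ : 1 ≤ Λ) (hx : 0 ≤ x) : cutoff Λ x ∈ Icc (0 : ℝ) 1 := by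
  have h := max_zero_one_sub_div_mem hΛ hx
  exact ⟨pow_nonneg h.1 _, pow_le_one₀ h.1 h.2⟩

lemma abs_cutoffDeriv_le (hΛ : 1 ≤ Λ) (hx : 0 ≤ x) : |cutoffDeriv Λ x| ≤ 3 / Λ := by
  have h := max_zero_one_sub_div_mem hΛ hx
  rw [cutoffDeriv, abs_mul, abs_neg, abs_of_nonneg (by positivity : 0 ≤ 3 / Λ),
    abs_of_nonneg (pow_nonneg h.1 _)]
  exact mul_le_of_le_one_right (by positivity) (pow_le_one₀ h.1 h.2)

lemma abs_cutoffDeriv₂_le (hΛ : 1 ≤ Λ) (hx : 0 ≤ x) : |cutoffDeriv₂ Λ x| ≤ 6 / Λ := by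
  have h := max_zero_one_sub_div_mem hΛ hx
  rw [cutoffDeriv₂, abs_mul, abs_of_nonneg (by positivity : 0 ≤ 6 / Λ ^ 2), abs_of_nonneg h.1]
  refine (mul_le_of_le_one_right (by positivity) h.2).trans ?_
  exact div_le_div_of_nonneg_left (by norm_num) (by linarith) (by nlinarith)

lemma cutoff_eq_zero (hΛ : 1 ≤ Λ) (hx : Λ ≤ x) : cutoff Λ x = 0 ∧ cutoffDeriv Λ x = 0 := by
  have : max 0 (1 - x / Λ) = 0 := by
    refine max_eq_left ?_
    have : 1 ≤ x / Λ := by rw [le_div_iff₀ (by linarith)]; linarith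
    linarith
  simp [cutoff, cutoffDeriv, this]

lemma tendsto_cutoff (x : ℝ) : Tendsto (fun Λ => cutoff Λ x) atTop (𝓝 1) := by
  have h : Tendsto (fun Λ : ℝ => max 0 (1 - x / Λ) ^ 3) atTop (𝓝 (max 0 (1 - 0) ^ 3)) :=
    (tendsto_const_nhds.max (tendsto_const_nhds.sub (tendsto_const_nhds.div_atTop tendsto_id))).pow 3
  simpa [cutoff] using h

/-- The profile `log (1 + y²)` and its first two derivatives. -/
noncomputable def logSq (y : ℝ) : ℝ := Real.log (1 + y ^ 2)
noncomputable def logSqDeriv (y : ℝ) : ℝ := 2 * y / (1 + y ^ 2)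
noncomputable def logSqDeriv₂ (y : ℝ) : ℝ := 2 * (1 - y ^ 2) / (1 + y ^ 2) ^ 2

lemma hasDerivAt_logSq (y : ℝ) : HasDerivAt logSq (logSqDeriv y) y := by
  have h : (1 : ℝ) + y ^ 2 ≠ 0 := by positivity
  refine (((hasDerivAt_pow 2 y).const_add 1).log h).congr_deriv ?_
  simp [logSqDeriv]

lemma hasDerivAt_logSqDeriv (y : ℝ) : HasDerivAt logSqDeriv (logSqDeriv₂ y) y := by
  have h : (1 : ℝ) + y ^ 2 ≠ 0 := by positivity
  refine (((hasDerivAt_id y).const_mul 2).div ((hasDerivAt_pow 2 y).const_add 1) h).congr_deriv ?_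
  simp only [logSqDeriv₂, id]; push_cast; field_simp; ring

lemma continuous_logSqDeriv₂ : Continuous logSqDeriv₂ := by
  unfold logSqDeriv₂
  exact Continuous.div (by fun_prop) (by fun_prop) fun y => by positivity

lemma logSq_nonneg (y : ℝ) : 0 ≤ logSq y := Real.log_nonneg (by nlinarith [sq_nonneg y])

lemma abs_logSqDeriv_le (y : ℝ) : |logSqDeriv y| ≤ 1 := by
  rw [logSqDeriv, abs_div, abs_of_pos (by positivity : 0 < 1 + y ^ 2), div_le_one (by positivity),
    abs_le]
  constructor <;> nlinarith [sq_nonneg (y - 1), sq_nonneg (y + 1)]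

/-- The gain `1 / (1 + y²)`, taken at the logarithm `y` of a distance `r`, turns the divergent `dr /
r` into `dr / (r (1 + log² r))`, which is integrable at both ends. -/
lemma logSqDeriv_sq_le (y : ℝ) : logSqDeriv y ^ 2 ≤ 4 / (1 + y ^ 2) := by
  rw [logSqDeriv, div_pow, div_le_div_iff₀ (by positivity) (by positivity)]
  nlinarith [sq_nonneg y, sq_nonneg (y ^ 2)]

lemma abs_logSqDeriv₂_le (y : ℝ) : |logSqDeriv₂ y| ≤ 2 / (1 + y ^ 2) := by
  rw [logSqDeriv₂, abs_div, abs_of_pos (by positivity : 0 < (1 + y ^ 2) ^ 2),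
    div_le_div_iff₀ (by positivity) (by positivity)]
  have h : |2 * (1 - y ^ 2)| ≤ 2 * (1 + y ^ 2) := by
    rw [abs_le]; constructor <;> nlinarith [sq_nonneg y]
  nlinarith [sq_nonneg y]

/-- The half-plane without the rim. -/
def rimless (ρ₀ : ℝ) : Set (ℝ × ℝ) := {p | 0 < p.1 ∧ p ≠ (ρ₀, 0)}

/-- The squared distance to the rim. -/
def rimDistSq (ρ₀ : ℝ) (p : ℝ × ℝ) : ℝ := (p.1 - ρ₀) ^ 2 + p.2 ^ 2

lemma rimDistSq_pos {ρ₀ : ℝ} {p : ℝ × ℝ} (hp : p ≠ (ρ₀, 0)) : 0 < rimDistSq ρ₀ p := by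
  rw [rimDistSq]
  rcases eq_or_ne p.2 0 with h | h
  · have : p.1 - ρ₀ ≠ 0 := fun h' => hp (Prod.ext (by simpa [sub_eq_zero] using h') h)
    positivity
  · positivity

/-- The jet of `log ρ`. -/
noncomputable def logAxisJet : PartialJet where
  f p := Real.log p.1
  r p := 1 / p.1
  z _ := 0
  rr p := -(1 / p.1 ^ 2)
  zz _ := 0

/-- The jet of the logarithm of the distance to the rim. -/
noncomputable def logRimJet (ρ₀ : ℝ) : PartialJet where
  f p := Real.log (rimDistSq ρ₀ p) / 2
  r p := (p.1 - ρ₀) / rimDistSq ρ₀ p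
  z p := p.2 / rimDistSq ρ₀ p
  rr p := (p.2 ^ 2 - (p.1 - ρ₀) ^ 2) / rimDistSq ρ₀ p ^ 2
  zz p := ((p.1 - ρ₀) ^ 2 - p.2 ^ 2) / rimDistSq ρ₀ p ^ 2

lemma isOn_logAxisJet (ρ₀ : ℝ) : logAxisJet.IsOn (rimless ρ₀) where
  hr p hp := (Real.hasDerivAt_log hp.1.ne').congr_deriv (by simp [logAxisJet])
  hz p _ := hasDerivAt_const p.2 (Real.log p.1)
  hrr p hp := by
    have h := hasDerivAt_inv hp.1.ne'
    refine (h.congr_deriv (by simp [logAxisJet])).congr_of_eventuallyEq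
      (Eventually.of_forall fun x => by simp [logAxisJet])
  hzz p _ := hasDerivAt_const p.2 (0 : ℝ)
  cf := continuousOn_fst.log fun p hp => hp.1.ne'
  cr := continuousOn_const.div continuousOn_fst fun p hp => hp.1.ne'
  cz := continuousOn_const
  crr := (continuousOn_const.div (continuousOn_fst.pow 2) fun p hp => (pow_pos hp.1 2).ne').neg
  czz := continuousOn_const

lemma isOn_logRimJet (ρ₀ : ℝ) : (logRimJet ρ₀).IsOn (rimless ρ₀) := by
  have hne : ∀ p ∈ rimless ρ₀, rimDistSq ρ₀ p ≠ 0 := fun p hp => (rimDistSq_pos hp.2).ne'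
  have hc : Continuous (rimDistSq ρ₀) := by unfold rimDistSq; fun_prop
  have dr : ∀ p : ℝ × ℝ, HasDerivAt (fun x => rimDistSq ρ₀ (x, p.2)) (2 * (p.1 - ρ₀)) p.1 := by
    intro p
    refine ((((hasDerivAt_id p.1).sub_const ρ₀).pow 2).add_const (p.2 ^ 2)).congr_deriv ?_
    simp
  have dz : ∀ p : ℝ × ℝ, HasDerivAt (fun x => rimDistSq ρ₀ (p.1, x)) (2 * p.2) p.2 := by
    intro p
    refine ((hasDerivAt_pow 2 p.2).const_add ((p.1 - ρ₀) ^ 2)).congr_deriv ?_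
    simp
  refine ⟨fun p hp => ?_, fun p hp => ?_, fun p hp => ?_, fun p hp => ?_, ?_, ?_, ?_, ?_, ?_⟩
  · refine (((dr p).log (hne p hp)).div_const 2).congr_deriv ?_
    simp only [logRimJet, Prod.mk.eta]; have := hne p hp; field_simp
  · refine (((dz p).log (hne p hp)).div_const 2).congr_deriv ?_
    simp only [logRimJet, Prod.mk.eta]; have := hne p hp; field_simp
  · refine (((hasDerivAt_id p.1).sub_const ρ₀).div (dr p) (hne p hp)).congr_deriv ?_
    simp only [logRimJet, Prod.mk.eta, id]; congr 1; rw [rimDistSq]; ring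
  · refine ((hasDerivAt_id p.2).div (dz p) (hne p hp)).congr_deriv ?_
    simp only [logRimJet, Prod.mk.eta, id]; congr 1; rw [rimDistSq]; ring
  · exact (hc.continuousOn.log hne).div_const 2
  · exact ContinuousOn.div (by fun_prop) hc.continuousOn hne
  · exact ContinuousOn.div (by fun_prop) hc.continuousOn hne
  · exact ContinuousOn.div (by fun_prop) (hc.continuousOn.pow 2) fun p hp => pow_ne_zero 2 (hne p hp)
  · exact ContinuousOn.div (by fun_prop) (hc.continuousOn.pow 2) fun p hp => pow_ne_zero 2 (hne p hp)

/-- An exhaustion of the half-plane without the rim: it tends to infinity at the axis, at the rim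
and at infinity, so slowly that cutting off along it costs nothing. -/
noncomputable def exhaustion (ρ₀ : ℝ) : PartialJet :=
  (PartialJet.comp logSq logSqDeriv logSqDeriv₂ logAxisJet).add
    (PartialJet.comp logSq logSqDeriv logSqDeriv₂ (logRimJet ρ₀))

noncomputable def cutoffJet (ρ₀ Λ : ℝ) : PartialJet :=
  PartialJet.comp (cutoff Λ) (cutoffDeriv Λ) (cutoffDeriv₂ Λ) (exhaustion ρ₀)

lemma isOn_exhaustion (ρ₀ : ℝ) : (exhaustion ρ₀).IsOn (rimless ρ₀) :=
  ((isOn_logAxisJet ρ₀).comp hasDerivAt_logSq hasDerivAt_logSqDeriv continuous_logSqDeriv₂).add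
    ((isOn_logRimJet ρ₀).comp hasDerivAt_logSq hasDerivAt_logSqDeriv continuous_logSqDeriv₂)

lemma isOn_cutoffJet (ρ₀ Λ : ℝ) : (cutoffJet ρ₀ Λ).IsOn (rimless ρ₀) :=
  (isOn_exhaustion ρ₀).comp (hasDerivAt_cutoff Λ) (hasDerivAt_cutoffDeriv Λ)
    (continuous_cutoffDeriv₂ Λ)

lemma exhaustion_nonneg (ρ₀ : ℝ) (p : ℝ × ℝ) : 0 ≤ (exhaustion ρ₀).f p :=
  add_nonneg (logSq_nonneg _) (logSq_nonneg _)

lemma cutoffJet_f_mem {ρ₀ Λ : ℝ} (hΛ : 1 ≤ Λ) (p : ℝ × ℝ) : (cutoffJet ρ₀ Λ).f p ∈ Icc (0 : ℝ) 1 :=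
  cutoff_mem hΛ (exhaustion_nonneg ρ₀ p)

lemma abs_le_exp_of_logSq_le {y Λ : ℝ} (h : logSq y ≤ Λ) : |y| ≤ Real.exp Λ := by
  have h1 : 1 + y ^ 2 ≤ Real.exp Λ := by
    rw [← Real.log_le_iff_le_exp (by positivity)]; exact h
  have : |y| ≤ 1 + y ^ 2 := by
    rw [← sq_abs]; nlinarith [sq_nonneg (|y| - 1), abs_nonneg y]
  linarith

/-- The supports of the cutoffs stay away from the axis, from the rim and from infinity. -/
lemma exists_support_cutoffJet (ρ₀ : ℝ) (hρ₀ : 0 < ρ₀) (Λ : ℝ) (hΛ : 1 ≤ Λ) (N : ℝ) :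
    ∃ a b r : ℝ, 0 < a ∧ a < b ∧ N < b ∧ ρ₀ < b ∧ 0 < r ∧ ∀ p : ℝ × ℝ,
      (p.1 ≤ a ∨ b ≤ p.1 ∨ b ≤ p.2 ∨ rimDistSq ρ₀ p < r ^ 2) → 0 < p.1 → p ≠ (ρ₀, 0) →
      (cutoffJet ρ₀ Λ).f p = 0 ∧ (cutoffJet ρ₀ Λ).r p = 0 ∧ (cutoffJet ρ₀ Λ).z p = 0 := by
  -- Below the level `Λ` of the exhaustion, `|log ρ|` and `|log d|` are at most `e`, with `d` the
  -- distance to the rim. Thresholds with logarithm `±(e + 1)` therefore lie in the region where the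
  -- cutoff is zero. The minimum with `ρ₀ / 2` only secures `a < b`.
  set e := Real.exp Λ with he
  set b : ℝ := ρ₀ + Real.exp (e + 1) + |N| + 1 with hb
  have hE : 0 < Real.exp (e + 1) := Real.exp_pos _
  have hN := abs_nonneg N
  refine ⟨min (Real.exp (-(e + 1))) (ρ₀ / 2), b, Real.exp (-(e + 1)), by positivity, ?_, ?_, ?_,
    Real.exp_pos _, ?_⟩
  · have := min_le_right (Real.exp (-(e + 1))) (ρ₀ / 2); linarith
  · have := le_abs_self N; linarith
  · linarith
  · intro p hp hp1 hp2
    have hd := rimDistSq_pos hp2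
    have key : Λ ≤ (exhaustion ρ₀).f p := by
      by_contra hlt
      push Not at hlt
      have h1 : |Real.log p.1| ≤ e := by
        refine abs_le_exp_of_logSq_le ?_
        have := logSq_nonneg ((logRimJet ρ₀).f p)
        have h2 : (exhaustion ρ₀).f p = logSq (Real.log p.1) + logSq ((logRimJet ρ₀).f p) := rfl
        linarith
      have h2 : |Real.log (rimDistSq ρ₀ p) / 2| ≤ e := by
        refine abs_le_exp_of_logSq_le ?_
        have := logSq_nonneg (Real.log p.1)
        have h2 : (exhaustion ρ₀).f p = logSq (Real.log p.1) +
          logSq (Real.log (rimDistSq ρ₀ p) / 2) := rfl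
        linarith
      rw [abs_le] at h1 h2
      have hlarge : Real.exp (e + 1) ^ 2 ≤ rimDistSq ρ₀ p → False := by
        intro h
        have := Real.log_le_log (by positivity) h
        rw [Real.log_pow, Real.log_exp] at this
        push_cast at this
        linarith [h2.2]
      rcases hp with h | h | h | h
      · have := Real.log_le_log hp1 (h.trans (min_le_left _ _))
        rw [Real.log_exp] at this
        linarith [h1.1]
      · refine hlarge ?_
        rw [rimDistSq]
        have : Real.exp (e + 1) ≤ p.1 - ρ₀ := by linarith
        nlinarith [sq_nonneg p.2]
      · refine hlarge ?_
        rw [rimDistSq]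
        have : Real.exp (e + 1) ≤ p.2 := by linarith
        nlinarith [sq_nonneg (p.1 - ρ₀)]
      · have := Real.log_le_log hd h.le
        rw [Real.log_pow, Real.log_exp] at this
        push_cast at this
        linarith [h2.1]
    obtain ⟨h0, h1⟩ := cutoff_eq_zero hΛ key
    simp [cutoffJet, PartialJet.comp, h0, h1]

end Cutoff

/-! ### An integrable majorant for the cutoff commutator -/

section CutoffBounds

/-- A majorant, up to a factor `1 / Λ`, of the commutator of the Laplacian with the cutoff. -/
noncomputable def cutoffMajorant (ρ₀ : ℝ) (p : ℝ × ℝ) : ℝ :=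
  10 * (1 / (1 + p.2 ^ 2) * (1 / (p.1 * (1 + Real.log p.1 ^ 2)))) +
  10 * (1 / (rimDistSq ρ₀ p * (1 + (Real.log (rimDistSq ρ₀ p) / 2) ^ 2))) +
  3 * (1 / ((1 + p.1 ^ 2 + p.2 ^ 2) * √(rimDistSq ρ₀ p))) +
  1 / √(1 + p.1 ^ 2 + p.2 ^ 2) ^ 3

variable {ρ₀ : ℝ} {p : ℝ × ℝ}

/-- `log ρ` is annihilated by the axisymmetric Laplacian, so only the second derivative of the
profile `log (1 + y²)` contributes. -/
lemma axis_bounds (hp : 0 < p.1) :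
    let J := PartialJet.comp logSq logSqDeriv logSqDeriv₂ logAxisJet
    |J.r p| ≤ 1 / p.1 ∧ J.z p = 0 ∧ |J.lap p| ≤ 2 / (p.1 ^ 2 * (1 + Real.log p.1 ^ 2)) ∧
      J.r p ^ 2 ≤ 4 / (p.1 ^ 2 * (1 + Real.log p.1 ^ 2)) := by
  intro J
  refine ⟨?_, ?_, ?_, ?_⟩
  · simp only [J, PartialJet.comp, logAxisJet]
    rw [abs_mul, abs_of_pos (by positivity : 0 < 1 / p.1)]
    exact mul_le_of_le_one_left (by positivity) (abs_logSqDeriv_le _)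
  · simp [J, PartialJet.comp, logAxisJet]
  · simp only [J]
    rw [PartialJet.lap_comp]
    have h0 : logAxisJet.lap p = 0 := by
      simp only [PartialJet.lap, logAxisJet]; field_simp; ring
    rw [h0, mul_zero, zero_add]
    simp only [logAxisJet]
    rw [abs_mul, abs_of_nonneg (by positivity : 0 ≤ (1 / p.1) ^ 2 + 0 ^ 2)]
    refine (mul_le_mul_of_nonneg_right (abs_logSqDeriv₂_le _) (by positivity)).trans_eq ?_
    field_simp; ring
  · simp only [J, PartialJet.comp, logAxisJet]
    rw [mul_pow]
    refine (mul_le_mul_of_nonneg_right (logSqDeriv_sq_le _) (by positivity)).trans_eq ?_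
    field_simp

/-- The logarithm of the distance to the rim is harmonic in the plane but not in space: besides the
second derivative of the profile there remains `J_ρ / ρ`, the source of the term `1 / (ρ d)`. -/
lemma rim_bounds (hp1 : 0 < p.1) (hp : p ≠ (ρ₀, 0)) :
    let J := PartialJet.comp logSq logSqDeriv logSqDeriv₂ (logRimJet ρ₀)
    let Y := Real.log (rimDistSq ρ₀ p) / 2
    |J.r p| ≤ 1 / √(rimDistSq ρ₀ p) ∧ |J.z p| ≤ 1 / √(rimDistSq ρ₀ p) ∧
    |J.lap p| ≤ 2 / (rimDistSq ρ₀ p * (1 + Y ^ 2)) + 1 / (p.1 * √(rimDistSq ρ₀ p)) ∧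
    J.r p ^ 2 + J.z p ^ 2 ≤ 4 / (rimDistSq ρ₀ p * (1 + Y ^ 2)) := by
  intro J Y
  have hd := rimDistSq_pos hp
  set d2 := rimDistSq ρ₀ p with hd2
  set d := √d2 with hdd
  have hdp : 0 < d := Real.sqrt_pos.2 hd
  have hdsq : d2 = d ^ 2 := (Real.sq_sqrt hd.le).symm
  have hsum : (p.1 - ρ₀) ^ 2 + p.2 ^ 2 = d2 := rfl
  have hx : |p.1 - ρ₀| ≤ d := Real.abs_le_sqrt (by nlinarith [sq_nonneg p.2])
  have hy : |p.2| ≤ d := Real.abs_le_sqrt (by nlinarith [sq_nonneg (p.1 - ρ₀)])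
  have hr : |(p.1 - ρ₀) / d2| ≤ 1 / d := by
    rw [abs_div, abs_of_pos hd, div_le_div_iff₀ hd hdp, hdsq]; nlinarith
  have hz : |p.2 / d2| ≤ 1 / d := by
    rw [abs_div, abs_of_pos hd, div_le_div_iff₀ hd hdp, hdsq]; nlinarith
  have hgrad : ((p.1 - ρ₀) / d2) ^ 2 + (p.2 / d2) ^ 2 = 1 / d2 := by
    rw [div_pow, div_pow, ← add_div, hsum]; field_simp
  have hJr : |J.r p| ≤ 1 / d := by
    simp only [J, PartialJet.comp, logRimJet]
    rw [abs_mul]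
    exact (mul_le_of_le_one_left (abs_nonneg _) (abs_logSqDeriv_le _)).trans hr
  refine ⟨hJr, ?_, ?_, ?_⟩
  · simp only [J, PartialJet.comp, logRimJet]
    rw [abs_mul]
    exact (mul_le_of_le_one_left (abs_nonneg _) (abs_logSqDeriv_le _)).trans hz
  · have h1 : J.lap p = logSqDeriv₂ Y * (1 / d2) + 1 / p.1 * J.r p := by
      simp only [J]
      rw [PartialJet.lap_comp]
      simp only [PartialJet.lap, PartialJet.comp, logRimJet]
      rw [← hd2, hgrad]; ring
    rw [h1]
    refine (abs_add_le _ _).trans (add_le_add ?_ ?_)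
    · rw [abs_mul, abs_of_pos (by positivity : 0 < 1 / d2)]
      refine (mul_le_mul_of_nonneg_right (abs_logSqDeriv₂_le _) (by positivity)).trans_eq ?_
      field_simp
    · rw [abs_mul, abs_of_pos (by positivity : 0 < 1 / p.1)]
      refine (mul_le_mul_of_nonneg_left hJr (by positivity)).trans_eq ?_
      field_simp
  · have h1 : J.r p ^ 2 + J.z p ^ 2 = logSqDeriv Y ^ 2 * (1 / d2) := by
      simp only [J, PartialJet.comp, logRimJet]
      rw [← hgrad]; ring
    rw [h1]
    refine (mul_le_mul_of_nonneg_right (logSqDeriv_sq_le _) (by positivity)).trans_eq ?_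
    field_simp

/-- The real inequality behind `abs_lap_cutoff_mul_le`. Here `θ1`, `θ2` are the derivatives of the
cutoff profile; `L`, `g2`, `er`, `ez` are the Laplacian, squared gradient and gradient of the
exhaustion; `g`, `gr`, `gz` are the kernel and its gradient. -/
lemma commutator_arith {ρ Λ C R d ax rm θ1 θ2 L g2 er ez g gr gz : ℝ} (hp1 : 0 < ρ) (hΛ0 : 0 < Λ)
    (hC : 0 ≤ C) (hR : 0 < R) (hdp : 0 < d) (hax0 : 0 ≤ ax) (hrm0 : 0 ≤ rm) (t1 : |θ1| ≤ 3 / Λ)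
    (t2 : |θ2| ≤ 6 / Λ) (hElap : |L| ≤ 2 * ax + 2 * rm + 1 / (ρ * d)) (hgr0 : 0 ≤ g2)
    (hEgrad : g2 ≤ 8 * ax + 8 * rm) (hEr : |er| ≤ 1 / ρ + 1 / d) (hEz : |ez| ≤ 1 / d)
    (hG : |g| ≤ C / R ^ 2) (hGr : |gr| ≤ C / R ^ 3) (hGz : |gz| ≤ C / R ^ 3) :
    |ρ * (θ1 * L * g) + ρ * (θ2 * g2 * g) +
      (2 * (ρ * (θ1 * er * gr)) + 2 * (ρ * (θ1 * ez * gz)))| ≤ 6 * C / Λ *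
      (10 * (ρ * ax / R ^ 2) + 10 * (ρ / R ^ 2 * rm) + 1 / (R ^ 2 * d)
        + 1 / R ^ 3 + 2 * (ρ / (R ^ 3 * d))) := by
  have s1 : |ρ * (θ1 * L * g)| ≤
      ρ * (3 / Λ * (2 * ax + 2 * rm + 1 / (ρ * d)) * (C / R ^ 2)) := by
    rw [abs_mul, abs_mul, abs_mul, abs_of_pos hp1]; gcongr
  have s2 : |ρ * (θ2 * g2 * g)| ≤
      ρ * (6 / Λ * (8 * ax + 8 * rm) * (C / R ^ 2)) := by
    rw [abs_mul, abs_mul, abs_mul, abs_of_pos hp1, abs_of_nonneg hgr0]; gcongr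
  have s3 : |ρ * (θ1 * er * gr)| ≤ ρ * (3 / Λ * (1 / ρ + 1 / d) * (C / R ^ 3)) := by
    rw [abs_mul, abs_mul, abs_mul, abs_of_pos hp1]; gcongr
  have s4 : |ρ * (θ1 * ez * gz)| ≤ ρ * (3 / Λ * (1 / d) * (C / R ^ 3)) := by
    rw [abs_mul, abs_mul, abs_mul, abs_of_pos hp1]; gcongr
  refine (abs_add_le _ _).trans ?_
  refine (add_le_add (abs_add_le _ _) (abs_add_le _ _)).trans ?_
  rw [abs_mul 2, abs_mul 2, abs_two]
  have hpos : 0 ≤ 6 * C / Λ * (ρ * ax / R ^ 2 + ρ / R ^ 2 * rm + 1 / 2 * (1 / (R ^ 2 * d))) := by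
    positivity
  have e1 : ρ * (3 / Λ * (2 * ax + 2 * rm + 1 / (ρ * d)) * (C / R ^ 2)) =
      6 * C / Λ * (ρ * ax / R ^ 2 + ρ / R ^ 2 * rm + 1 / 2 * (1 / (R ^ 2 * d))) := by
    field_simp; ring
  have e2 : ρ * (6 / Λ * (8 * ax + 8 * rm) * (C / R ^ 2)) =
      6 * C / Λ * (8 * (ρ * ax / R ^ 2) + 8 * (ρ / R ^ 2 * rm)) := by ring
  have e3 : ρ * (3 / Λ * (1 / ρ + 1 / d) * (C / R ^ 3)) =
      6 * C / Λ * (1 / 2 * (1 / R ^ 3) + 1 / 2 * (ρ / (R ^ 3 * d))) := by field_simp; ring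
  have e4 : ρ * (3 / Λ * (1 / d) * (C / R ^ 3)) =
      6 * C / Λ * (1 / 2 * (ρ / (R ^ 3 * d))) := by field_simp; ring
  rw [e1] at s1; rw [e2] at s2; rw [e3] at s3; rw [e4] at s4
  linarith

lemma exhaustion_bounds (hp1 : 0 < p.1) (hp : p ≠ (ρ₀, 0)) {ax rm d : ℝ}
    (hd : d = √(rimDistSq ρ₀ p)) (hax : ax = 1 / (p.1 ^ 2 * (1 + Real.log p.1 ^ 2)))
    (hrm : rm = 1 / (rimDistSq ρ₀ p * (1 + (Real.log (rimDistSq ρ₀ p) / 2) ^ 2))) :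
    |(exhaustion ρ₀).r p| ≤ 1 / p.1 + 1 / d ∧ |(exhaustion ρ₀).z p| ≤ 1 / d ∧
    |(exhaustion ρ₀).lap p| ≤ 2 * ax + 2 * rm + 1 / (p.1 * d) ∧
    (exhaustion ρ₀).r p ^ 2 + (exhaustion ρ₀).z p ^ 2 ≤ 8 * ax + 8 * rm := by
  obtain ⟨a1, a2, a3, a4⟩ := axis_bounds hp1
  obtain ⟨b1, b2, b3, b4⟩ := rim_bounds hp1 hp
  rw [← hd] at b1 b2 b3
  have er : (exhaustion ρ₀).r p = _ + _ := rfl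
  have ez : (exhaustion ρ₀).z p = _ + _ := rfl
  have el : (exhaustion ρ₀).lap p = _ + _ := PartialJet.lap_add p
  rw [er, ez, el, a2, zero_add]
  generalize (PartialJet.comp logSq logSqDeriv logSqDeriv₂ logAxisJet).r p = Ar at *
  generalize (PartialJet.comp logSq logSqDeriv logSqDeriv₂ logAxisJet).lap p = Al at *
  generalize (PartialJet.comp logSq logSqDeriv logSqDeriv₂ (logRimJet ρ₀)).r p = Br at *
  generalize (PartialJet.comp logSq logSqDeriv logSqDeriv₂ (logRimJet ρ₀)).z p = Bz at *
  generalize (PartialJet.comp logSq logSqDeriv logSqDeriv₂ (logRimJet ρ₀)).lap p = Bl at *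
  have h1 : ∀ c, c / (p.1 ^ 2 * (1 + Real.log p.1 ^ 2)) = c * ax := fun c => by rw [hax]; ring
  have h2 : ∀ c, c / (rimDistSq ρ₀ p * (1 + (Real.log (rimDistSq ρ₀ p) / 2) ^ 2)) = c * rm :=
    fun c => by rw [hrm]; ring
  rw [h1] at a3 a4
  rw [h2] at b3 b4
  refine ⟨(abs_add_le _ _).trans (add_le_add a1 b1), b2, ?_, ?_⟩
  · have := abs_add_le Al Bl
    linarith
  · nlinarith [sq_nonneg (Ar - Br), sq_nonneg Bz]

lemma majorant_arith {ρ ζ R d ax rm l : ℝ} (hρ : 0 < ρ) (hR0 : 0 < R)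
    (hR2 : 1 + ρ ^ 2 + ζ ^ 2 = R ^ 2) (hd : 0 < d) (hrm0 : 0 ≤ rm)
    (hax : ax = 1 / (ρ ^ 2 * (1 + l ^ 2))) :
    10 * (ρ * ax / R ^ 2) + 10 * (ρ / R ^ 2 * rm) + 1 / (R ^ 2 * d)
        + 1 / R ^ 3 + 2 * (ρ / (R ^ 3 * d)) ≤
    10 * (1 / (1 + ζ ^ 2) * (1 / (ρ * (1 + l ^ 2)))) + 10 * rm + 3 * (1 / (R ^ 2 * d)) +
      1 / R ^ 3 := by
  have hRρ : ρ ≤ R := (sq_le_sq₀ hρ.le hR0.le).1 (by nlinarith [sq_nonneg ζ])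
  have c1 : ρ * ax / R ^ 2 ≤ 1 / (1 + ζ ^ 2) * (1 / (ρ * (1 + l ^ 2))) := by
    have : ρ * ax / R ^ 2 = 1 / R ^ 2 * (1 / (ρ * (1 + l ^ 2))) := by
      rw [hax]; field_simp
    rw [this]
    refine mul_le_mul_of_nonneg_right ?_ (by positivity)
    refine one_div_le_one_div_of_le (by positivity) ?_
    rw [← hR2]; nlinarith [sq_nonneg ρ]
  have c2 : ρ / R ^ 2 * rm ≤ rm := by
    refine mul_le_of_le_one_left hrm0 ?_
    rw [div_le_one (by positivity), ← hR2]; nlinarith [sq_nonneg (ρ - 1), sq_nonneg ζ]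
  have c3 : ρ / (R ^ 3 * d) ≤ 1 / (R ^ 2 * d) := by
    rw [div_le_div_iff₀ (by positivity) (by positivity)]
    have : 0 < R ^ 2 * d := by positivity
    nlinarith
  linarith

/-- Since `ΔG = 0`, every surviving term has a derivative on the cutoff, which costs a factor `1 /
Λ`. The decay `R⁻²` of the kernel and `R⁻³` of its gradient make the remaining factor integrable at
infinity. -/
lemma abs_lap_cutoff_mul_le {G : PartialJet} {Λ C : ℝ} (hΛ : 1 ≤ Λ)
    (hp : p ∈ rimless ρ₀) (hlap : G.lap p = 0)
    (hG : |G.f p| ≤ C / (1 + p.1 ^ 2 + p.2 ^ 2))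
    (hGr : |G.r p| ≤ C / √(1 + p.1 ^ 2 + p.2 ^ 2) ^ 3)
    (hGz : |G.z p| ≤ C / √(1 + p.1 ^ 2 + p.2 ^ 2) ^ 3) :
    |p.1 * ((cutoffJet ρ₀ Λ).mul G).lap p| ≤ 6 * C / Λ * cutoffMajorant ρ₀ p := by
  obtain ⟨hp1, hp2⟩ := hp
  have hd := rimDistSq_pos hp2
  obtain ⟨hEr, hEz, hElap, hEgrad⟩ := exhaustion_bounds hp1 hp2 rfl rfl rfl
  have hR0 : 0 < √(1 + p.1 ^ 2 + p.2 ^ 2) := by positivity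
  have hR2 : 1 + p.1 ^ 2 + p.2 ^ 2 = √(1 + p.1 ^ 2 + p.2 ^ 2) ^ 2 :=
    (Real.sq_sqrt (by positivity)).symm
  have hC : 0 ≤ C := by
    have h1 := (abs_nonneg _).trans hG
    by_contra h
    have h2 : C / (1 + p.1 ^ 2 + p.2 ^ 2) < 0 := div_neg_of_neg_of_pos (by linarith) (by positivity)
    linarith
  have t1 := abs_cutoffDeriv_le hΛ (exhaustion_nonneg ρ₀ p)
  have t2 := abs_cutoffDeriv₂_le hΛ (exhaustion_nonneg ρ₀ p)
  have e0 : p.1 * ((cutoffJet ρ₀ Λ).mul G).lap p =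
      p.1 * (cutoffDeriv Λ ((exhaustion ρ₀).f p) * (exhaustion ρ₀).lap p * G.f p) +
      p.1 * (cutoffDeriv₂ Λ ((exhaustion ρ₀).f p) *
        ((exhaustion ρ₀).r p ^ 2 + (exhaustion ρ₀).z p ^ 2) * G.f p) +
      (2 * (p.1 * (cutoffDeriv Λ ((exhaustion ρ₀).f p) * (exhaustion ρ₀).r p * G.r p)) +
        2 * (p.1 * (cutoffDeriv Λ ((exhaustion ρ₀).f p) * (exhaustion ρ₀).z p * G.z p))) := by
    rw [PartialJet.lap_mul, hlap, cutoffJet, PartialJet.lap_comp]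
    simp only [PartialJet.comp]; ring
  rw [e0]
  rw [hR2] at hG
  refine (commutator_arith hp1 (by linarith) hC hR0 (Real.sqrt_pos.2 hd) (by positivity)
    (by positivity) t1 t2 hElap (by positivity) hEgrad hEr hEz hG hGr hGz).trans ?_
  refine mul_le_mul_of_nonneg_left ?_ (by positivity)
  rw [cutoffMajorant]
  refine (majorant_arith (ζ := p.2) hp1 hR0 hR2 (Real.sqrt_pos.2 hd) (by positivity) rfl).trans_eq ?_
  rw [← hR2]

/-- The antiderivative `arctan (log x)` is bounded. -/
lemma integrableOn_one_div_mul_one_add_log_sq :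
    IntegrableOn (fun x : ℝ => 1 / (x * (1 + Real.log x ^ 2))) (Ioi 0) := by
  have hd : ∀ x : ℝ, 0 < x →
      HasDerivAt (fun y => Real.arctan (Real.log y)) (1 / (x * (1 + Real.log x ^ 2))) x := by
    intro x hx
    refine ((Real.hasDerivAt_log hx.ne').arctan).congr_deriv ?_
    field_simp
  rw [← Ioc_union_Ioi_eq_Ioi zero_le_one]
  refine IntegrableOn.union ?_ ?_
  · have h := intervalIntegral.integrableOn_deriv_of_nonneg (a := 0) (b := 1)
      -- At `0` the limit `-π / 2` has to be imposed, since `Real.log 0 = 0` would give the value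
      -- `0`.
      (g := fun y => if y = 0 then -(Real.pi / 2) else Real.arctan (Real.log y))
      (g' := fun x => 1 / (x * (1 + Real.log x ^ 2))) ?_ ?_ ?_
    · exact h
    · intro x hx
      rcases hx.1.eq_or_lt with h0 | h0
      · subst h0
        rw [← continuousWithinAt_sdiff_self]
        have h1 : Tendsto (fun y => Real.arctan (Real.log y)) (𝓝[Icc (0 : ℝ) 1 \ {0}] 0)
            (𝓝 (-(Real.pi / 2))) := by
          refine (Real.tendsto_arctan_atBot.mono_right nhdsWithin_le_nhds).comp ?_
          exact Real.tendsto_log_nhdsNE_zero.mono_left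
            (nhdsWithin_mono _ fun y hy => hy.2)
        simp only [ContinuousWithinAt, if_true]
        refine h1.congr' ?_
        filter_upwards [self_mem_nhdsWithin] with y hy
        exact (if_neg (fun h : y = 0 => hy.2 h)).symm
      · refine ContinuousAt.continuousWithinAt ?_
        refine (hd x h0).continuousAt.congr ?_
        filter_upwards [Ioi_mem_nhds h0] with y hy
        rw [if_neg (ne_of_gt hy)]
    · intro x hx
      refine (hd x hx.1).congr_of_eventuallyEq ?_
      filter_upwards [Ioi_mem_nhds hx.1] with y hy
      rw [if_neg (ne_of_gt hy)]
    · intro x hx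
      have := hx.1
      positivity
  · refine integrableOn_Ioi_deriv_of_nonneg (hd 1 one_pos).continuousAt.continuousWithinAt
      (fun x hx => hd x (one_pos.trans hx)) (fun x hx => ?_)
      ((Real.tendsto_arctan_atTop.mono_right nhdsWithin_le_nhds).comp Real.tendsto_log_atTop)
    have : (0 : ℝ) < x := one_pos.trans hx
    positivity

/-- The norm of `ℝ × ℝ` is the maximum norm. Integration of radial functions works for any norm, so
the Euclidean distance to the rim may be exchanged for it up to a factor. -/
lemma norm_sub_rim_le (ρ₀ : ℝ) (p : ℝ × ℝ) :
    ‖p - (ρ₀, 0)‖ ^ 2 ≤ rimDistSq ρ₀ p ∧ rimDistSq ρ₀ p ≤ 2 * ‖p - (ρ₀, 0)‖ ^ 2 := by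
  have h : ‖p - (ρ₀, 0)‖ = max |p.1 - ρ₀| |p.2| := by
    rw [Prod.norm_def]; simp
  rw [h, rimDistSq, ← sq_abs (p.1 - ρ₀), ← sq_abs p.2]
  have h1 := abs_nonneg (p.1 - ρ₀)
  have h2 := abs_nonneg p.2
  rcases le_total |p.1 - ρ₀| |p.2| with h | h
  · rw [max_eq_right h]; constructor <;> nlinarith
  · rw [max_eq_left h]; constructor <;> nlinarith

/-- The axis term is a product of integrable functions of one variable. The two terms singular at
the rim are compared with radial functions centred there, where the area element `r dr` tames the
singularity. The last term is an integrable power of `1 + ‖p‖²`. -/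
lemma integrableOn_cutoffMajorant (ρ₀ : ℝ) :
    IntegrableOn (cutoffMajorant ρ₀) (Ioi 0 ×ˢ univ) := by
  have hmd : Measurable (rimDistSq ρ₀) := by unfold rimDistSq; fun_prop
  have hfin : Module.finrank ℝ (ℝ × ℝ) = 2 := by simp
  have i1 : IntegrableOn (fun p : ℝ × ℝ =>
      1 / (1 + p.2 ^ 2) * (1 / (p.1 * (1 + Real.log p.1 ^ 2)))) (Ioi 0 ×ˢ univ) := by
    rw [IntegrableOn, Measure.volume_eq_prod, ← Measure.prod_restrict, Measure.restrict_univ]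
    have h := (integrableOn_one_div_mul_one_add_log_sq).mul_prod
      (integrable_inv_one_add_sq : Integrable (fun x : ℝ => (1 + x ^ 2)⁻¹))
    refine h.congr (ae_of_all _ fun p => ?_)
    simp only; ring
  have i2 : Integrable (fun p : ℝ × ℝ =>
      1 / (rimDistSq ρ₀ p * (1 + (Real.log (rimDistSq ρ₀ p) / 2) ^ 2))) := by
    have h0 : Integrable (fun p : ℝ × ℝ => 1 / (‖p‖ ^ 2 * (1 + Real.log ‖p‖ ^ 2))) := by
      rw [integrable_fun_norm_addHaar (volume : Measure (ℝ × ℝ))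
        (f := fun r : ℝ => 1 / (r ^ 2 * (1 + Real.log r ^ 2))), hfin]
      refine integrableOn_one_div_mul_one_add_log_sq.congr_fun (fun x hx => ?_) measurableSet_Ioi
      have hx0 : 0 < x := hx
      simp only [smul_eq_mul]; field_simp; norm_num
    -- The factor `3` pays for the change of norm: half the logarithm of `rimDistSq` exceeds `log n`
    -- by at most `(log 2) / 2`.
    have h1 := (h0.comp_sub_right (ρ₀, (0 : ℝ))).const_mul 3
    refine h1.mono' (Measurable.aestronglyMeasurable (by fun_prop)) ?_
    have hae : ∀ᵐ p : ℝ × ℝ, p ≠ (ρ₀, 0) := by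
      simp [ae_iff]
    filter_upwards [hae] with p hp
    have hd := rimDistSq_pos hp
    obtain ⟨n1, n2⟩ := norm_sub_rim_le ρ₀ p
    set n := ‖p - (ρ₀, 0)‖ with hn
    set D := rimDistSq ρ₀ p with hD
    have hn0 : 0 < n := norm_pos_iff.2 (sub_ne_zero.2 hp)
    rw [Real.norm_of_nonneg (by positivity), mul_one_div, div_le_div_iff₀ (by positivity)
      (by positivity), one_mul]
    have l1 : 2 * Real.log n ≤ Real.log D := by
      have := Real.log_le_log (by positivity) n1
      rw [Real.log_pow] at this; push_cast at this; exact this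
    have l2 : Real.log D ≤ Real.log 2 + 2 * Real.log n := by
      have := Real.log_le_log hd n2
      rw [Real.log_mul two_ne_zero (by positivity), Real.log_pow] at this
      push_cast at this; exact this
    have l3 : Real.log 2 < 1 := by have := Real.log_two_lt_d9; linarith
    have l4 : 1 + Real.log n ^ 2 ≤ 3 * (1 + (Real.log D / 2) ^ 2) := by
      nlinarith [sq_nonneg (Real.log D / 2 + (Real.log D / 2 - Real.log n)),
        sq_nonneg (Real.log n)]
    calc n ^ 2 * (1 + Real.log n ^ 2) ≤ D * (3 * (1 + (Real.log D / 2) ^ 2)) := by gcongr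
      _ = 3 * (D * (1 + (Real.log D / 2) ^ 2)) := by ring
  have i3 : Integrable (fun p : ℝ × ℝ => 1 / ((1 + p.1 ^ 2 + p.2 ^ 2) * √(rimDistSq ρ₀ p))) := by
    have h0 : Integrable (fun p : ℝ × ℝ => 1 / (‖p‖ * (1 + ‖p‖ ^ 2))) := by
      rw [integrable_fun_norm_addHaar (volume : Measure (ℝ × ℝ))
        (f := fun r : ℝ => 1 / (r * (1 + r ^ 2))), hfin]
      refine (integrable_inv_one_add_sq.integrableOn (s := Ioi (0 : ℝ))).congr_fun
        (fun x hx => ?_) measurableSet_Ioi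
      have hx0 : 0 < x := hx
      simp only [smul_eq_mul]; field_simp; norm_num
    have h1 := (h0.comp_sub_right (ρ₀, (0 : ℝ))).const_mul (2 + 2 * ρ₀ ^ 2)
    refine h1.mono' (Measurable.aestronglyMeasurable (by fun_prop)) ?_
    have hae : ∀ᵐ p : ℝ × ℝ, p ≠ (ρ₀, 0) := by
      simp [ae_iff]
    filter_upwards [hae] with p hp
    have hd := rimDistSq_pos hp
    obtain ⟨n1, n2⟩ := norm_sub_rim_le ρ₀ p
    set n := ‖p - (ρ₀, 0)‖ with hn
    have hn0 : 0 < n := norm_pos_iff.2 (sub_ne_zero.2 hp)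
    have hs : n ≤ √(rimDistSq ρ₀ p) := Real.le_sqrt_of_sq_le n1
    have hb : 1 + n ^ 2 ≤ (2 + 2 * ρ₀ ^ 2) * (1 + p.1 ^ 2 + p.2 ^ 2) := by
      have : rimDistSq ρ₀ p ≤ 2 * p.1 ^ 2 + 2 * ρ₀ ^ 2 + p.2 ^ 2 := by
        rw [rimDistSq]; nlinarith [sq_nonneg (p.1 + ρ₀)]
      nlinarith [mul_nonneg (sq_nonneg ρ₀) (add_nonneg (sq_nonneg p.1) (sq_nonneg p.2)),
        sq_nonneg p.2]
    rw [Real.norm_of_nonneg (by positivity), mul_one_div, div_le_div_iff₀ (by positivity)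
      (by positivity), one_mul]
    calc n * (1 + n ^ 2)
        ≤ √(rimDistSq ρ₀ p) * ((2 + 2 * ρ₀ ^ 2) * (1 + p.1 ^ 2 + p.2 ^ 2)) := by gcongr
      _ = _ := by ring
  have i4 : Integrable (fun p : ℝ × ℝ => 1 / √(1 + p.1 ^ 2 + p.2 ^ 2) ^ 3) := by
    have h0 := integrable_rpow_neg_one_add_norm_sq (E := ℝ × ℝ) (μ := volume) (r := 3)
      (by rw [hfin]; norm_num)
    refine h0.mono' (Measurable.aestronglyMeasurable (by fun_prop)) (ae_of_all _ fun p => ?_)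
    rw [Real.norm_of_nonneg (by positivity)]
    have hn : ‖p‖ ^ 2 ≤ p.1 ^ 2 + p.2 ^ 2 := by
      have := (norm_sub_rim_le 0 p).1
      have e : p - ((0 : ℝ), (0 : ℝ)) = p := sub_zero p
      rw [e] at this
      simpa [rimDistSq] using this
    have e1 : (1 + ‖p‖ ^ 2) ^ (-(3 : ℝ) / 2) = 1 / √(1 + ‖p‖ ^ 2) ^ 3 := by
      have hpos : 0 ≤ 1 + ‖p‖ ^ 2 := by positivity
      generalize 1 + ‖p‖ ^ 2 = X at hpos
      rw [Real.sqrt_eq_rpow, ← Real.rpow_natCast, ← Real.rpow_mul hpos, one_div,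
        ← Real.rpow_neg hpos]
      norm_num
    rw [e1]
    refine one_div_le_one_div_of_le (by positivity) ?_
    refine pow_le_pow_left₀ (by positivity) (Real.sqrt_le_sqrt (by linarith)) _
  exact (((i1.const_mul 10).add (i2.const_mul 10).integrableOn).add
    (i3.const_mul 3).integrableOn).add i4.integrableOn

end CutoffBounds

/-! ### The Poisson kernel and its decay -/

section PoissonKernel

/-- The Poisson kernel `z / (ρ² + z²)^{3/2}` of the half-space (up to a factor) at axis points. -/
noncomputable def poissonKer (ρ z : ℝ) : ℝ := z / √(ρ ^ 2 + z ^ 2) ^ 3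

noncomputable def poissonKerDeriv (ρ z : ℝ) : ℝ :=
  1 / √(ρ ^ 2 + z ^ 2) ^ 3 - 3 * z ^ 2 / √(ρ ^ 2 + z ^ 2) ^ 5

/-- The jet of `poissonKer ρ (σ ζ + c)`, where `σ = ± 1`. -/
noncomputable def poissonJet (σ c : ℝ) : PartialJet where
  f p := poissonKer p.1 (σ * p.2 + c)
  r p := -(3 * p.1 * (σ * p.2 + c)) / √(p.1 ^ 2 + (σ * p.2 + c) ^ 2) ^ 5
  z p := σ * poissonKerDeriv p.1 (σ * p.2 + c)
  rr p := -(3 * (σ * p.2 + c)) / √(p.1 ^ 2 + (σ * p.2 + c) ^ 2) ^ 5 +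
    15 * (σ * p.2 + c) * p.1 ^ 2 / √(p.1 ^ 2 + (σ * p.2 + c) ^ 2) ^ 7
  zz p := -(9 * (σ * p.2 + c)) / √(p.1 ^ 2 + (σ * p.2 + c) ^ 2) ^ 5 +
    15 * (σ * p.2 + c) ^ 3 / √(p.1 ^ 2 + (σ * p.2 + c) ^ 2) ^ 7

lemma hasDerivAt_inv_sqrt_add_sq_pow {c z : ℝ} (h : 0 < c + z ^ 2) (n : ℕ) :
    HasDerivAt (fun x => (√(c + x ^ 2) ^ n)⁻¹) (-(n * z) / √(c + z ^ 2) ^ (n + 2)) z := by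
  have hS : 0 < √(c + z ^ 2) := Real.sqrt_pos.2 h
  have h1 : HasDerivAt (fun x => √(c + x ^ 2)) (z / √(c + z ^ 2)) z := by
    refine (((hasDerivAt_pow 2 z).const_add c).sqrt h.ne').congr_deriv ?_
    field_simp; simp
  have h2 : HasDerivAt (fun y : ℝ => (y ^ n)⁻¹) (-n / √(c + z ^ 2) ^ (n + 1)) √(c + z ^ 2) := by
    have := hasDerivAt_zpow (-(n : ℤ)) √(c + z ^ 2) (Or.inl hS.ne')
    simp only [zpow_neg, zpow_natCast] at this
    refine this.congr_deriv ?_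
    rw [show -(n : ℤ) - 1 = -((n + 1 : ℕ) : ℤ) by push_cast; ring, zpow_neg, zpow_natCast]
    push_cast; ring
  refine (h2.comp z h1).congr_deriv ?_
  field_simp
  ring

lemma hasDerivAt_inv_sqrt_pow {ρ : ℝ} (h : 0 < ρ) (z : ℝ) (n : ℕ) :
    HasDerivAt (fun x => (√(ρ ^ 2 + x ^ 2) ^ n)⁻¹) (-(n * z) / √(ρ ^ 2 + z ^ 2) ^ (n + 2)) z :=
  hasDerivAt_inv_sqrt_add_sq_pow (by positivity) n

lemma hasDerivAt_inv_sqrt_pow_left {ρ : ℝ} (h : 0 < ρ) (z : ℝ) (n : ℕ) :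
    HasDerivAt (fun x => (√(x ^ 2 + z ^ 2) ^ n)⁻¹) (-(n * ρ) / √(ρ ^ 2 + z ^ 2) ^ (n + 2)) ρ := by
  have := hasDerivAt_inv_sqrt_add_sq_pow (c := z ^ 2) (z := ρ) (by positivity) n
  simpa only [add_comm (z ^ 2)] using this

lemma hasDerivAt_poissonKer {ρ : ℝ} (h : 0 < ρ) (z : ℝ) :
    HasDerivAt (poissonKer ρ) (poissonKerDeriv ρ z) z := by
  refine ((hasDerivAt_id z).mul (hasDerivAt_inv_sqrt_pow h z 3)).congr_deriv ?_
  simp only [poissonKerDeriv, id]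
  push_cast; ring

lemma hasDerivAt_poissonKerDeriv {ρ : ℝ} (h : 0 < ρ) (z : ℝ) :
    HasDerivAt (poissonKerDeriv ρ)
      (-(9 * z) / √(ρ ^ 2 + z ^ 2) ^ 5 + 15 * z ^ 3 / √(ρ ^ 2 + z ^ 2) ^ 7) z := by
  have h1 := (hasDerivAt_inv_sqrt_pow h z 3).sub
    (((hasDerivAt_pow 2 z).const_mul 3).mul (hasDerivAt_inv_sqrt_pow h z 5))
  refine (h1.congr_deriv ?_).congr_of_eventuallyEq (Eventually.of_forall fun x => ?_)
  · push_cast; ring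
  · simp only [poissonKerDeriv, Pi.sub_apply, Pi.mul_apply]; ring

lemma isOn_poissonJet {σ : ℝ} (hσ : σ ^ 2 = 1) (c : ℝ) :
    (poissonJet σ c).IsOn {p | 0 < p.1} := by
  have hlin : ∀ p : ℝ × ℝ, HasDerivAt (fun x => σ * x + c) σ p.2 := fun p => by
    simpa using ((hasDerivAt_id p.2).const_mul σ).add_const c
  have hc : ∀ (n : ℕ) (g : ℝ × ℝ → ℝ), Continuous g →
      ContinuousOn (fun p : ℝ × ℝ => g p / √(p.1 ^ 2 + (σ * p.2 + c) ^ 2) ^ n) {p | 0 < p.1} := by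
    intro n g hg
    refine ContinuousOn.div hg.continuousOn (by fun_prop) fun p hp => ?_
    have : 0 < p.1 := hp
    positivity
  refine ⟨fun p hp => ?_, fun p hp => ?_, fun p hp => ?_, fun p hp => ?_, ?_, ?_, ?_, ?_, ?_⟩
  · refine ((hasDerivAt_inv_sqrt_pow_left hp (σ * p.2 + c) 3).const_mul
      (σ * p.2 + c)).congr_deriv ?_
    simp only [poissonJet]; push_cast; ring
  · refine ((hasDerivAt_poissonKer hp (σ * p.2 + c)).comp p.2 (hlin p)).congr_deriv ?_
    simp only [poissonJet]; ring
  · have h1 := (((hasDerivAt_id p.1).const_mul 3).mul_const (σ * p.2 + c)).neg.mul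
      (hasDerivAt_inv_sqrt_pow_left hp (σ * p.2 + c) 5)
    refine (h1.congr_deriv ?_).congr_of_eventuallyEq (Eventually.of_forall fun x => ?_)
    · simp only [poissonJet, id, Pi.neg_apply]; push_cast; ring
    · simp only [poissonJet, id, Pi.neg_apply, Pi.mul_apply]; ring
  · refine (((hasDerivAt_poissonKerDeriv hp (σ * p.2 + c)).comp p.2 (hlin p)).const_mul
      σ).congr_deriv ?_
    simp only [poissonJet]
    generalize -(9 * (σ * p.2 + c)) / √(p.1 ^ 2 + (σ * p.2 + c) ^ 2) ^ 5 +
      15 * (σ * p.2 + c) ^ 3 / √(p.1 ^ 2 + (σ * p.2 + c) ^ 2) ^ 7 = X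
    linear_combination X * hσ
  · exact hc 3 _ (by fun_prop)
  · exact hc 5 _ (by fun_prop)
  · exact continuousOn_const.mul ((hc 3 _ (by fun_prop)).sub (hc 5 _ (by fun_prop)))
  · exact (hc 5 _ (by fun_prop)).add (hc 7 _ (by fun_prop))
  · exact (hc 5 _ (by fun_prop)).add (hc 7 _ (by fun_prop))

/-- The kernel is minus the `z`-derivative of the Newton kernel `1 / √(ρ² + z²)`, hence harmonic
away from its source. -/
lemma lap_poissonJet (σ c : ℝ) {p : ℝ × ℝ} (hp : 0 < p.1) : (poissonJet σ c).lap p = 0 := by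
  simp only [PartialJet.lap, poissonJet]
  generalize σ * p.2 + c = z
  have hS0 : 0 < √(p.1 ^ 2 + z ^ 2) := by positivity
  have hS2 : √(p.1 ^ 2 + z ^ 2) ^ 2 = p.1 ^ 2 + z ^ 2 := Real.sq_sqrt (by positivity)
  generalize √(p.1 ^ 2 + z ^ 2) = S at *
  have : p.1 ^ 2 = S ^ 2 - z ^ 2 := by linarith
  field_simp
  rw [this]; ring

lemma abs_poissonKer_le (ρ : ℝ) {z : ℝ} (hz : 0 < z) :
    |poissonKer ρ z| ≤ 1 / √(ρ ^ 2 + z ^ 2) ^ 2 := by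
  have hS0 : 0 < √(ρ ^ 2 + z ^ 2) := by positivity
  have hzS : z ≤ √(ρ ^ 2 + z ^ 2) := Real.le_sqrt_of_sq_le (by nlinarith [sq_nonneg ρ])
  rw [poissonKer, abs_of_nonneg (by positivity), div_le_div_iff₀ (by positivity) (by positivity)]
  generalize √(ρ ^ 2 + z ^ 2) = S at *
  nlinarith [pow_pos hS0 2]

lemma abs_poissonKerDeriv_le (ρ : ℝ) {z : ℝ} (hz : 0 < z) :
    |poissonKerDeriv ρ z| ≤ 4 / √(ρ ^ 2 + z ^ 2) ^ 3 := by
  have hS0 : 0 < √(ρ ^ 2 + z ^ 2) := by positivity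
  have hzS : z ≤ √(ρ ^ 2 + z ^ 2) := Real.le_sqrt_of_sq_le (by nlinarith [sq_nonneg ρ])
  rw [poissonKerDeriv]
  generalize √(ρ ^ 2 + z ^ 2) = S at *
  have h1 : 3 * z ^ 2 / S ^ 5 ≤ 3 / S ^ 3 := by
    rw [div_le_div_iff₀ (by positivity) (by positivity)]
    have : z ^ 2 ≤ S ^ 2 := by gcongr
    have h3 : 0 < S ^ 3 := by positivity
    nlinarith
  have h2 : 0 ≤ 3 * z ^ 2 / S ^ 5 := by positivity
  have h3 : 0 < 1 / S ^ 3 := by positivity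
  have h4 : 3 / S ^ 3 = 3 * (1 / S ^ 3) := by ring
  have h5 : 4 / S ^ 3 = 4 * (1 / S ^ 3) := by ring
  rw [h5, abs_le]
  constructor <;> linarith

/-- The kernel is `O(S⁻²)` and its gradient `O(S⁻³)` in the distance `S` to the source. As the
height `z` above the source is at least `w`, both `1` and `ε²` are bounded by multiples of `z²`, so
`1 + ρ² + ζ² ≤ D S²` and `S` may be replaced by the distance used in the majorant. -/
lemma poissonJet_bounds {σ c w ε : ℝ} (hσ : σ ^ 2 = 1) (hw : 0 < w) {p : ℝ × ℝ}
    (h1 : w ≤ σ * p.2 + c) (hp2 : 0 ≤ p.2) (h2 : p.2 ≤ σ * p.2 + c + ε) :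
    let C := 4 * (2 + (1 + 2 * ε ^ 2) / w ^ 2) ^ 2
    |(poissonJet σ c).f p| ≤ C / (1 + p.1 ^ 2 + p.2 ^ 2) ∧
    |(poissonJet σ c).r p| ≤ C / √(1 + p.1 ^ 2 + p.2 ^ 2) ^ 3 ∧
    |(poissonJet σ c).z p| ≤ C / √(1 + p.1 ^ 2 + p.2 ^ 2) ^ 3 := by
  intro C
  set z := σ * p.2 + c with hz
  have hz0 : 0 < z := hw.trans_le h1
  set S := √(p.1 ^ 2 + z ^ 2) with hS
  have hS0 : 0 < S := by positivity
  have hS2 : S ^ 2 = p.1 ^ 2 + z ^ 2 := Real.sq_sqrt (by positivity)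
  set R := √(1 + p.1 ^ 2 + p.2 ^ 2) with hR
  have hR0 : 0 < R := by positivity
  have hR2 : R ^ 2 = 1 + p.1 ^ 2 + p.2 ^ 2 := Real.sq_sqrt (by positivity)
  set D := 2 + (1 + 2 * ε ^ 2) / w ^ 2 with hD
  have hD1 : 1 ≤ D := by
    have : 0 ≤ (1 + 2 * ε ^ 2) / w ^ 2 := by positivity
    linarith
  have hRS2 : R ^ 2 ≤ D * S ^ 2 := by
    rw [hR2, hS2, hD]
    have e1 : (1 + 2 * ε ^ 2) / w ^ 2 * z ^ 2 ≥ 1 + 2 * ε ^ 2 := by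
      rw [ge_iff_le, div_mul_eq_mul_div, le_div_iff₀ (by positivity)]
      have : w ^ 2 ≤ z ^ 2 := by gcongr
      nlinarith [sq_nonneg ε]
    have e2 : p.2 ^ 2 ≤ 2 * z ^ 2 + 2 * ε ^ 2 := by
      have : p.2 ^ 2 ≤ (z + ε) ^ 2 := by gcongr
      nlinarith [sq_nonneg (z - ε)]
    have e3 : 0 ≤ (1 + 2 * ε ^ 2) / w ^ 2 * p.1 ^ 2 := by positivity
    nlinarith [sq_nonneg p.1]
  have hRS : R ≤ D * S := by
    refine (sq_le_sq₀ hR0.le (by positivity)).1 (hRS2.trans ?_)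
    rw [mul_pow]; gcongr; nlinarith
  have k3 : 4 / S ^ 3 ≤ C / R ^ 3 := by
    rw [div_le_div_iff₀ (by positivity) (by positivity)]
    have : R ^ 3 ≤ D ^ 2 * S ^ 3 := by
      calc R ^ 3 = R ^ 2 * R := by ring
        _ ≤ (D * S ^ 2) * (D * S) := by gcongr
        _ = D ^ 2 * S ^ 3 := by ring
    simp only [C]; linarith
  refine ⟨(abs_poissonKer_le _ hz0).trans ?_, ?_, ?_⟩
  · rw [← hS, ← hR2, div_le_div_iff₀ (by positivity) (by positivity), one_mul]
    simp only [C]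
    have : D * S ^ 2 ≤ D ^ 2 * S ^ 2 := by gcongr; nlinarith
    nlinarith [sq_nonneg (D * S)]
  · refine le_trans ?_ k3
    simp only [poissonJet]
    rw [← hz, ← hS, abs_div, abs_of_pos (by positivity : 0 < S ^ 5), abs_neg,
      div_le_div_iff₀ (by positivity) (by positivity)]
    have h3 : |3 * p.1 * z| ≤ 4 * S ^ 2 := by
      rw [hS2, abs_le]; constructor <;> nlinarith [sq_nonneg (p.1 - z), sq_nonneg (p.1 + z)]
    calc |3 * p.1 * z| * S ^ 3 ≤ 4 * S ^ 2 * S ^ 3 := by gcongr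
      _ = 4 * S ^ 5 := by ring
  · refine le_trans ?_ k3
    simp only [poissonJet]
    rw [← hz, abs_mul]
    have : |σ| = 1 := by
      rw [← sq_eq_sq₀ (abs_nonneg _) zero_le_one, sq_abs, hσ, one_pow]
    rw [this, one_mul]
    exact abs_poissonKerDeriv_le _ hz0

end PoissonKernel

/-- Local bounds along `S` are assumed also at points of `K` outside `S`. This suits functions whose
behaviour at the disk is known only through one-sided limits. -/
lemma IsCompact.exists_bound_of_isBigO_one {X : Type*} [TopologicalSpace X] {f : X → ℝ}
    {K S : Set X} (hK : IsCompact K) (h : ∀ x ∈ K, f =O[𝓝[S] x] fun _ => (1 : ℝ)) :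
    ∃ C, ∀ y ∈ K ∩ S, |f y| ≤ C := by
  refine hK.induction_on (p := fun t => ∃ C, ∀ y ∈ t ∩ S, |f y| ≤ C) ⟨0, by simp⟩ ?_ ?_ ?_
  · rintro s t hst ⟨C, hC⟩
    exact ⟨C, fun y hy => hC y ⟨hst hy.1, hy.2⟩⟩
  · rintro s t ⟨C, hC⟩ ⟨C', hC'⟩
    refine ⟨max C C', fun y hy => ?_⟩
    rcases hy.1 with h1 | h1
    · exact (hC y ⟨h1, hy.2⟩).trans (le_max_left _ _)
    · exact (hC' y ⟨h1, hy.2⟩).trans (le_max_right _ _)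
  · intro x hx
    obtain ⟨C, hC⟩ := (h x hx).bound
    rw [eventually_nhdsWithin_iff] at hC
    exact ⟨_, mem_nhdsWithin_of_mem_nhds hC, C, fun y hy => by simpa using hy.1 hy.2⟩

lemma abs_iterated_integral_le {F Maj : ℝ × ℝ → ℝ} {a b c d : ℝ} (ha : 0 < a) (hab : a ≤ b)
    (hcd : c ≤ d) (hF : ContinuousOn F (Icc a b ×ˢ Icc c d))
    (hMaj : IntegrableOn Maj (Ioi 0 ×ˢ univ)) (h0 : ∀ p : ℝ × ℝ, 0 < p.1 → 0 ≤ Maj p)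
    (hle : ∀ p ∈ Icc a b ×ˢ Icc c d, |F p| ≤ Maj p) :
    |∫ ζ in c..d, ∫ ρ in a..b, F (ρ, ζ)| ≤ ∫ p in Ioi 0 ×ˢ univ, Maj p := by
  have hint : IntegrableOn F (Ioc a b ×ˢ Ioc c d) :=
    (hF.integrableOn_compact (isCompact_Icc.prod isCompact_Icc)).mono_set
      (prod_mono Ioc_subset_Icc_self Ioc_subset_Icc_self)
  have e : ∫ ζ in c..d, ∫ ρ in a..b, F (ρ, ζ) = ∫ p in Ioc a b ×ˢ Ioc c d, F p := by
    rw [Measure.volume_eq_prod, setIntegral_prod F hint]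
    simp_rw [intervalIntegral.integral_of_le hcd, intervalIntegral.integral_of_le hab]
    refine (integral_integral_swap (f := fun x y => F (x, y)) ?_).symm
    rw [Measure.prod_restrict]
    exact hint
  have hsub : Ioc a b ×ˢ Ioc c d ⊆ Ioi (0 : ℝ) ×ˢ (univ : Set ℝ) :=
    prod_mono (fun x hx => ha.trans hx.1) (subset_univ _)
  rw [e]
  calc |∫ p in Ioc a b ×ˢ Ioc c d, F p| ≤ ∫ p in Ioc a b ×ˢ Ioc c d, Maj p := by
        rw [← Real.norm_eq_abs]
        refine norm_integral_le_of_norm_le (hMaj.mono_set hsub) ?_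
        refine (ae_restrict_iff' (measurableSet_Ioc.prod measurableSet_Ioc)).2
          (ae_of_all _ fun p hp => ?_)
        exact hle p ⟨Ioc_subset_Icc_self hp.1, Ioc_subset_Icc_self hp.2⟩
    _ ≤ ∫ p in Ioi 0 ×ˢ univ, Maj p := by
        refine setIntegral_mono_set hMaj ?_ (LE.le.eventuallyLE hsub)
        refine (ae_restrict_iff' (measurableSet_Ioi.prod MeasurableSet.univ)).2
          (ae_of_all _ fun p hp => h0 p hp.1)

/-! ### Green's identity with a kinked kernel on two strips -/

section HalfSpace

/-- The Neumann-symmetrized Poisson kernel below the level `ε`. -/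
noncomputable def lowerJet (ε w : ℝ) : PartialJet :=
  (poissonJet (-1) (ε + w)).add (poissonJet 1 (ε + w))

/-- The continuation of `lowerJet` above the level `ε`, with a kink at this level. -/
noncomputable def upperJet (ε w : ℝ) : PartialJet :=
  (poissonJet 1 (w - ε)).add (poissonJet 1 (ε + w))

noncomputable def kernelConst (ε w : ℝ) : ℝ := 2 * (4 * (2 + (1 + 2 * ε ^ 2) / w ^ 2) ^ 2)

lemma PartialJet.add_bounds {J K : PartialJet} {p : ℝ × ℝ} {A B C : ℝ}
    (hJ : |J.f p| ≤ C / A ∧ |J.r p| ≤ C / B ∧ |J.z p| ≤ C / B)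
    (hK : |K.f p| ≤ C / A ∧ |K.r p| ≤ C / B ∧ |K.z p| ≤ C / B) :
    |(J.add K).f p| ≤ 2 * C / A ∧ |(J.add K).r p| ≤ 2 * C / B ∧ |(J.add K).z p| ≤ 2 * C / B := by
  have h : ∀ x, 2 * C / x = C / x + C / x := fun x => by ring
  simp only [h]
  exact ⟨(abs_add_le _ _).trans (add_le_add hJ.1 hK.1),
    (abs_add_le _ _).trans (add_le_add hJ.2.1 hK.2.1),
    (abs_add_le _ _).trans (add_le_add hJ.2.2 hK.2.2)⟩

lemma lowerJet_bounds {ε w : ℝ} (hw : 0 < w) {p : ℝ × ℝ} (h0 : 0 ≤ p.2) (h1 : p.2 ≤ ε) :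
    |(lowerJet ε w).f p| ≤ kernelConst ε w / (1 + p.1 ^ 2 + p.2 ^ 2) ∧
    |(lowerJet ε w).r p| ≤ kernelConst ε w / √(1 + p.1 ^ 2 + p.2 ^ 2) ^ 3 ∧
    |(lowerJet ε w).z p| ≤ kernelConst ε w / √(1 + p.1 ^ 2 + p.2 ^ 2) ^ 3 :=
  PartialJet.add_bounds
    (poissonJet_bounds (by norm_num) hw (by linarith) h0 (by linarith))
    (poissonJet_bounds (by norm_num) hw (by linarith) h0 (by linarith))

lemma upperJet_bounds {ε w : ℝ} (hw : 0 < w) (hε : 0 < ε) {p : ℝ × ℝ} (h1 : ε ≤ p.2) :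
    |(upperJet ε w).f p| ≤ kernelConst ε w / (1 + p.1 ^ 2 + p.2 ^ 2) ∧
    |(upperJet ε w).r p| ≤ kernelConst ε w / √(1 + p.1 ^ 2 + p.2 ^ 2) ^ 3 ∧
    |(upperJet ε w).z p| ≤ kernelConst ε w / √(1 + p.1 ^ 2 + p.2 ^ 2) ^ 3 :=
  PartialJet.add_bounds
    (poissonJet_bounds (by norm_num) hw (by linarith) (by linarith) (by linarith))
    (poissonJet_bounds (by norm_num) hw (by linarith) (by linarith) (by linarith))

lemma isOn_lowerJet (ε w : ℝ) : (lowerJet ε w).IsOn {p | 0 < p.1} :=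
  (isOn_poissonJet (by norm_num) _).add (isOn_poissonJet (by norm_num) _)

lemma isOn_upperJet (ε w : ℝ) : (upperJet ε w).IsOn {p | 0 < p.1} :=
  (isOn_poissonJet (by norm_num) _).add (isOn_poissonJet (by norm_num) _)

lemma lap_lowerJet (ε w : ℝ) {p : ℝ × ℝ} (hp : 0 < p.1) : (lowerJet ε w).lap p = 0 := by
  rw [lowerJet, PartialJet.lap_add, lap_poissonJet _ _ hp, lap_poissonJet _ _ hp, add_zero]

lemma lap_upperJet (ε w : ℝ) {p : ℝ × ℝ} (hp : 0 < p.1) : (upperJet ε w).lap p = 0 := by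
  rw [upperJet, PartialJet.lap_add, lap_poissonJet _ _ hp, lap_poissonJet _ _ hp, add_zero]

lemma isOn_cutoff_mul {ρ₀ Λ : ℝ} {G : PartialJet} (hG : G.IsOn {p | 0 < p.1}) :
    ((cutoffJet ρ₀ Λ).mul G).IsOn (rimless ρ₀) :=
  (isOn_cutoffJet ρ₀ Λ).mul (hG.mono fun _ hp => hp.1)

lemma cutoffMajorant_nonneg (ρ₀ : ℝ) {p : ℝ × ℝ} (hp : 0 < p.1) : 0 ≤ cutoffMajorant ρ₀ p := by
  have : 0 ≤ rimDistSq ρ₀ p := by rw [rimDistSq]; positivity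
  rw [cutoffMajorant]; positivity

/-- The commutator error of a cutoff solution on a rectangle in the upper half-plane. -/
lemma abs_integral_lap_cutoff_le {ρ₀ Λ M C a b c d : ℝ} {J G : PartialJet} (hΛ : 1 ≤ Λ)
    (ha : 0 < a) (hab : a ≤ b) (hc : 0 < c) (hcd : c ≤ d)
    (hJ : J.IsOn {p | 0 < p.1 ∧ 0 < p.2}) (hM : ∀ p : ℝ × ℝ, 0 < p.1 → 0 < p.2 → |J.f p| ≤ M)
    (hG : G.IsOn {p | 0 < p.1}) (hlap : ∀ p : ℝ × ℝ, 0 < p.1 → G.lap p = 0)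
    (hGb : ∀ p : ℝ × ℝ, c ≤ p.2 → p.2 ≤ d →
      |G.f p| ≤ C / (1 + p.1 ^ 2 + p.2 ^ 2) ∧ |G.r p| ≤ C / √(1 + p.1 ^ 2 + p.2 ^ 2) ^ 3 ∧
      |G.z p| ≤ C / √(1 + p.1 ^ 2 + p.2 ^ 2) ^ 3) :
    |∫ ζ in c..d, ∫ ρ in a..b, ρ * (J.f (ρ, ζ) * ((cutoffJet ρ₀ Λ).mul G).lap (ρ, ζ))| ≤
      (M * (6 * C) * ∫ p in Ioi 0 ×ˢ univ, cutoffMajorant ρ₀ p) / Λ := by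
  have hsub1 : Icc a b ×ˢ Icc c d ⊆ {p : ℝ × ℝ | 0 < p.1 ∧ 0 < p.2} := fun p hp =>
    ⟨ha.trans_le hp.1.1, hc.trans_le hp.2.1⟩
  have hsub2 : Icc a b ×ˢ Icc c d ⊆ rimless ρ₀ := fun p hp =>
    ⟨ha.trans_le hp.1.1, fun h => by
      have := hc.trans_le hp.2.1
      rw [h] at this; exact lt_irrefl _ this⟩
  have hM0 : 0 ≤ M := (abs_nonneg _).trans (hM (1, 1) one_pos one_pos)
  have hC0 : 0 ≤ C := by
    have h1 := (abs_nonneg _).trans (hGb (0, c) le_rfl hcd).1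
    by_contra h
    have h2 : C / (1 + (0 : ℝ) ^ 2 + c ^ 2) < 0 := div_neg_of_neg_of_pos (by linarith) (by positivity)
    exact absurd h1 (not_le.2 h2)
  have hΛ0 : 0 < Λ := by linarith
  have key := abs_iterated_integral_le (a := a) (b := b) (c := c) (d := d)
    (F := fun p => p.1 * (J.f p * ((cutoffJet ρ₀ Λ).mul G).lap p))
    (Maj := fun p => M * (6 * C) / Λ * cutoffMajorant ρ₀ p) ha hab hcd ?_
    ((integrableOn_cutoffMajorant ρ₀).const_mul _) ?_ ?_
  · refine key.trans_eq ?_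
    rw [integral_const_mul]; ring
  · exact continuousOn_fst.mul ((hJ.cf.mono hsub1).mul
      (((isOn_cutoff_mul hG).continuousOn_lap fun p hp => hp.1.ne').mono hsub2))
  · intro p hp
    have := cutoffMajorant_nonneg ρ₀ hp
    positivity
  · intro p hp
    have hp1 := (hsub1 hp).1
    obtain ⟨b1, b2, b3⟩ := hGb p hp.2.1 hp.2.2
    have h1 := abs_lap_cutoff_mul_le hΛ (hsub2 hp) (hlap p hp1) b1 b2 b3
    have h2 := hM p hp1 (hsub1 hp).2
    calc |p.1 * (J.f p * ((cutoffJet ρ₀ Λ).mul G).lap p)|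
        = |J.f p| * |p.1 * ((cutoffJet ρ₀ Λ).mul G).lap p| := by rw [← abs_mul]; congr 1; ring
      _ ≤ M * (6 * C / Λ * cutoffMajorant ρ₀ p) := by gcongr
      _ = M * (6 * C) / Λ * cutoffMajorant ρ₀ p := by ring

/-- Green's identity is applied on `c ≤ ζ ≤ ε` with the lower kernel and on `ε ≤ ζ ≤ b` with the
upper one. The sides and the top lie where the cutoff vanishes, and each volume term is a commutator
error. At level `ε` only the kink survives, so the uncontrolled `J.z` drops out there. -/
lemma green_two_strips {ρ₀ Λ M a b c ε w : ℝ} {J : PartialJet} (hΛ : 1 ≤ Λ)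
    (ha : 0 < a) (hab : a ≤ b) (hc : 0 < c) (hcε : c ≤ ε) (hεb : ε ≤ b) (hw : 0 < w)
    (hJ : J.IsOn {p | 0 < p.1 ∧ 0 < p.2}) (hlap : ∀ p : ℝ × ℝ, 0 < p.1 → 0 < p.2 → J.lap p = 0)
    (hM : ∀ p : ℝ × ℝ, 0 < p.1 → 0 < p.2 → |J.f p| ≤ M)
    (hsupp : ∀ p : ℝ × ℝ, (p.1 ≤ a ∨ b ≤ p.1 ∨ b ≤ p.2) → 0 < p.1 → p ≠ (ρ₀, 0) →
      (cutoffJet ρ₀ Λ).f p = 0 ∧ (cutoffJet ρ₀ Λ).r p = 0 ∧ (cutoffJet ρ₀ Λ).z p = 0) :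
    |(-2 * ∫ ρ in a..b, ρ * (J.f (ρ, ε) * ((cutoffJet ρ₀ Λ).f (ρ, ε) * poissonKerDeriv ρ w))) -
      ∫ ρ in a..b, ρ * (J.f (ρ, c) * ((cutoffJet ρ₀ Λ).mul (lowerJet ε w)).z (ρ, c) -
        J.z (ρ, c) * ((cutoffJet ρ₀ Λ).mul (lowerJet ε w)).f (ρ, c))| ≤
      2 * ((M * (6 * kernelConst ε w) * ∫ p in Ioi 0 ×ˢ univ, cutoffMajorant ρ₀ p) / Λ) := by
  set H₁ := (cutoffJet ρ₀ Λ).mul (lowerJet ε w) with hH₁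
  set H₂ := (cutoffJet ρ₀ Λ).mul (upperJet ε w) with hH₂
  have hε : 0 < ε := hc.trans_le hcε
  have e1 := abs_integral_lap_cutoff_le (ρ₀ := ρ₀) hΛ ha hab hc hcε hJ hM (isOn_lowerJet ε w)
    (fun p hp => lap_lowerJet ε w hp) (fun p h1 h2 => lowerJet_bounds hw (hc.le.trans h1) h2)
  have e2 := abs_integral_lap_cutoff_le (ρ₀ := ρ₀) hΛ ha hab hε hεb hJ hM (isOn_upperJet ε w)
    (fun p hp => lap_upperJet ε w hp) (fun p h1 h2 => upperJet_bounds hw hε h1)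
  have hne : ∀ p : ℝ × ℝ, 0 < p.2 → p ≠ (ρ₀, 0) := fun p hp h => by
    rw [h] at hp; exact lt_irrefl _ hp
  have hside : ∀ G : PartialJet, ∀ ζ, 0 < ζ →
      ((cutoffJet ρ₀ Λ).mul G).f (a, ζ) = 0 ∧ ((cutoffJet ρ₀ Λ).mul G).r (a, ζ) = 0 ∧
      ((cutoffJet ρ₀ Λ).mul G).f (b, ζ) = 0 ∧ ((cutoffJet ρ₀ Λ).mul G).r (b, ζ) = 0 := by
    intro G ζ hζ
    obtain ⟨s1, s2, -⟩ := hsupp (a, ζ) (Or.inl le_rfl) ha (hne _ hζ)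
    obtain ⟨s3, s4, -⟩ := hsupp (b, ζ) (Or.inr (Or.inl le_rfl)) (ha.trans_le hab) (hne _ hζ)
    simp [PartialJet.mul, s1, s2, s3, s4]
  have hrect : ∀ c d : ℝ, 0 < c → ∀ p ∈ Icc a b ×ˢ Icc c d, 0 < p.1 ∧ 0 < p.2 := fun c d hc p hp =>
    ⟨ha.trans_le hp.1.1, hc.trans_le hp.2.1⟩
  have g1 := PartialJet.green_rectangle (K := H₁) ha hab hcε (hJ.mono (hrect c ε hc))
    ((isOn_cutoff_mul (isOn_lowerJet ε w)).mono fun p hp =>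
      ⟨(hrect c ε hc p hp).1, hne p (hrect c ε hc p hp).2⟩)
    (fun p hp => hlap p (hrect c ε hc p hp).1 (hrect c ε hc p hp).2)
    (fun ζ hζ => hside _ ζ (hc.trans_le hζ.1))
  have g2 := PartialJet.green_rectangle (K := H₂) ha hab hεb (hJ.mono (hrect ε b hε))
    ((isOn_cutoff_mul (isOn_upperJet ε w)).mono fun p hp =>
      ⟨(hrect ε b hε p hp).1, hne p (hrect ε b hε p hp).2⟩)
    (fun p hp => hlap p (hrect ε b hε p hp).1 (hrect ε b hε p hp).2)
    (fun ζ hζ => hside _ ζ (hε.trans_le hζ.1))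
  have hb0 : 0 < b := ha.trans_le hab
  have gtop : ∫ ρ in a..b, ρ * (J.f (ρ, b) * H₂.z (ρ, b) - J.z (ρ, b) * H₂.f (ρ, b)) = 0 := by
    refine (intervalIntegral.integral_congr fun ρ hρ => ?_).trans intervalIntegral.integral_zero
    rw [uIcc_of_le hab] at hρ
    obtain ⟨s1, -, s3⟩ := hsupp (ρ, b) (Or.inr (Or.inr le_rfl)) (ha.trans_le hρ.1) (hne _ hb0)
    simp [hH₂, PartialJet.mul, s1, s3]
  have hci : ∀ G : PartialJet, G.IsOn {p | 0 < p.1} → IntervalIntegrable (fun ρ =>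
      ρ * (J.f (ρ, ε) * ((cutoffJet ρ₀ Λ).mul G).z (ρ, ε) -
        J.z (ρ, ε) * ((cutoffJet ρ₀ Λ).mul G).f (ρ, ε))) volume a b := by
    intro G hG
    refine ContinuousOn.intervalIntegrable_of_Icc hab ?_
    have hm1 : MapsTo (fun ρ : ℝ => (ρ, ε)) (Icc a b) {p | 0 < p.1 ∧ 0 < p.2} := fun ρ hρ =>
      ⟨ha.trans_le hρ.1, hε⟩
    have hm2 : MapsTo (fun ρ : ℝ => (ρ, ε)) (Icc a b) (rimless ρ₀) := fun ρ hρ =>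
      ⟨ha.trans_le hρ.1, hne _ hε⟩
    have hcont : ContinuousOn (fun ρ : ℝ => (ρ, ε)) (Icc a b) := by fun_prop
    have hH := isOn_cutoff_mul (ρ₀ := ρ₀) (Λ := Λ) hG
    exact continuousOn_id.mul (((hJ.cf.comp hcont hm1).mul (hH.cz.comp hcont hm2)).sub
      ((hJ.cz.comp hcont hm1).mul (hH.cf.comp hcont hm2)))
  -- At `ζ = ε` the first summands of the two kernels both equal `poissonKer ρ w` and have opposite
  -- `ζ`-derivatives, while the second summands coincide. So the values agree and the derivatives
  -- differ by `-2 poissonKerDeriv ρ w`.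
  have hjump : (∫ ρ in a..b, ρ * (J.f (ρ, ε) * H₁.z (ρ, ε) - J.z (ρ, ε) * H₁.f (ρ, ε))) -
      ∫ ρ in a..b, ρ * (J.f (ρ, ε) * H₂.z (ρ, ε) - J.z (ρ, ε) * H₂.f (ρ, ε)) =
      -2 * ∫ ρ in a..b,
        ρ * (J.f (ρ, ε) * ((cutoffJet ρ₀ Λ).f (ρ, ε) * poissonKerDeriv ρ w)) := by
    rw [← intervalIntegral.integral_sub (hci _ (isOn_lowerJet ε w)) (hci _ (isOn_upperJet ε w)),
      ← intervalIntegral.integral_const_mul]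
    refine intervalIntegral.integral_congr fun ρ _ => ?_
    simp only [PartialJet.mul, lowerJet, upperJet, PartialJet.add, poissonJet]
    rw [show (-1 : ℝ) * ε + (ε + w) = w by ring, show 1 * ε + (w - ε) = w by ring]
    ring
  rw [gtop] at g2
  rw [← hjump]
  rw [g1] at e1
  rw [g2] at e2
  have := abs_add_le
    ((∫ ρ in a..b, ρ * (J.f (ρ, ε) * H₁.z (ρ, ε) - J.z (ρ, ε) * H₁.f (ρ, ε))) -
      ∫ ρ in a..b, ρ * (J.f (ρ, c) * H₁.z (ρ, c) - J.z (ρ, c) * H₁.f (ρ, c)))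
    (0 - ∫ ρ in a..b, ρ * (J.f (ρ, ε) * H₂.z (ρ, ε) - J.z (ρ, ε) * H₂.f (ρ, ε)))
  refine le_trans (le_of_eq ?_) (this.trans (by linarith))
  congr 1; ring

end HalfSpace

/-! ### Limits `c → 0` and `Λ → ∞` in Green's identity -/

section HalfSpaceLimit

lemma isOpen_rimless (ρ₀ : ℝ) : IsOpen (rimless ρ₀) :=
  (isOpen_lt continuous_const continuous_fst).inter isOpen_ne

lemma measurable_cutoffJet_f (ρ₀ Λ : ℝ) : Measurable (cutoffJet ρ₀ Λ).f := by
  have : (cutoffJet ρ₀ Λ).f = fun p => cutoff Λ (Real.log (1 + Real.log p.1 ^ 2) +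
      Real.log (1 + (Real.log ((p.1 - ρ₀) ^ 2 + p.2 ^ 2) / 2) ^ 2)) := rfl
  rw [this]; unfold cutoff; fun_prop

lemma cutoffJet_z_zero (ρ₀ Λ ρ : ℝ) : (cutoffJet ρ₀ Λ).z (ρ, 0) = 0 := by
  simp [cutoffJet, PartialJet.comp, exhaustion, PartialJet.add, logAxisJet, logRimJet]

/-- At height zero the symmetrized kernel and the cutoff have zero `ζ`-derivative, so only `J.z`
times twice the Poisson kernel remains. Domination follows from compactness: near the rim the cutoff
vanishes, at other points of the plane `J.z` has a one-sided limit, and above the plane it is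
continuous. -/
lemma tendsto_lower_boundary_term {ρ₀ Λ M a b r ε w : ℝ} {J : PartialJet} {N : ℝ → ℝ}
    (ha : 0 < a) (hab : a ≤ b) (hε : 0 < ε) (hr : 0 < r)
    (hJ : J.IsOn {p | 0 < p.1 ∧ 0 < p.2})
    (hM : ∀ p : ℝ × ℝ, 0 < p.1 → 0 < p.2 → |J.f p| ≤ M)
    (hN : ∀ ρ > 0, ρ ≠ ρ₀ → Tendsto J.z (𝓝[{p | 0 < p.2}] (ρ, 0)) (𝓝 (N ρ)))
    (hsupp : ∀ p : ℝ × ℝ, rimDistSq ρ₀ p < r ^ 2 → 0 < p.1 → p ≠ (ρ₀, 0) →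
      (cutoffJet ρ₀ Λ).f p = 0 ∧ (cutoffJet ρ₀ Λ).r p = 0 ∧ (cutoffJet ρ₀ Λ).z p = 0) :
    Tendsto (fun c => ∫ ρ in a..b, ρ * (J.f (ρ, c) * ((cutoffJet ρ₀ Λ).mul (lowerJet ε w)).z (ρ, c) -
        J.z (ρ, c) * ((cutoffJet ρ₀ Λ).mul (lowerJet ε w)).f (ρ, c))) (𝓝[>] 0)
      (𝓝 (∫ ρ in a..b, -2 * (ρ * N ρ * ((cutoffJet ρ₀ Λ).f (ρ, 0) * poissonKer ρ (ε + w))))) := by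
  set H := (cutoffJet ρ₀ Λ).mul (lowerJet ε w) with hH
  have hHon : H.IsOn (rimless ρ₀) := isOn_cutoff_mul (isOn_lowerJet ε w)
  set S : Set (ℝ × ℝ) := {p | 0 < p.2} with hS
  have hSne : ∀ p ∈ S, p ≠ (ρ₀, 0) := fun p hp h => by
    rw [h] at hp; exact lt_irrefl _ (show (0 : ℝ) < 0 from hp)
  have hcatH : ∀ {F : ℝ × ℝ → ℝ}, ContinuousOn F (rimless ρ₀) → ∀ x ∈ rimless ρ₀,
      Tendsto F (𝓝[S] x) (𝓝 (F x)) := fun hF x hx =>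
    (hF.continuousAt ((isOpen_rimless ρ₀).mem_nhds hx)).tendsto.mono_left nhdsWithin_le_nhds
  have hopen : IsOpen {p : ℝ × ℝ | 0 < p.1 ∧ 0 < p.2} :=
    (isOpen_lt continuous_const continuous_fst).inter (isOpen_lt continuous_const continuous_snd)
  have hJO : ∀ x : ℝ × ℝ, 0 < x.1 → J.f =O[𝓝[S] x] fun _ => (1 : ℝ) := by
    intro x hx
    refine Asymptotics.IsBigO.of_bound M ?_
    filter_upwards [self_mem_nhdsWithin, mem_nhdsWithin_of_mem_nhds
      ((isOpen_lt continuous_const continuous_fst).mem_nhds hx)] with p h1 h2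
    simpa using hM p h2 h1
  obtain ⟨C, hC⟩ := (isCompact_Icc.prod isCompact_Icc :
      IsCompact (Icc a b ×ˢ Icc (0 : ℝ) ε)).exists_bound_of_isBigO_one (S := S)
    (f := fun p => p.1 * (J.f p * H.z p - J.z p * H.f p)) (by
      intro x hx
      have hx1 : 0 < x.1 := ha.trans_le hx.1.1
      by_cases hxr : x = (ρ₀, 0)
      · refine Asymptotics.IsBigO.of_bound 0 ?_
        have hc : Continuous (rimDistSq ρ₀) := by unfold rimDistSq; fun_prop
        have h0 : rimDistSq ρ₀ x < r ^ 2 := by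
          rw [hxr]; simp only [rimDistSq, sub_self]; simpa using pow_pos hr 2
        filter_upwards [self_mem_nhdsWithin, mem_nhdsWithin_of_mem_nhds
          ((isOpen_lt continuous_const continuous_fst).mem_nhds hx1), mem_nhdsWithin_of_mem_nhds
          ((isOpen_lt hc continuous_const).mem_nhds h0)] with p h1 h2 h3
        obtain ⟨s1, s2, s3⟩ := hsupp p h3 h2 (hSne p h1)
        simp [hH, PartialJet.mul, s1, s3]
      · have hxm : x ∈ rimless ρ₀ := ⟨hx1, hxr⟩
        have hz : J.z =O[𝓝[S] x] fun _ => (1 : ℝ) := by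
          rcases hx.2.1.eq_or_lt with h | h
          · have hx' : x = (x.1, 0) := Prod.ext rfl h.symm
            rw [hx']
            exact (hN x.1 hx1 fun h' => hxr (by rw [hx', h'])).isBigO_one ℝ
          · exact ((hJ.cz.continuousAt (hopen.mem_nhds ⟨hx1, h⟩)).tendsto.mono_left
              nhdsWithin_le_nhds).isBigO_one ℝ
        have h1 := (hcatH hHon.cz x hxm).isBigO_one ℝ
        have h2 := (hcatH hHon.cf x hxm).isBigO_one ℝ
        have h3 : (fun p : ℝ × ℝ => p.1) =O[𝓝[S] x] fun _ => (1 : ℝ) :=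
          (continuous_fst.tendsto x |>.mono_left nhdsWithin_le_nhds).isBigO_one ℝ
        simpa using h3.mul (((hJO x hx1).mul h1).sub (hz.mul h2)))
  refine intervalIntegral.tendsto_integral_filter_of_dominated_convergence (fun _ => C) ?_ ?_ ?_ ?_
  · filter_upwards [self_mem_nhdsWithin] with c hc
    have hc0 : (0 : ℝ) < c := hc
    refine ContinuousOn.aestronglyMeasurable ?_ measurableSet_uIoc
    rw [uIoc_of_le hab]
    have hm1 : MapsTo (fun ρ : ℝ => (ρ, c)) (Ioc a b) {p | 0 < p.1 ∧ 0 < p.2} := fun ρ hρ =>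
      ⟨ha.trans hρ.1, hc0⟩
    have hm2 : MapsTo (fun ρ : ℝ => (ρ, c)) (Ioc a b) (rimless ρ₀) := fun ρ hρ =>
      ⟨ha.trans hρ.1, hSne _ hc0⟩
    have hcont : ContinuousOn (fun ρ : ℝ => (ρ, c)) (Ioc a b) := by fun_prop
    exact continuousOn_id.mul (((hJ.cf.comp hcont hm1).mul (hHon.cz.comp hcont hm2)).sub
      ((hJ.cz.comp hcont hm1).mul (hHon.cf.comp hcont hm2)))
  · filter_upwards [Ioc_mem_nhdsGT hε] with c hc
    refine ae_of_all _ fun ρ hρ => ?_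
    rw [uIoc_of_le hab] at hρ
    exact hC (ρ, c) ⟨⟨⟨hρ.1.le, hρ.2⟩, ⟨hc.1.le, hc.2⟩⟩, hc.1⟩
  · exact intervalIntegrable_const
  · have hae : ∀ᵐ ρ : ℝ, ρ ≠ ρ₀ := by simp [ae_iff]
    filter_upwards [hae] with ρ hne hρ
    rw [uIoc_of_le hab] at hρ
    have hρ0 : 0 < ρ := ha.trans hρ.1
    have hmem : ((ρ, 0) : ℝ × ℝ) ∈ rimless ρ₀ := ⟨hρ0, fun h => hne (congrArg Prod.fst h)⟩
    have hpath : Tendsto (fun c : ℝ => (ρ, c)) (𝓝[>] 0) (𝓝[S] (ρ, 0)) := by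
      refine tendsto_nhdsWithin_iff.2 ⟨?_, ?_⟩
      · exact (Continuous.tendsto (by fun_prop) _).mono_left nhdsWithin_le_nhds
      · filter_upwards [self_mem_nhdsWithin] with c hc using hc
    -- Here `J.f` is merely bounded and the other factor tends to zero; no boundary limit of `J.f`
    -- is used.
    have t1 : Tendsto (fun p => J.f p * H.z p) (𝓝[S] (ρ, 0)) (𝓝 0) := by
      have hz0 : H.z (ρ, 0) = 0 := by
        simp only [hH, PartialJet.mul, cutoffJet_z_zero, lowerJet, PartialJet.add, poissonJet]
        ring_nf
      have h1 := hcatH hHon.cz _ hmem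
      rw [hz0] at h1
      have h2 := (hJO (ρ, 0) hρ0).mul_isLittleO ((Asymptotics.isLittleO_one_iff ℝ).2 h1)
      simp only [mul_one] at h2
      exact (Asymptotics.isLittleO_one_iff ℝ).1 h2
    have t2 := (hN ρ hρ0 hne).mul (hcatH hHon.cf _ hmem)
    have hf0 : H.f (ρ, 0) = (cutoffJet ρ₀ Λ).f (ρ, 0) * (2 * poissonKer ρ (ε + w)) := by
      simp only [hH, PartialJet.mul, lowerJet, PartialJet.add, poissonJet]
      ring_nf
    have t3 := ((t1.sub t2).comp hpath).const_mul ρ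
    rw [hf0] at t3
    rw [show -2 * (ρ * N ρ * ((cutoffJet ρ₀ Λ).f (ρ, 0) * poissonKer ρ (ε + w))) = ρ * (0 - N ρ *
      ((cutoffJet ρ₀ Λ).f (ρ, 0) * (2 * poissonKer ρ (ε + w)))) by ring]
    exact t3

lemma integrable_one_div_sq_add_sq {w : ℝ} (hw : 0 < w) :
    Integrable (fun ρ : ℝ => 1 / (ρ ^ 2 + w ^ 2)) := by
  refine (integrable_inv_one_add_sq.const_mul (1 + 1 / w ^ 2)).mono'
    (Measurable.aestronglyMeasurable (by fun_prop)) (ae_of_all _ fun ρ => ?_)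
  rw [Real.norm_of_nonneg (by positivity), ← div_eq_mul_inv,
    div_le_div_iff₀ (by positivity) (by positivity), one_mul]
  have : (1 + 1 / w ^ 2) * (ρ ^ 2 + w ^ 2) = ρ ^ 2 + w ^ 2 + ρ ^ 2 / w ^ 2 + 1 := by
    field_simp; ring
  rw [this]
  have : 0 ≤ ρ ^ 2 / w ^ 2 := by positivity
  nlinarith [sq_nonneg w]

lemma abs_mul_poissonKerDeriv_le {ρ w : ℝ} (hρ : 0 < ρ) (hw : 0 < w) :
    |ρ * poissonKerDeriv ρ w| ≤ 4 * (1 / (ρ ^ 2 + w ^ 2)) := by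
  have h := abs_poissonKerDeriv_le ρ hw
  have hS0 : 0 < √(ρ ^ 2 + w ^ 2) := by positivity
  have hρS : ρ ≤ √(ρ ^ 2 + w ^ 2) := Real.le_sqrt_of_sq_le (by nlinarith [sq_nonneg w])
  have hS2 : √(ρ ^ 2 + w ^ 2) ^ 2 = ρ ^ 2 + w ^ 2 := Real.sq_sqrt (by positivity)
  rw [← hS2, abs_mul, abs_of_pos hρ]
  calc ρ * |poissonKerDeriv ρ w| ≤ √(ρ ^ 2 + w ^ 2) * (4 / √(ρ ^ 2 + w ^ 2) ^ 3) := by gcongr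
    _ = 4 * (1 / √(ρ ^ 2 + w ^ 2) ^ 2) := by field_simp

lemma abs_mul_poissonKer_le {ρ s : ℝ} (hρ : 0 < ρ) (hs : 0 < s) :
    |ρ * poissonKer ρ s| ≤ 1 / s := by
  have h := abs_poissonKer_le ρ hs
  have hS0 : 0 < √(ρ ^ 2 + s ^ 2) := by positivity
  have hρS : ρ ≤ √(ρ ^ 2 + s ^ 2) := Real.le_sqrt_of_sq_le (by nlinarith [sq_nonneg s])
  have hsS : s ≤ √(ρ ^ 2 + s ^ 2) := Real.le_sqrt_of_sq_le (by nlinarith [sq_nonneg ρ])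
  rw [abs_mul, abs_of_pos hρ]
  calc ρ * |poissonKer ρ s| ≤ √(ρ ^ 2 + s ^ 2) * (1 / √(ρ ^ 2 + s ^ 2) ^ 2) := by gcongr
    _ = 1 / √(ρ ^ 2 + s ^ 2) := by field_simp
    _ ≤ 1 / s := by gcongr

lemma measurable_poissonKer (z : ℝ) : Measurable fun ρ => poissonKer ρ z := by
  unfold poissonKer; fun_prop

lemma measurable_poissonKerDeriv (z : ℝ) : Measurable fun ρ => poissonKerDeriv ρ z := by
  unfold poissonKerDeriv; fun_prop

lemma tendsto_cutoffJet_f (ρ₀ : ℝ) (p : ℝ × ℝ) :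
    Tendsto (fun Λ => (cutoffJet ρ₀ Λ).f p) atTop (𝓝 1) := tendsto_cutoff _

/-- Green's identity in the half-space for a bounded solution with integrable normal derivative
`N` on the boundary, tested against derivatives of Newton kernels with sources on the axis. -/
theorem half_space_green_identity {ρ₀ M ε w : ℝ} {J : PartialJet} {N : ℝ → ℝ}
    (hρ₀ : 0 < ρ₀) (hε : 0 < ε) (hw : 0 < w)
    (hJ : J.IsOn {p | 0 < p.1 ∧ 0 < p.2}) (hlap : ∀ p : ℝ × ℝ, 0 < p.1 → 0 < p.2 → J.lap p = 0)
    (hM : ∀ p : ℝ × ℝ, 0 < p.1 → 0 < p.2 → |J.f p| ≤ M)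
    (hN : ∀ ρ > 0, ρ ≠ ρ₀ → Tendsto J.z (𝓝[{p | 0 < p.2}] (ρ, 0)) (𝓝 (N ρ)))
    (hNint : IntegrableOn N (Ioi 0)) :
    ∫ ρ in Ioi 0, ρ * J.f (ρ, ε) * poissonKerDeriv ρ w =
      ∫ ρ in Ioi 0, ρ * N ρ * poissonKer ρ (ε + w) := by
  have hs : 0 < ε + w := by positivity
  have hJε : ContinuousOn (fun ρ => J.f (ρ, ε)) (Ioi 0) :=
    hJ.cf.comp (by fun_prop) fun ρ hρ => ⟨hρ, hε⟩
  set C := 2 * (M * (6 * kernelConst ε w) * ∫ p in Ioi 0 ×ˢ univ, cutoffMajorant ρ₀ p) with hC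
  -- At fixed `Λ` the lower level `c` tends to zero first; the error bound `C / Λ` does not depend
  -- on `c` or on the rectangle.
  have hstep : ∀ Λ : ℝ, 1 ≤ Λ →
      |(-2 * ∫ ρ in Ioi 0, ρ * (J.f (ρ, ε) * ((cutoffJet ρ₀ Λ).f (ρ, ε) * poissonKerDeriv ρ w))) -
        ∫ ρ in Ioi 0, -2 * (ρ * N ρ * ((cutoffJet ρ₀ Λ).f (ρ, 0) * poissonKer ρ (ε + w)))| ≤
        C / Λ := by
    intro Λ hΛ
    obtain ⟨a, b, r, ha, hab, hεb, -, hr, hsupp⟩ := exists_support_cutoffJet ρ₀ hρ₀ Λ hΛ ε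
    have hlim := tendsto_lower_boundary_term (Λ := Λ) (w := w) ha hab.le hε hr hJ hM hN
      fun p hp => hsupp p (Or.inr (Or.inr (Or.inr hp)))
    -- The cutoff vanishes outside `(a, b)`, so the integrals extend to the half-line and no longer
    -- involve the `Λ`-dependent `a` and `b`.
    have hres : ∀ F : ℝ → ℝ, (∀ᵐ ρ : ℝ, 0 < ρ → (ρ ≤ a ∨ b ≤ ρ) → F ρ = 0) →
        ∫ ρ in a..b, F ρ = ∫ ρ in Ioi 0, F ρ := by
      intro F hF
      rw [intervalIntegral.integral_of_le hab.le]
      symm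
      refine setIntegral_eq_of_subset_of_ae_sdiff_eq_zero measurableSet_Ioi.nullMeasurableSet
        (fun x hx => ha.trans hx.1) ?_
      filter_upwards [hF] with x hx hxm
      refine hx hxm.1 ?_
      have := hxm.2
      simp only [mem_Ioc, not_and_or, not_lt, not_le] at this
      exact this.imp_right le_of_lt
    have hae : ∀ᵐ ρ : ℝ, ρ ≠ ρ₀ := by simp [ae_iff]
    rw [← hres _ (ae_of_all _ fun ρ hρ h => ?_), ← hres _ ?_]
    · refine le_of_tendsto (tendsto_const_nhds.sub hlim).abs ?_
      filter_upwards [Ioc_mem_nhdsGT hε] with c hc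
      have := green_two_strips hΛ ha hab.le hc.1 hc.2 hεb.le hw hJ hlap hM
        (fun p hp => hsupp p (by tauto))
      rw [← mul_div_assoc] at this
      exact this
    · filter_upwards [hae] with ρ hne hρ h
      rw [(hsupp (ρ, 0) (by tauto) hρ fun h' => hne (congrArg Prod.fst h')).1]
      ring
    · rw [(hsupp (ρ, ε) (by tauto) hρ fun h' => hε.ne' (congrArg Prod.snd h')).1]
      ring
  have hM0 : 0 ≤ M := (abs_nonneg _).trans (hM (1, 1) one_pos one_pos)
  have l1 : Tendsto (fun Λ => ∫ ρ in Ioi 0,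
      ρ * (J.f (ρ, ε) * ((cutoffJet ρ₀ Λ).f (ρ, ε) * poissonKerDeriv ρ w))) atTop
      (𝓝 (∫ ρ in Ioi 0, ρ * J.f (ρ, ε) * poissonKerDeriv ρ w)) := by
    refine tendsto_integral_filter_of_dominated_convergence
      (fun ρ => M * (4 * (1 / (ρ ^ 2 + w ^ 2)))) ?_ ?_ ?_ ?_
    · refine Eventually.of_forall fun Λ => ?_
      refine measurable_id.aestronglyMeasurable.mul ((hJε.aestronglyMeasurable
        measurableSet_Ioi).mul (Measurable.aestronglyMeasurable ?_))
      exact ((measurable_cutoffJet_f ρ₀ Λ).comp (by fun_prop)).mul (measurable_poissonKerDeriv w)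
    · filter_upwards [eventually_ge_atTop 1] with Λ hΛ
      refine (ae_restrict_iff' measurableSet_Ioi).2 (ae_of_all _ fun ρ hρ => ?_)
      have h1 := cutoffJet_f_mem (ρ₀ := ρ₀) hΛ (ρ, ε)
      have h2 := abs_mul_poissonKerDeriv_le hρ hw
      have h3 := hM (ρ, ε) hρ hε
      calc ‖ρ * (J.f (ρ, ε) * ((cutoffJet ρ₀ Λ).f (ρ, ε) * poissonKerDeriv ρ w))‖
          = |J.f (ρ, ε)| * ((cutoffJet ρ₀ Λ).f (ρ, ε) * |ρ * poissonKerDeriv ρ w|) := by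
            rw [Real.norm_eq_abs, ← abs_of_nonneg h1.1, ← abs_mul, ← abs_mul, abs_of_nonneg h1.1]
            congr 1; ring
        _ ≤ M * (1 * (4 * (1 / (ρ ^ 2 + w ^ 2)))) := by
            have := h1.1
            gcongr
            exact h1.2
        _ = _ := by ring
    · exact (((integrable_one_div_sq_add_sq hw).const_mul 4).const_mul M).integrableOn
    · refine (ae_restrict_iff' measurableSet_Ioi).2 (ae_of_all _ fun ρ hρ => ?_)
      have := (((tendsto_cutoffJet_f ρ₀ (ρ, ε)).mul_const (poissonKerDeriv ρ w)).const_mul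
        (J.f (ρ, ε))).const_mul ρ
      convert this using 2
      ring
  have l2 : Tendsto (fun Λ => ∫ ρ in Ioi 0,
      -2 * (ρ * N ρ * ((cutoffJet ρ₀ Λ).f (ρ, 0) * poissonKer ρ (ε + w)))) atTop
      (𝓝 (∫ ρ in Ioi 0, -2 * (ρ * N ρ * poissonKer ρ (ε + w)))) := by
    refine tendsto_integral_filter_of_dominated_convergence
      (fun ρ => 2 * (1 / (ε + w)) * |N ρ|) ?_ ?_ ?_ ?_
    · refine Eventually.of_forall fun Λ => ?_
      refine aestronglyMeasurable_const.mul ((measurable_id.aestronglyMeasurable.mul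
        hNint.aestronglyMeasurable).mul (Measurable.aestronglyMeasurable ?_))
      exact ((measurable_cutoffJet_f ρ₀ Λ).comp (by fun_prop)).mul (measurable_poissonKer _)
    · filter_upwards [eventually_ge_atTop 1] with Λ hΛ
      refine (ae_restrict_iff' measurableSet_Ioi).2 (ae_of_all _ fun ρ hρ => ?_)
      have h1 := cutoffJet_f_mem (ρ₀ := ρ₀) hΛ (ρ, 0)
      have h2 := abs_mul_poissonKer_le hρ hs
      calc ‖-2 * (ρ * N ρ * ((cutoffJet ρ₀ Λ).f (ρ, 0) * poissonKer ρ (ε + w)))‖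
          = 2 * ((cutoffJet ρ₀ Λ).f (ρ, 0) * |ρ * poissonKer ρ (ε + w)|) * |N ρ| := by
            simp only [norm_mul, Real.norm_eq_abs, abs_mul, abs_neg, abs_two]
            rw [abs_of_nonneg h1.1]; ring
        _ ≤ 2 * (1 * (1 / (ε + w))) * |N ρ| := by
            gcongr
            exact h1.2
        _ = _ := by ring
    · exact hNint.norm.const_mul _
    · refine (ae_restrict_iff' measurableSet_Ioi).2 (ae_of_all _ fun ρ hρ => ?_)
      have := (((tendsto_cutoffJet_f ρ₀ (ρ, 0)).mul_const (poissonKer ρ (ε + w))).const_mul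
        (ρ * N ρ)).const_mul (-2)
      convert this using 2
      ring
  have hzero : Tendsto (fun Λ : ℝ => C / Λ) atTop (𝓝 0) := tendsto_const_nhds.div_atTop tendsto_id
  have hfin := le_of_tendsto_of_tendsto ((l1.const_mul (-2)).sub l2).abs hzero (by
    filter_upwards [eventually_ge_atTop 1] with Λ hΛ using hstep Λ hΛ)
  rw [integral_const_mul] at hfin
  have := abs_nonpos_iff.1 hfin
  linarith

end HalfSpaceLimit

/-! ### Poisson transforms at axis points -/

section AxisTransform

lemma poissonKer_nonneg (ρ : ℝ) {w : ℝ} (hw : 0 < w) : 0 ≤ poissonKer ρ w := by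
  rw [poissonKer]; positivity

/-- The antiderivative is `-w / √(w² + ρ²)`. Total mass one makes the kernel an approximate identity
as `w → 0` and a dominating weight elsewhere. -/
lemma integral_mul_poissonKer {w : ℝ} (hw : 0 < w) :
    IntegrableOn (fun ρ => ρ * poissonKer ρ w) (Ioi 0) ∧
      ∫ ρ in Ioi 0, ρ * poissonKer ρ w = 1 := by
  have h := integral_Ioi_of_deriv_nonneg (a := 0) (l := 0)
    (g := fun ρ => -(w * (√(w ^ 2 + ρ ^ 2) ^ 1)⁻¹)) (g' := fun ρ => ρ * poissonKer ρ w) ?_ ?_ ?_ ?_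
  · refine ⟨h.1, h.2.trans ?_⟩
    simp [Real.sqrt_sq hw.le, hw.ne']
  · exact ((hasDerivAt_inv_sqrt_add_sq_pow (by positivity) 1).const_mul
      w).neg.continuousAt.continuousWithinAt
  · intro ρ _
    refine ((hasDerivAt_inv_sqrt_add_sq_pow (by positivity) 1).const_mul w).neg.congr_deriv ?_
    rw [poissonKer, add_comm (w ^ 2)]; push_cast; ring
  · intro ρ hρ
    exact mul_nonneg (le_of_lt hρ) (poissonKer_nonneg ρ hw)
  · rw [← neg_zero, ← mul_zero w]
    refine (Tendsto.const_mul w (Tendsto.inv_tendsto_atTop ?_)).neg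
    simp only [pow_one]
    exact Real.tendsto_sqrt_atTop.comp
      (tendsto_atTop_add_const_left _ _ (tendsto_pow_atTop two_ne_zero))

variable {g N : ℝ → ℝ} {M : ℝ}

lemma integrableOn_mul_poissonKer (hg : AEStronglyMeasurable g (volume.restrict (Ioi 0)))
    (hM : ∀ ρ > 0, |g ρ| ≤ M) {w : ℝ} (hw : 0 < w) :
    IntegrableOn (fun ρ => ρ * g ρ * poissonKer ρ w) (Ioi 0) := by
  refine ((integral_mul_poissonKer hw).1.const_mul M).mono'
    ((measurable_id.aestronglyMeasurable.mul hg).mul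
      (measurable_poissonKer w).aestronglyMeasurable) ?_
  refine (ae_restrict_iff' measurableSet_Ioi).2 (ae_of_all _ fun ρ hρ => ?_)
  have h1 := hM ρ hρ
  have h2 := mul_nonneg (le_of_lt hρ) (poissonKer_nonneg ρ hw)
  calc ‖ρ * g ρ * poissonKer ρ w‖ = |g ρ| * (ρ * poissonKer ρ w) := by
        rw [Real.norm_eq_abs, show ρ * g ρ * poissonKer ρ w = g ρ * (ρ * poissonKer ρ w) by ring,
      abs_mul, abs_of_nonneg h2]
    _ ≤ M * (ρ * poissonKer ρ w) := by gcongr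

lemma hasDerivAt_integral_poissonKer (hg : AEStronglyMeasurable g (volume.restrict (Ioi 0)))
    (hM : ∀ ρ > 0, |g ρ| ≤ M) {w : ℝ} (hw : 0 < w) :
    HasDerivAt (fun v => ∫ ρ in Ioi 0, ρ * g ρ * poissonKer ρ v)
      (∫ ρ in Ioi 0, ρ * g ρ * poissonKerDeriv ρ w) w := by
  have hM0 : 0 ≤ M := (abs_nonneg _).trans (hM 1 one_pos)
  refine (hasDerivAt_integral_of_dominated_loc_of_deriv_le (μ := volume.restrict (Ioi 0))
    (F := fun v ρ => ρ * g ρ * poissonKer ρ v) (F' := fun v ρ => ρ * g ρ * poissonKerDeriv ρ v)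
    (bound := fun ρ => M * (4 * (1 / (ρ ^ 2 + (w / 2) ^ 2))))
    (s := Ioi (w / 2)) (Ioi_mem_nhds (by linarith)) ?_
    (integrableOn_mul_poissonKer hg hM hw) ?_ ?_ ?_ ?_).2
  · exact Eventually.of_forall fun v => (measurable_id.aestronglyMeasurable.mul hg).mul
      (measurable_poissonKer v).aestronglyMeasurable
  · exact (measurable_id.aestronglyMeasurable.mul hg).mul
      (measurable_poissonKerDeriv w).aestronglyMeasurable
  · refine (ae_restrict_iff' measurableSet_Ioi).2 (ae_of_all _ fun ρ hρ v hv => ?_)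
    have hv' : w / 2 < v := hv
    have h1 := hM ρ hρ
    have h2 := abs_mul_poissonKerDeriv_le hρ ((by positivity : 0 < w / 2).trans hv')
    calc ‖ρ * g ρ * poissonKerDeriv ρ v‖ = |g ρ| * |ρ * poissonKerDeriv ρ v| := by
          rw [Real.norm_eq_abs, ← abs_mul]; congr 1; ring
      _ ≤ M * (4 * (1 / (ρ ^ 2 + v ^ 2))) := by gcongr
      _ ≤ M * (4 * (1 / (ρ ^ 2 + (w / 2) ^ 2))) := by gcongr
  · exact (((integrable_one_div_sq_add_sq (by positivity)).const_mul 4).const_mul M).integrableOn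
  · refine (ae_restrict_iff' measurableSet_Ioi).2 (ae_of_all _ fun ρ hρ v _ => ?_)
    exact (hasDerivAt_poissonKer hρ v).const_mul (ρ * g ρ)
-- The mass spreads out as `w` grows: on a bounded interval the kernel is at most `1 / w²`, and
-- beyond it `g` is small.
lemma tendsto_integral_poissonKer_atTop
    (hM : ∀ ρ > 0, |g ρ| ≤ M) (hd : Tendsto g atTop (𝓝 0)) :
    Tendsto (fun w => ∫ ρ in Ioi 0, ρ * g ρ * poissonKer ρ w) atTop (𝓝 0) := by
  rw [Metric.tendsto_nhds]
  intro e he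
  obtain ⟨R, hR⟩ := eventually_atTop.1 ((Metric.tendsto_nhds.1 hd) (e / 2) (by positivity))
  have hM0 : 0 ≤ M := (abs_nonneg _).trans (hM 1 one_pos)
  set R' := max R 0 with hR'
  have hR0 : 0 ≤ R' := le_max_right _ _
  have h2 : Tendsto (fun w : ℝ => M * R' ^ 2 / w ^ 2) atTop (𝓝 0) :=
    tendsto_const_nhds.div_atTop (tendsto_pow_atTop two_ne_zero)
  filter_upwards [eventually_gt_atTop 0, h2.eventually_lt_const (show (0 : ℝ) < e / 2 by positivity)]
    with w hw hlt
  rw [dist_zero_right]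
  have i1 : IntegrableOn (fun _ : ℝ => M * R' / w ^ 2) (Ioc 0 R') := by simp
  have i1' : Integrable ((Ioc 0 R').indicator fun _ : ℝ => M * R' / w ^ 2)
      (volume.restrict (Ioi 0)) :=
    ((integrable_indicator_iff measurableSet_Ioc).2 i1).integrableOn
  have i2 := (integral_mul_poissonKer hw).1.const_mul (e / 2)
  have hval : ∫ ρ in Ioi 0, ((Ioc 0 R').indicator (fun _ : ℝ => M * R' / w ^ 2) ρ +
      e / 2 * (ρ * poissonKer ρ w)) = M * R' ^ 2 / w ^ 2 + e / 2 := by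
    rw [integral_add i1' i2, integral_const_mul, (integral_mul_poissonKer hw).2,
      setIntegral_indicator measurableSet_Ioc]
    have : Ioi (0 : ℝ) ∩ Ioc 0 R' = Ioc 0 R' := inter_eq_right.2 fun x hx => hx.1
    rw [this]
    simp only [integral_const, MeasurableSet.univ, measureReal_restrict_apply, univ_inter,
      Real.volume_real_Ioc_of_le hR0, smul_eq_mul]
    ring
  refine lt_of_le_of_lt (norm_integral_le_of_norm_le (i1'.add i2) ?_)
    (hval.trans_lt (by linarith))
  refine (ae_restrict_iff' measurableSet_Ioi).2 (ae_of_all _ fun ρ hρ => ?_)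
  have hρ0 : 0 < ρ := hρ
  have hk := poissonKer_nonneg ρ hw
  have hnorm : ‖ρ * g ρ * poissonKer ρ w‖ = |g ρ| * (ρ * poissonKer ρ w) := by
    have h2 := mul_nonneg hρ0.le hk
    rw [Real.norm_eq_abs, show ρ * g ρ * poissonKer ρ w = g ρ * (ρ * poissonKer ρ w) by ring,
      abs_mul, abs_of_nonneg h2]
  rw [hnorm]
  simp only [Pi.add_apply]
  rcases le_or_gt ρ R' with h | h
  · have hmem : ρ ∈ Ioc 0 R' := ⟨hρ0, h⟩
    rw [indicator_of_mem hmem]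
    have hkw : poissonKer ρ w ≤ 1 / w ^ 2 := by
      have hb := (le_abs_self _).trans (abs_poissonKer_le ρ hw)
      rw [Real.sq_sqrt (by positivity)] at hb
      refine hb.trans (one_div_le_one_div_of_le (by positivity) ?_)
      nlinarith [sq_nonneg ρ]
    calc |g ρ| * (ρ * poissonKer ρ w) ≤ M * (R' * (1 / w ^ 2)) := by
          have := hM ρ hρ0
          gcongr
      _ = M * R' / w ^ 2 := by ring
      _ ≤ _ := by
          have : 0 ≤ e / 2 * (ρ * poissonKer ρ w) := by positivity
          linarith
  · rw [indicator_of_notMem (fun hx => not_le.2 h hx.2), zero_add]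
    have := hR ρ ((le_max_left R 0).trans h.le)
    rw [dist_zero_right, Real.norm_eq_abs] at this
    gcongr

/-- The axis values of the single layer potential with density proportional to `N`. -/
noncomputable def axisPotential (N : ℝ → ℝ) (s : ℝ) : ℝ :=
  -∫ ρ in Ioi 0, ρ * N ρ * (√(ρ ^ 2 + s ^ 2))⁻¹

lemma mul_inv_sqrt_le_one {ρ : ℝ} (hρ : 0 < ρ) (s : ℝ) : ρ * (√(ρ ^ 2 + s ^ 2))⁻¹ ≤ 1 := by
  have hS : 0 < √(ρ ^ 2 + s ^ 2) := by positivity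
  rw [← div_eq_mul_inv, div_le_one hS]
  exact Real.le_sqrt_of_sq_le (by nlinarith [sq_nonneg s])

lemma norm_axisPotential_integrand_le {ρ : ℝ} (hρ : 0 < ρ) (s : ℝ) :
    ‖ρ * N ρ * (√(ρ ^ 2 + s ^ 2))⁻¹‖ ≤ |N ρ| := by
  have h : 0 ≤ ρ * (√(ρ ^ 2 + s ^ 2))⁻¹ := by positivity
  calc ‖ρ * N ρ * (√(ρ ^ 2 + s ^ 2))⁻¹‖ = |N ρ| * (ρ * (√(ρ ^ 2 + s ^ 2))⁻¹) := by
        rw [Real.norm_eq_abs, mul_comm ρ, mul_assoc, abs_mul, abs_of_nonneg h]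
    _ ≤ |N ρ| * 1 := by gcongr; exact mul_inv_sqrt_le_one hρ s
    _ = |N ρ| := mul_one _

lemma aestronglyMeasurable_axisPotential_integrand (hN : IntegrableOn N (Ioi 0)) (s : ℝ) :
    AEStronglyMeasurable (fun ρ => ρ * N ρ * (√(ρ ^ 2 + s ^ 2))⁻¹) (volume.restrict (Ioi 0)) :=
  (measurable_id.aestronglyMeasurable.mul hN.aestronglyMeasurable).mul
    (Measurable.aestronglyMeasurable (by fun_prop))

lemma hasDerivAt_axisPotential (hN : IntegrableOn N (Ioi 0)) {s : ℝ} (hs : 0 < s) :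
    HasDerivAt (axisPotential N) (∫ ρ in Ioi 0, ρ * N ρ * poissonKer ρ s) s := by
  have h := (hasDerivAt_integral_of_dominated_loc_of_deriv_le (μ := volume.restrict (Ioi 0))
    (F := fun v ρ => ρ * N ρ * (√(ρ ^ 2 + v ^ 2))⁻¹)
    (F' := fun v ρ => -(ρ * N ρ * poissonKer ρ v))
    (bound := fun ρ => |N ρ| * (1 / (s / 2)))
    (s := Ioi (s / 2)) (x₀ := s) (Ioi_mem_nhds (by linarith)) ?_ ?_ ?_ ?_ ?_ ?_).2
  · refine h.neg.congr_deriv ?_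
    rw [integral_neg, neg_neg]
  · exact Eventually.of_forall fun v => aestronglyMeasurable_axisPotential_integrand hN v
  · refine hN.norm.mono' (aestronglyMeasurable_axisPotential_integrand hN s) ?_
    exact (ae_restrict_iff' measurableSet_Ioi).2 (ae_of_all _ fun ρ hρ =>
      norm_axisPotential_integrand_le hρ s)
  · exact ((measurable_id.aestronglyMeasurable.mul hN.aestronglyMeasurable).mul
      (measurable_poissonKer s).aestronglyMeasurable).neg
  · refine (ae_restrict_iff' measurableSet_Ioi).2 (ae_of_all _ fun ρ hρ v hv => ?_)
    have hv' : s / 2 < v := hv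
    have h2 := abs_mul_poissonKer_le hρ ((by positivity : 0 < s / 2).trans hv')
    calc ‖-(ρ * N ρ * poissonKer ρ v)‖ = |N ρ| * |ρ * poissonKer ρ v| := by
          rw [norm_neg, Real.norm_eq_abs, ← abs_mul]; congr 1; ring
      _ ≤ |N ρ| * (1 / v) := by gcongr
      _ ≤ |N ρ| * (1 / (s / 2)) := by gcongr
  · exact hN.norm.mul_const _
  · refine (ae_restrict_iff' measurableSet_Ioi).2 (ae_of_all _ fun ρ hρ v _ => ?_)
    have := (hasDerivAt_inv_sqrt_pow hρ v 1).const_mul (ρ * N ρ)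
    simp only [pow_one] at this
    refine this.congr_deriv ?_
    rw [poissonKer]; push_cast; ring

lemma tendsto_axisPotential_atTop (hN : IntegrableOn N (Ioi 0)) :
    Tendsto (axisPotential N) atTop (𝓝 0) := by
  have h : Tendsto (fun s => ∫ ρ in Ioi 0, ρ * N ρ * (√(ρ ^ 2 + s ^ 2))⁻¹) atTop
      (𝓝 (∫ ρ in Ioi (0 : ℝ), (0 : ℝ))) := by
    refine tendsto_integral_filter_of_dominated_convergence (fun ρ => |N ρ|)
      (Eventually.of_forall fun s => aestronglyMeasurable_axisPotential_integrand hN s)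
      (Eventually.of_forall fun s => ?_) hN.norm ?_
    · exact (ae_restrict_iff' measurableSet_Ioi).2 (ae_of_all _ fun ρ hρ =>
        norm_axisPotential_integrand_le hρ s)
    · refine ae_of_all _ fun ρ => ?_
      have : Tendsto (fun s : ℝ => (√(ρ ^ 2 + s ^ 2))⁻¹) atTop (𝓝 0) :=
        Tendsto.inv_tendsto_atTop (Real.tendsto_sqrt_atTop.comp
          (tendsto_atTop_add_const_left _ _ (tendsto_pow_atTop two_ne_zero)))
      simpa using this.const_mul (ρ * N ρ)
  have h' := h.neg
  simp only [integral_zero, neg_zero] at h'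
  exact h'

/-- The Poisson transform, at axis points, of the values of the solution at the level `ε`. -/
theorem integral_level_poissonKer {ρ₀ M ε w : ℝ} {J : PartialJet} {N : ℝ → ℝ}
    (hρ₀ : 0 < ρ₀) (hε : 0 < ε) (hw : 0 < w)
    (hJ : J.IsOn {p | 0 < p.1 ∧ 0 < p.2}) (hlap : ∀ p : ℝ × ℝ, 0 < p.1 → 0 < p.2 → J.lap p = 0)
    (hM : ∀ p : ℝ × ℝ, 0 < p.1 → 0 < p.2 → |J.f p| ≤ M)
    (hN : ∀ ρ > 0, ρ ≠ ρ₀ → Tendsto J.z (𝓝[{p | 0 < p.2}] (ρ, 0)) (𝓝 (N ρ)))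
    (hNint : IntegrableOn N (Ioi 0)) (hd : Tendsto (fun ρ => J.f (ρ, ε)) atTop (𝓝 0)) :
    ∫ ρ in Ioi 0, ρ * J.f (ρ, ε) * poissonKer ρ w = axisPotential N (ε + w) := by
  have hJε : ContinuousOn (fun ρ => J.f (ρ, ε)) (Ioi 0) :=
    hJ.cf.comp (by fun_prop) fun ρ hρ => ⟨hρ, hε⟩
  have hmeas := hJε.aestronglyMeasurable measurableSet_Ioi (μ := volume)
  have hM' : ∀ ρ > 0, |J.f (ρ, ε)| ≤ M := fun ρ hρ => hM _ hρ hε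
  -- Green's identity says that the two sides have the same `w`-derivative. Both tend to zero as `w
  -- → ∞`, so their constant difference `E` is zero.
  set E : ℝ → ℝ := fun w => (∫ ρ in Ioi 0, ρ * J.f (ρ, ε) * poissonKer ρ w) -
    axisPotential N (ε + w) with hE
  have hder : ∀ v > 0, HasDerivAt E 0 v := by
    intro v hv
    have h1 := hasDerivAt_integral_poissonKer hmeas hM' hv
    have h2 := (hasDerivAt_axisPotential hNint (by positivity : 0 < ε + v)).comp_const_add ε v
    refine (h1.sub h2).congr_deriv ?_
    rw [half_space_green_identity hρ₀ hε hv hJ hlap hM hN hNint, sub_self]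
  have hconst : ∀ v > 0, E v = E w := fun v hv =>
    isOpen_Ioi.is_const_of_deriv_eq_zero isPreconnected_Ioi
      (fun x hx => (hder x hx).differentiableAt.differentiableWithinAt)
      (fun x hx => (hder x hx).deriv) hv hw
  have hlim : Tendsto E atTop (𝓝 (0 - 0)) :=
    (tendsto_integral_poissonKer_atTop hM' hd).sub
      ((tendsto_axisPotential_atTop hNint).comp (tendsto_atTop_add_const_left _ _ tendsto_id))
  have h0 : E w = 0 - 0 := by
    refine tendsto_nhds_unique (tendsto_const_nhds.congr' ?_) hlim
    filter_upwards [eventually_gt_atTop 0] with v hv using (hconst v hv).symm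
  simp only [hE] at h0
  linarith

end AxisTransform

/-! ### Jets of twice continuously differentiable functions -/

section Jet

variable {f : ℝ × ℝ → ℝ} {Ω : Set (ℝ × ℝ)}

lemma hasDerivAt_partialRho {p : ℝ × ℝ} (h : DifferentiableAt ℝ f p) :
    HasDerivAt (fun r => f (r, p.2)) (partialRho f p) p.1 ∧
      partialRho f p = fderiv ℝ f p (1, 0) := by
  have h1 : HasDerivAt (fun r => f (r, p.2)) (fderiv ℝ f p (1, 0)) p.1 :=
    HasFDerivAt.comp_hasDerivAt (f := fun r : ℝ => (r, p.2)) p.1 h.hasFDerivAt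
      ((hasDerivAt_id p.1).prodMk (hasDerivAt_const p.1 p.2))
  have h2 : partialRho f p = fderiv ℝ f p (1, 0) := h1.deriv
  exact ⟨h2 ▸ h1, h2⟩

lemma hasDerivAt_partialZeta {p : ℝ × ℝ} (h : DifferentiableAt ℝ f p) :
    HasDerivAt (fun z => f (p.1, z)) (partialZeta f p) p.2 ∧
      partialZeta f p = fderiv ℝ f p (0, 1) := by
  have h1 : HasDerivAt (fun z => f (p.1, z)) (fderiv ℝ f p (0, 1)) p.2 :=
    HasFDerivAt.comp_hasDerivAt (f := fun z : ℝ => (p.1, z)) p.2 h.hasFDerivAt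
      ((hasDerivAt_const p.2 p.1).prodMk (hasDerivAt_id p.2))
  have h2 : partialZeta f p = fderiv ℝ f p (0, 1) := h1.deriv
  exact ⟨h2 ▸ h1, h2⟩

lemma contDiffOn_partials {n m : WithTop ℕ∞} (hΩ : IsOpen Ω) (hf : ContDiffOn ℝ n f Ω)
    (hn : m + 1 ≤ n) :
    ContDiffOn ℝ m (partialRho f) Ω ∧ ContDiffOn ℝ m (partialZeta f) Ω := by
  have hd : DifferentiableOn ℝ f Ω := hf.differentiableOn (by
    intro h; rw [h] at hn; simp at hn)
  have h1 := hf.fderiv_of_isOpen hΩ hn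
  exact ⟨(h1.clm_apply contDiffOn_const).congr fun p hp =>
      (hasDerivAt_partialRho (hd.differentiableAt (hΩ.mem_nhds hp))).2,
    (h1.clm_apply contDiffOn_const).congr fun p hp =>
      (hasDerivAt_partialZeta (hd.differentiableAt (hΩ.mem_nhds hp))).2⟩

/-- The jet of a function formed by its partial derivatives. -/
noncomputable def PartialJet.ofFun (f : ℝ × ℝ → ℝ) : PartialJet where
  f := f
  r := partialRho f
  z := partialZeta f
  rr := partialRho (partialRho f)
  zz := partialZeta (partialZeta f)

lemma PartialJet.isOn_ofFun (hΩ : IsOpen Ω) (hf : ContDiffOn ℝ 2 f Ω) :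
    (PartialJet.ofFun f).IsOn Ω := by
  have hd : ∀ {g : ℝ × ℝ → ℝ}, ContDiffOn ℝ 1 g Ω → ∀ p ∈ Ω, DifferentiableAt ℝ g p :=
    fun hg p hp => (hg.differentiableOn one_ne_zero).differentiableAt (hΩ.mem_nhds hp)
  have hf1 : ContDiffOn ℝ 1 f Ω := hf.of_le one_le_two
  have h1 := contDiffOn_partials (m := 1) hΩ hf (by norm_num)
  have h2 := contDiffOn_partials (m := 0) hΩ h1.1 (by norm_num)
  have h3 := contDiffOn_partials (m := 0) hΩ h1.2 (by norm_num)
  exact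
    { hr := fun p hp => (hasDerivAt_partialRho (hd hf1 p hp)).1
      hz := fun p hp => (hasDerivAt_partialZeta (hd hf1 p hp)).1
      hrr := fun p hp => (hasDerivAt_partialRho (hd h1.1 p hp)).1
      hzz := fun p hp => (hasDerivAt_partialZeta (hd h1.2 p hp)).1
      cf := hf.continuousOn
      cr := h1.1.continuousOn
      cz := h1.2.continuousOn
      crr := h2.1.continuousOn
      czz := h3.2.continuousOn }

end Jet

/-! ### Boundedness and boundary values of the solution -/

section Exterior

variable {ρ₀ : ℝ} {U : ℝ × ℝ → ℝ}

lemma mem_exteriorDisk {p : ℝ × ℝ} : p ∈ exteriorDisk ρ₀ ↔ 0 < p.1 ∧ (p.2 ≠ 0 ∨ ρ₀ ≤ p.1) := by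
  simp only [exteriorDisk, Set.mem_sdiff, mem_ofPred_eq, not_and]
  constructor
  · rintro ⟨h1, h2⟩
    refine ⟨h1, ?_⟩
    by_contra! h
    exact h2 h1 h.2 h.1
  · rintro ⟨h1, h2 | h2⟩
    · exact ⟨h1, fun _ _ h => h2 h⟩
    · exact ⟨h1, fun _ h => absurd h2 (not_le.2 h)⟩

lemma exteriorDisk_diff_rim (hρ₀ : 0 < ρ₀) :
    exteriorDisk ρ₀ \ {(ρ₀, 0)} = {p : ℝ × ℝ | 0 < p.1} ∩ ({p | p.2 ≠ 0} ∪ {p | ρ₀ < p.1}) := by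
  ext ⟨a, b⟩
  simp only [Set.mem_sdiff, mem_exteriorDisk, mem_singleton_iff, Prod.mk.injEq, mem_inter_iff,
    mem_ofPred_eq, mem_union]
  constructor
  · rintro ⟨⟨h1, h2⟩, h3⟩
    refine ⟨h1, ?_⟩
    by_contra! h
    exact h3 ⟨le_antisymm h.2 (h2.resolve_left fun h' => h' h.1), h.1⟩
  · rintro ⟨h1, h2⟩
    refine ⟨⟨h1, h2.imp_right le_of_lt⟩, ?_⟩
    rintro ⟨rfl, rfl⟩
    simp at h2

lemma isOpen_exteriorDisk_diff_rim (hρ₀ : 0 < ρ₀) : IsOpen (exteriorDisk ρ₀ \ {(ρ₀, 0)}) := by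
  rw [exteriorDisk_diff_rim hρ₀]
  exact (isOpen_lt continuous_const continuous_fst).inter
    ((isOpen_ne_fun continuous_snd continuous_const).union
      (isOpen_lt continuous_const continuous_fst))

lemma upper_subset_exteriorDisk_diff_rim (hρ₀ : 0 < ρ₀) :
    {p : ℝ × ℝ | 0 < p.1 ∧ 0 < p.2} ⊆ exteriorDisk ρ₀ \ {(ρ₀, 0)} := by
  rw [exteriorDisk_diff_rim hρ₀]
  exact fun p hp => ⟨hp.1, Or.inl hp.2.ne'⟩

lemma isOn_ofFun_upper (hρ₀ : 0 < ρ₀)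
    (hU : IsAxisymmetricHarmonicOn U (exteriorDisk ρ₀ \ {(ρ₀, 0)})) :
    (PartialJet.ofFun U).IsOn {p | 0 < p.1 ∧ 0 < p.2} :=
  (PartialJet.isOn_ofFun (isOpen_exteriorDisk_diff_rim hρ₀) hU.1).mono
    (upper_subset_exteriorDisk_diff_rim hρ₀)

/-- Evenness in `ζ` forces `U_ζ = 0` on the plane outside the disk, and `U_ζ` is continuous there.
-/
lemma tendsto_partialZeta_outside (hρ₀ : 0 < ρ₀)
    (hU : IsAxisymmetricHarmonicOn U (exteriorDisk ρ₀ \ {(ρ₀, 0)}))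
    (hsymm : ∀ p ∈ exteriorDisk ρ₀, U (p.1, p.2) = U (p.1, -p.2)) {ρ : ℝ} (hρ : ρ₀ < ρ) :
    Tendsto (partialZeta U) (𝓝 (ρ, 0)) (𝓝 0) := by
  have hΩ := isOpen_exteriorDisk_diff_rim hρ₀
  have hmem : (ρ, (0 : ℝ)) ∈ exteriorDisk ρ₀ \ {(ρ₀, 0)} := by
    rw [exteriorDisk_diff_rim hρ₀]; exact ⟨hρ₀.trans hρ, Or.inr hρ⟩
  have h := ((PartialJet.isOn_ofFun hΩ hU.1).cz.continuousAt (hΩ.mem_nhds hmem)).tendsto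
  have h0 : partialZeta U (ρ, 0) = 0 := by
    have he : (fun z => U (ρ, z)) = fun z => U (ρ, -z) := by
      ext z
      exact hsymm (ρ, z) (mem_exteriorDisk.2 ⟨hρ₀.trans hρ, Or.inr hρ.le⟩)
    have h1 : deriv (fun z => U (ρ, z)) 0 = -deriv (fun z => U (ρ, z)) (-0) := by
      conv_lhs => rw [he]
      exact deriv_comp_neg (fun z => U (ρ, z)) 0
    rw [neg_zero] at h1
    change deriv (fun z => U (ρ, z)) 0 = 0
    linarith
  rwa [show (PartialJet.ofFun U).z = partialZeta U from rfl, h0] at h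

/-- A limit of `U_ρ` at an axis point bounds it nearby. The mean value inequality along a horizontal
segment then compares `U` with its values on the line `ρ = δ / 2`, where it is continuous. -/
lemma isBigO_one_of_partialRho (hρ₀ : 0 < ρ₀)
    (hU : IsAxisymmetricHarmonicOn U (exteriorDisk ρ₀ \ {(ρ₀, 0)}))
    {b l : ℝ} (hb : 0 < b) (h : Tendsto (partialRho U) (𝓝[{p | 0 < p.1}] (0, b)) (𝓝 l)) :
    U =O[𝓝[{p : ℝ × ℝ | 0 < p.1 ∧ 0 < p.2}] (0, b)] fun _ => (1 : ℝ) := by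
  have hJ := isOn_ofFun_upper hρ₀ hU
  obtain ⟨C, hC⟩ := (h.isBigO_one ℝ).bound
  rw [eventually_nhdsWithin_iff, Metric.eventually_nhds_iff] at hC
  obtain ⟨δ, hδ, hC⟩ := hC
  have hcont : ContinuousAt (fun z => U (δ / 2, z)) b :=
    (hJ.hz (δ / 2, b) ⟨by positivity, hb⟩).continuousAt
  have h1 := hcont.abs.eventually_lt_const (lt_add_one |U (δ / 2, b)|)
  refine Asymptotics.IsBigO.of_bound (|U (δ / 2, b)| + 1 + C * (δ / 2)) ?_
  have h2 : ∀ᶠ p : ℝ × ℝ in 𝓝 (0, b), |U (δ / 2, p.2)| < |U (δ / 2, b)| + 1 :=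
    (continuous_snd.tendsto ((0 : ℝ), b)).eventually h1
  filter_upwards [mem_nhdsWithin_of_mem_nhds (Metric.ball_mem_nhds _ (half_pos hδ)),
    mem_nhdsWithin_of_mem_nhds h2, self_mem_nhdsWithin] with p hp1 hp2 hp3
  rw [Metric.mem_ball, Prod.dist_eq, max_lt_iff, Real.dist_eq, sub_zero] at hp1
  obtain ⟨hp11, hp12⟩ := hp1
  have hpδ : p.1 < δ / 2 := (le_abs_self _).trans_lt hp11
  have hmv := (convex_Icc p.1 (δ / 2)).norm_image_sub_le_of_norm_hasDerivWithin_le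
    (f := fun r => U (r, p.2)) (f' := fun r => partialRho U (r, p.2)) (C := C)
    (fun r hr => (hJ.hr (r, p.2) ⟨hp3.1.trans_le hr.1, hp3.2⟩).hasDerivWithinAt)
    (fun r hr => by
      have := hC (y := (r, p.2)) (by
        rw [Prod.dist_eq, max_lt_iff]
        refine ⟨?_, hp12.trans (by linarith)⟩
        rw [Real.dist_eq, sub_zero, abs_of_pos (hp3.1.trans_le hr.1)]
        linarith [hr.2]) (hp3.1.trans_le hr.1)
      simpa using this)
    (right_mem_Icc.2 hpδ.le) (left_mem_Icc.2 hpδ.le)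
  have hC0 : 0 ≤ C := by
    have := hC (y := (δ / 2, b)) (by
      rw [Prod.dist_eq, max_lt_iff]
      refine ⟨?_, by simpa using hδ⟩
      rw [Real.dist_eq, sub_zero, abs_of_pos (half_pos hδ)]
      linarith) (half_pos hδ)
    exact (abs_nonneg _).trans (by simpa using this)
  rw [norm_one, mul_one]
  have h3 : ‖p.1 - δ / 2‖ ≤ δ / 2 := by
    rw [Real.norm_eq_abs, abs_le]; constructor <;> linarith [hp3.1]
  have h4 : C * ‖p.1 - δ / 2‖ ≤ C * (δ / 2) := by gcongr
  have h5 := norm_le_norm_add_norm_sub' (U (p.1, p.2)) (U (δ / 2, p.2))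
  simp only [Real.norm_eq_abs] at *
  linarith

/-- The same argument at a point of the disk, along vertical segments ending at `ζ = δ / 2`. -/
lemma isBigO_one_of_partialZeta (hρ₀ : 0 < ρ₀)
    (hU : IsAxisymmetricHarmonicOn U (exteriorDisk ρ₀ \ {(ρ₀, 0)}))
    {a l : ℝ} (ha : 0 < a) (h : Tendsto (partialZeta U) (𝓝[{p | 0 < p.2}] (a, 0)) (𝓝 l)) :
    U =O[𝓝[{p : ℝ × ℝ | 0 < p.1 ∧ 0 < p.2}] (a, 0)] fun _ => (1 : ℝ) := by
  have hJ := isOn_ofFun_upper hρ₀ hU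
  obtain ⟨C, hC⟩ := (h.isBigO_one ℝ).bound
  rw [eventually_nhdsWithin_iff, Metric.eventually_nhds_iff] at hC
  obtain ⟨δ, hδ, hC⟩ := hC
  have hcont : ContinuousAt (fun r => U (r, δ / 2)) a :=
    (hJ.hr (a, δ / 2) ⟨ha, by positivity⟩).continuousAt
  have h1 := hcont.abs.eventually_lt_const (lt_add_one |U (a, δ / 2)|)
  refine Asymptotics.IsBigO.of_bound (|U (a, δ / 2)| + 1 + C * (δ / 2)) ?_
  have h2 : ∀ᶠ p : ℝ × ℝ in 𝓝 (a, 0), |U (p.1, δ / 2)| < |U (a, δ / 2)| + 1 :=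
    (continuous_fst.tendsto (a, (0 : ℝ))).eventually h1
  filter_upwards [mem_nhdsWithin_of_mem_nhds (Metric.ball_mem_nhds _ (half_pos hδ)),
    mem_nhdsWithin_of_mem_nhds h2, self_mem_nhdsWithin] with p hp1 hp2 hp3
  rw [Metric.mem_ball, Prod.dist_eq, max_lt_iff, Real.dist_eq p.2, sub_zero] at hp1
  obtain ⟨hp11, hp12⟩ := hp1
  have hpδ : p.2 < δ / 2 := (le_abs_self _).trans_lt hp12
  have hmv := (convex_Icc p.2 (δ / 2)).norm_image_sub_le_of_norm_hasDerivWithin_le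
    (f := fun r => U (p.1, r)) (f' := fun r => partialZeta U (p.1, r)) (C := C)
    (fun r hr => (hJ.hz (p.1, r) ⟨hp3.1, hp3.2.trans_le hr.1⟩).hasDerivWithinAt)
    (fun r hr => by
      have := hC (y := (p.1, r)) (by
        rw [Prod.dist_eq, max_lt_iff]
        refine ⟨hp11.trans (by linarith), ?_⟩
        rw [Real.dist_eq, sub_zero, abs_of_pos (hp3.2.trans_le hr.1)]
        linarith [hr.2]) (hp3.2.trans_le hr.1)
      simpa using this)
    (right_mem_Icc.2 hpδ.le) (left_mem_Icc.2 hpδ.le)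
  have hC0 : 0 ≤ C := by
    have := hC (y := (a, δ / 2)) (by
      rw [Prod.dist_eq, max_lt_iff]
      refine ⟨by simpa using hδ, ?_⟩
      rw [Real.dist_eq, sub_zero, abs_of_pos (half_pos hδ)]
      linarith) (half_pos hδ)
    exact (abs_nonneg _).trans (by simpa using this)
  rw [norm_one, mul_one]
  have h3 : ‖p.2 - δ / 2‖ ≤ δ / 2 := by
    rw [Real.norm_eq_abs, abs_le]; constructor <;> linarith [hp3.2]
  have h4 : C * ‖p.2 - δ / 2‖ ≤ C * (δ / 2) := by gcongr
  have h5 := norm_le_norm_add_norm_sub' (U (p.1, p.2)) (U (p.1, δ / 2))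
  simp only [Real.norm_eq_abs] at *
  linarith

/-- Decay disposes of infinity. On a compact square each point is locally bounded for its own
reason: the limit `Uc` at the origin, axis regularity on the axis, the limit of `U_ζ` on the disk,
and continuity elsewhere, including the rim. -/
lemma exists_bound_upper (hρ₀ : 0 < ρ₀) (hcont : ContinuousOn U (exteriorDisk ρ₀))
    (hU : IsAxisymmetricHarmonicOn U (exteriorDisk ρ₀ \ {(ρ₀, 0)}))
    (haxis : ∀ ζ : ℝ, ζ ≠ 0 →
      Tendsto (partialRho U) (𝓝[{p | 0 < p.1}] ((0 : ℝ), ζ)) (𝓝 0))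
    (hdecay : Tendsto U
      (comap (fun p : ℝ × ℝ => p.1 ^ 2 + p.2 ^ 2) atTop ⊓ 𝓟 (exteriorDisk ρ₀)) (𝓝 0))
    {Uc : ℝ} {Uz : ℝ → ℝ}
    (hUc : Tendsto U (𝓝[{p | 0 < p.1 ∧ 0 < p.2}] ((0 : ℝ), (0 : ℝ))) (𝓝 Uc))
    (hUz : ∀ ρ ∈ Ioo 0 ρ₀, Tendsto (partialZeta U) (𝓝[{p | 0 < p.2}] (ρ, (0 : ℝ))) (𝓝 (Uz ρ))) :
    ∃ M, ∀ p : ℝ × ℝ, 0 < p.1 → 0 < p.2 → |U p| ≤ M := by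
  have hsub : {p : ℝ × ℝ | 0 < p.1 ∧ 0 < p.2} ⊆ exteriorDisk ρ₀ :=
    (upper_subset_exteriorDisk_diff_rim hρ₀).trans sdiff_subset
  obtain ⟨t, ht, hinf⟩ := mem_comap.1 (eventually_inf_principal.1
    (hdecay.abs.eventually_lt_const (by simp : |(0 : ℝ)| < 1)))
  obtain ⟨R, hR⟩ := mem_atTop_sets.1 ht
  obtain ⟨C, hC⟩ := IsCompact.exists_bound_of_isBigO_one (f := U)
    (S := {p : ℝ × ℝ | 0 < p.1 ∧ 0 < p.2})
    ((isCompact_Icc (a := 0) (b := |R| + 1)).prod (isCompact_Icc (a := 0) (b := |R| + 1))) (by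
      rintro ⟨a, b⟩ ⟨⟨ha, -⟩, ⟨hb, -⟩⟩
      simp only at ha hb
      rcases ha.eq_or_lt with rfl | ha
      · rcases hb.eq_or_lt with rfl | hb
        · exact hUc.isBigO_one ℝ
        · exact isBigO_one_of_partialRho hρ₀ hU hb (haxis b hb.ne')
      · by_cases hm : (a, b) ∈ exteriorDisk ρ₀
        · exact ((hcont _ hm).mono hsub).tendsto.isBigO_one ℝ
        · have : b = 0 ∧ a < ρ₀ := by
            rw [mem_exteriorDisk] at hm
            push Not at hm
            exact hm ha
          obtain ⟨rfl, ha'⟩ := this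
          exact isBigO_one_of_partialZeta hρ₀ hU ha (hUz a ⟨ha, ha'⟩))
  refine ⟨max C 1, fun p h1 h2 => ?_⟩
  by_cases hp : p.1 ≤ |R| + 1 ∧ p.2 ≤ |R| + 1
  · exact (hC p ⟨⟨⟨h1.le, hp.1⟩, ⟨h2.le, hp.2⟩⟩, ⟨h1, h2⟩⟩).trans (le_max_left _ _)
  · have : R ≤ p.1 ^ 2 + p.2 ^ 2 := by
      have hR0 := abs_nonneg R
      have hR1 := le_abs_self R
      rw [not_and_or, not_le, not_le] at hp
      rcases hp with hp | hp <;> nlinarith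
    exact (hinf (hR _ this : p ∈ _) (hsub ⟨h1, h2⟩)).le.trans (le_max_right _ _)

lemma tendsto_level_atTop (hdecay : Tendsto U
      (comap (fun p : ℝ × ℝ => p.1 ^ 2 + p.2 ^ 2) atTop ⊓ 𝓟 (exteriorDisk ρ₀)) (𝓝 0))
    {ε : ℝ} (hε : 0 < ε) : Tendsto (fun ρ => U (ρ, ε)) atTop (𝓝 0) := by
  refine hdecay.comp (tendsto_inf.2 ⟨tendsto_comap_iff.2 ?_, tendsto_principal.2 ?_⟩)
  · exact tendsto_atTop_add_const_right atTop (ε ^ 2) (tendsto_pow_atTop (α := ℝ) two_ne_zero)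
  · filter_upwards [eventually_gt_atTop 0] with ρ hρ
    exact mem_exteriorDisk.2 ⟨hρ, Or.inl hε.ne'⟩

/-- The values on the upper side of the disk are recovered from the tangential derivative. -/
lemma tendsto_disk_values (hρ₀ : 0 < ρ₀)
    (hU : IsAxisymmetricHarmonicOn U (exteriorDisk ρ₀ \ {(ρ₀, 0)})) {Uc : ℝ} {Ur : ℝ → ℝ}
    (hUc : Tendsto U (𝓝[{p | 0 < p.1 ∧ 0 < p.2}] ((0 : ℝ), (0 : ℝ))) (𝓝 Uc))
    (hUr : ∀ ρ ∈ Ioo 0 ρ₀, Tendsto (partialRho U) (𝓝[{p | 0 < p.2}] (ρ, (0 : ℝ))) (𝓝 (Ur ρ)))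
    (hUr_int : ∀ a ∈ Ioo 0 ρ₀, IntervalIntegrable Ur volume 0 a) {ρ : ℝ} (hρ : ρ ∈ Ioo 0 ρ₀) :
    Tendsto (fun ε => U (ρ, ε)) (𝓝[>] 0) (𝓝 (Uc + ∫ r in (0 : ℝ)..ρ, Ur r)) := by
  have hJ := isOn_ofFun_upper hρ₀ hU
  have hρi := hUr_int ρ hρ
  -- Away from the origin the limit passes under the integral of `U_ρ`, because compactness bounds
  -- `U_ρ` near the segment `[a, ρ]` of the disk.
  have hstep : ∀ a ∈ Ioo 0 ρ, Tendsto (fun ε => U (ρ, ε) - U (a, ε)) (𝓝[>] 0)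
      (𝓝 (∫ r in a..ρ, Ur r)) := by
    intro a ha
    obtain ⟨C, hC⟩ := IsCompact.exists_bound_of_isBigO_one (f := partialRho U)
      (S := {p : ℝ × ℝ | 0 < p.2})
      ((isCompact_Icc (a := a) (b := ρ)).prod (isCompact_Icc (a := (0 : ℝ)) (b := 1))) (by
        rintro ⟨r, b⟩ ⟨⟨hr1, hr2⟩, ⟨hb, -⟩⟩
        simp only at hr1 hr2 hb
        rcases hb.eq_or_lt with rfl | hb
        · exact (hUr r ⟨ha.1.trans_le hr1, hr2.trans_lt hρ.2⟩).isBigO_one ℝ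
        · have ho : IsOpen {p : ℝ × ℝ | 0 < p.1 ∧ 0 < p.2} :=
            (isOpen_lt continuous_const continuous_fst).inter
              (isOpen_lt continuous_const continuous_snd)
          have : ContinuousAt (partialRho U) (r, b) :=
            hJ.cr.continuousAt (ho.mem_nhds ⟨ha.1.trans_le hr1, hb⟩)
          exact (this.tendsto.mono_left nhdsWithin_le_nhds).isBigO_one ℝ)
    have hlim : Tendsto (fun ε => ∫ r in a..ρ, partialRho U (r, ε)) (𝓝[>] 0)
        (𝓝 (∫ r in a..ρ, Ur r)) := by
      refine intervalIntegral.tendsto_integral_filter_of_dominated_convergence (fun _ => C)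
        ?_ ?_ intervalIntegrable_const ?_
      · filter_upwards [self_mem_nhdsWithin] with ε hε
        have : ContinuousOn (fun r => partialRho U (r, ε)) (uIoc a ρ) :=
          hJ.cr.comp (by fun_prop) fun r hr => by
            rw [uIoc_of_le ha.2.le] at hr
            exact ⟨ha.1.trans hr.1, hε⟩
        exact this.aestronglyMeasurable measurableSet_uIoc
      · filter_upwards [self_mem_nhdsWithin, mem_nhdsWithin_of_mem_nhds (Iic_mem_nhds one_pos)]
          with ε hε hε1
        refine ae_of_all _ fun r hr => ?_
        rw [uIoc_of_le ha.2.le] at hr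
        exact hC (r, ε) ⟨⟨⟨hr.1.le, hr.2⟩, ⟨le_of_lt hε, hε1⟩⟩, hε⟩
      · refine ae_of_all _ fun r hr => ?_
        rw [uIoc_of_le ha.2.le] at hr
        refine (hUr r ⟨ha.1.trans hr.1, hr.2.trans_lt hρ.2⟩).comp ?_
        exact tendsto_nhdsWithin_iff.2 ⟨(Continuous.tendsto' (by fun_prop) _ _ rfl).mono_left
          nhdsWithin_le_nhds, self_mem_nhdsWithin⟩
    refine hlim.congr' ?_
    filter_upwards [self_mem_nhdsWithin] with ε hε
    refine intervalIntegral.integral_eq_sub_of_hasDerivAt (f := fun r => U (r, ε)) ?_ ?_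
    · intro r hr
      rw [uIcc_of_le ha.2.le] at hr
      exact hJ.hr (r, ε) ⟨ha.1.trans_le hr.1, hε⟩
    · refine ContinuousOn.intervalIntegrable (hJ.cr.comp (by fun_prop) fun r hr => ?_)
      rw [uIcc_of_le ha.2.le] at hr
      exact ⟨ha.1.trans_le hr.1, hε⟩
  -- Now `a` is chosen so small that `∫₀ᵃ Ur` is small and that `(a, ε)` lies, for small `ε`, in the
  -- region near the origin where `U` is close to `Uc`.
  rw [Metric.tendsto_nhds]
  intro e he
  have hc := Metric.tendsto_nhds.1 hUc (e / 3) (by positivity)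
  rw [eventually_nhdsWithin_iff, Metric.eventually_nhds_iff] at hc
  obtain ⟨δ, hδ, hc⟩ := hc
  have hprim : Tendsto (fun a => ∫ r in (0 : ℝ)..a, Ur r) (𝓝[Icc 0 ρ] 0) (𝓝 0) := by
    have h := (intervalIntegral.continuousOn_primitive_interval (f := Ur) (μ := volume)
      (a := 0) (b := ρ) (by rw [← intervalIntegrable_iff']; exact hρi)) 0 left_mem_uIcc
    rw [uIcc_of_le hρ.1.le] at h
    simpa [ContinuousWithinAt] using h
  have h1 : ∀ᶠ a in 𝓝[>] (0 : ℝ), dist (∫ r in (0 : ℝ)..a, Ur r) 0 < e / 3 :=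
    (hprim.mono_left (nhdsWithin_le_of_mem (Icc_mem_nhdsGT hρ.1))).eventually
      (Metric.ball_mem_nhds _ (by positivity))
  obtain ⟨a, ha1, ha⟩ := (h1.and (Ioo_mem_nhdsGT (lt_min hδ hρ.1))).exists
  have haρ : a ∈ Ioo 0 ρ := ⟨ha.1, ha.2.trans_le (min_le_right _ _)⟩
  filter_upwards [Metric.tendsto_nhds.1 (hstep a haρ) (e / 3) (by positivity),
    Ioo_mem_nhdsGT hδ] with ε h2 h3
  have h4 := hc (y := (a, ε)) (by
    rw [Prod.dist_eq, max_lt_iff, Real.dist_eq, Real.dist_eq, sub_zero, sub_zero,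
      abs_of_pos ha.1, abs_of_pos h3.1]
    exact ⟨ha.2.trans_le (min_le_left _ _), h3.2⟩) ⟨ha.1, h3.1⟩
  have h5 := intervalIntegral.integral_add_adjacent_intervals
    (hUr_int a ⟨ha.1, haρ.2.trans hρ.2⟩) ((hUr_int a ⟨ha.1, haρ.2.trans hρ.2⟩).symm.trans hρi)
  rw [Real.dist_eq, abs_lt] at *
  constructor <;> linarith [h2.1, h2.2, h4.1, h4.2, ha1.1, ha1.2]

end Exterior

/-! ### Poisson transform of the boundary values -/

section Limit

variable {U : ℝ × ℝ → ℝ} {N u : ℝ → ℝ} {M : ℝ}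

/-- Passage to the limit `ε → 0` in the Poisson transform of the values at the level `ε`. -/
lemma integral_boundary_poissonKer (hcU : ContinuousOn U {p | 0 < p.1 ∧ 0 < p.2})
    (hM : ∀ p : ℝ × ℝ, 0 < p.1 → 0 < p.2 → |U p| ≤ M)
    (hu : ∀ ρ > 0, Tendsto (fun ε => U (ρ, ε)) (𝓝[>] 0) (𝓝 (u ρ)))
    (hNint : IntegrableOn N (Ioi 0))
    (hlev : ∀ ε > 0, ∀ w > 0,
      ∫ ρ in Ioi 0, ρ * U (ρ, ε) * poissonKer ρ w = axisPotential N (ε + w)) :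
    AEStronglyMeasurable u (volume.restrict (Ioi 0)) ∧ (∀ ρ > 0, |u ρ| ≤ M) ∧
      ∀ w > 0, ∫ ρ in Ioi 0, ρ * u ρ * poissonKer ρ w = axisPotential N w := by
  have hmeas : ∀ ε > 0, AEStronglyMeasurable (fun ρ => U (ρ, ε)) (volume.restrict (Ioi 0)) :=
    fun ε hε => (hcU.comp (f := fun ρ => (ρ, ε)) (s := Ioi 0) (by fun_prop)
      fun ρ hρ => ⟨hρ, hε⟩).aestronglyMeasurable measurableSet_Ioi
  have hum : AEStronglyMeasurable u (volume.restrict (Ioi 0)) := by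
    have hseq : Tendsto (fun n : ℕ => 1 / ((n : ℝ) + 1)) atTop (𝓝[>] 0) :=
      tendsto_nhdsWithin_iff.2 ⟨tendsto_one_div_add_atTop_nhds_zero_nat,
        Eventually.of_forall fun n => mem_Ioi.2 (by positivity)⟩
    refine aestronglyMeasurable_of_tendsto_ae atTop (f := fun (n : ℕ) ρ => U (ρ, 1 / ((n : ℝ) + 1)))
      (fun n => hmeas _ (by positivity)) ?_
    exact (ae_restrict_iff' measurableSet_Ioi).2 (ae_of_all _ fun ρ hρ => (hu ρ hρ).comp hseq)
  have huM : ∀ ρ > 0, |u ρ| ≤ M := fun ρ hρ => le_of_tendsto (hu ρ hρ).abs (by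
    filter_upwards [self_mem_nhdsWithin] with ε hε using hM _ hρ hε)
  refine ⟨hum, huM, fun w hw => ?_⟩
  have h1 : Tendsto (fun ε => ∫ ρ in Ioi 0, ρ * U (ρ, ε) * poissonKer ρ w) (𝓝[>] 0)
      (𝓝 (∫ ρ in Ioi 0, ρ * u ρ * poissonKer ρ w)) := by
    refine tendsto_integral_filter_of_dominated_convergence (fun ρ => M * (ρ * poissonKer ρ w))
      ?_ ?_ ((integral_mul_poissonKer hw).1.const_mul M) ?_
    · filter_upwards [self_mem_nhdsWithin] with ε hε
      exact (measurable_id.aestronglyMeasurable.mul (hmeas ε hε)).mul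
        (measurable_poissonKer w).aestronglyMeasurable
    · filter_upwards [self_mem_nhdsWithin] with ε hε
      refine (ae_restrict_iff' measurableSet_Ioi).2 (ae_of_all _ fun ρ hρ => ?_)
      have h2 := mul_nonneg (le_of_lt hρ) (poissonKer_nonneg ρ hw)
      rw [Real.norm_eq_abs, mul_comm ρ, mul_assoc, abs_mul, abs_of_nonneg h2]
      exact mul_le_mul_of_nonneg_right (hM _ hρ hε) h2
    · refine (ae_restrict_iff' measurableSet_Ioi).2 (ae_of_all _ fun ρ hρ => ?_)
      exact ((hu ρ hρ).const_mul ρ).mul_const _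
  have h2 : Tendsto (fun ε => axisPotential N (ε + w)) (𝓝[>] 0) (𝓝 (axisPotential N w)) := by
    refine (hasDerivAt_axisPotential hNint hw).continuousAt.tendsto.comp ?_
    exact (Continuous.tendsto' (f := fun ε : ℝ => ε + w) (by fun_prop) 0 w (zero_add w)).mono_left
      nhdsWithin_le_nhds
  refine tendsto_nhds_unique h1 (h2.congr' ?_)
  filter_upwards [self_mem_nhdsWithin] with ε hε using (hlev ε hε w hw).symm

end Limit

/-! ### Abel transforms and their continuity -/

section Abel

/-- The Abel transforms of `g`: upper (`σ = 1`) and lower (`σ = -1`). The convention `√y = 0` for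
`y ≤ 0` restricts the integration to `ρ > t`, respectively to `ρ < t`. -/
noncomputable def abelTransform (σ : ℝ) (g : ℝ → ℝ) (t : ℝ) : ℝ :=
  ∫ ρ in Ioi 0, ρ * g ρ * (√(σ * (ρ ^ 2 - t ^ 2)))⁻¹

/-- The function `y ^ (-1/2)` cut off below `y = η ^ 2`. -/
noncomputable def invSqrtFar (η y : ℝ) : ℝ := if η ^ 2 < y then (√y)⁻¹ else 0

lemma invSqrtFar_mem {η : ℝ} (hη : 0 < η) (y : ℝ) :
    0 ≤ invSqrtFar η y ∧ invSqrtFar η y ≤ η⁻¹ := by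
  rw [invSqrtFar]
  split_ifs with h
  · refine ⟨by positivity, inv_anti₀ hη (Real.le_sqrt_of_sq_le h.le)⟩
  · exact ⟨le_rfl, by positivity⟩

lemma continuousAt_invSqrtFar {η y : ℝ} (hη : 0 < η) (hy : y ≠ η ^ 2) :
    ContinuousAt (invSqrtFar η) y := by
  rcases lt_or_gt_of_ne hy with h | h
  · refine (continuousAt_const (y := (0 : ℝ))).congr ?_
    filter_upwards [Iio_mem_nhds h] with z hz
    rw [invSqrtFar, if_neg (not_lt.2 (le_of_lt hz))]
  · have hy0 : 0 < y := (by positivity : 0 < η ^ 2).trans h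
    refine (Real.continuous_sqrt.continuousAt.inv₀ (Real.sqrt_pos.2 hy0).ne').congr ?_
    filter_upwards [Ioi_mem_nhds h] with z hz
    rw [invSqrtFar, if_pos (show η ^ 2 < z from hz), Pi.inv_apply]

lemma measurable_invSqrtFar (η : ℝ) : Measurable (invSqrtFar η) :=
  Measurable.ite measurableSet_Ioi (by fun_prop) measurable_const

/-- The contribution of the singularity to the Abel kernel. -/
lemma integral_mul_invSqrt_near {σ : ℝ} (hσ : σ = 1 ∨ σ = -1) {t η : ℝ} (hη : 0 < η)
    (ht : η < t) :
    IntegrableOn (fun ρ => ρ * ((√(σ * (ρ ^ 2 - t ^ 2)))⁻¹ -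
      invSqrtFar η (σ * (ρ ^ 2 - t ^ 2)))) (Ioi 0) ∧
    ∫ ρ in Ioi 0, ρ * ((√(σ * (ρ ^ 2 - t ^ 2)))⁻¹ - invSqrtFar η (σ * (ρ ^ 2 - t ^ 2))) = η := by
  have ht0 : 0 < t := hη.trans ht
  -- Except at one jump point `c`, the near part of the kernel is `ρ` over the square root on an
  -- interval: `(t, √(t² + η²))` for `σ = 1`, `(√(t² - η²), t)` for `σ = -1`. Both integrals equal
  -- `η`.
  have key : ∀ {E : Set ℝ} {G : ℝ → ℝ} {c : ℝ}, MeasurableSet E → E ⊆ Ioi 0 →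
      IntegrableOn G E ∧ ∫ ρ in E, G ρ = η →
      (∀ ρ ∈ Ioi (0 : ℝ), ρ ≠ c → E.indicator G ρ = ρ * ((√(σ * (ρ ^ 2 - t ^ 2)))⁻¹ -
        invSqrtFar η (σ * (ρ ^ 2 - t ^ 2)))) →
      IntegrableOn (fun ρ => ρ * ((√(σ * (ρ ^ 2 - t ^ 2)))⁻¹ -
        invSqrtFar η (σ * (ρ ^ 2 - t ^ 2)))) (Ioi 0) ∧
      ∫ ρ in Ioi 0, ρ * ((√(σ * (ρ ^ 2 - t ^ 2)))⁻¹ -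
        invSqrtFar η (σ * (ρ ^ 2 - t ^ 2))) = η := by
    intro E G c hE hE0 hG hc
    have hae : E.indicator G =ᵐ[volume.restrict (Ioi 0)] fun ρ => ρ * ((√(σ * (ρ ^ 2 - t ^ 2)))⁻¹ -
        invSqrtFar η (σ * (ρ ^ 2 - t ^ 2))) := by
      rw [Filter.EventuallyEq, ae_restrict_iff' measurableSet_Ioi]
      have hne : ∀ᵐ ρ : ℝ, ρ ≠ c := by simp [ae_iff]
      filter_upwards [hne] with ρ h1 h2 using hc ρ h2 h1
    constructor
    · exact (((integrable_indicator_iff hE).2 hG.1).integrableOn (s := Ioi 0)).congr hae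
    · rw [← integral_congr_ae hae, setIntegral_indicator hE, inter_eq_right.2 hE0, hG.2]
  rcases hσ with rfl | rfl
  · have hb : t ≤ √(t ^ 2 + η ^ 2) := Real.le_sqrt_of_sq_le (by nlinarith)
    have h := integral_div_sqrt_sq_sub_lower ht0 hb
    rw [Real.sq_sqrt (by positivity), add_sub_cancel_left, Real.sqrt_sq hη.le] at h
    refine key (c := √(t ^ 2 + η ^ 2)) measurableSet_Ioo
      (fun ρ hρ => ht0.trans hρ.1) h fun ρ hρ hne => ?_
    have hρ0 : 0 < ρ := hρ
    by_cases h1 : t < ρ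
    · have h1' : t ^ 2 < ρ ^ 2 := by gcongr
      rcases lt_or_gt_of_ne hne with h2 | h2
      · have h2' : ρ ^ 2 < t ^ 2 + η ^ 2 := (Real.lt_sqrt hρ0.le).1 h2
        rw [indicator_of_mem (show ρ ∈ Ioo t √(t ^ 2 + η ^ 2) from ⟨h1, h2⟩), invSqrtFar,
          if_neg (by linarith), sub_zero, one_mul, div_eq_mul_inv]
      · have h2' : t ^ 2 + η ^ 2 < ρ ^ 2 := (Real.sqrt_lt' hρ0).1 h2
        rw [indicator_of_notMem (fun h => h2.not_gt h.2), invSqrtFar, if_pos (by linarith),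
          sub_self, mul_zero]
    · have h1' : ρ ^ 2 ≤ t ^ 2 := by have := not_lt.1 h1; gcongr
      rw [indicator_of_notMem (fun h => h1 h.1), invSqrtFar,
        if_neg (by nlinarith), sub_zero, Real.sqrt_eq_zero_of_nonpos (by linarith), inv_zero,
        mul_zero]
  · have hr2 : 0 < t ^ 2 - η ^ 2 := by nlinarith
    have hb : √(t ^ 2 - η ^ 2) ≤ t := Real.sqrt_le_iff.2 ⟨ht0.le, by nlinarith⟩
    have h := integral_div_sqrt_sq_sub_upper (Real.sqrt_nonneg _) hb
    rw [Real.sq_sqrt hr2.le, sub_sub_cancel, Real.sqrt_sq hη.le] at h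
    refine key (c := √(t ^ 2 - η ^ 2)) measurableSet_Ioo
      (fun ρ hρ => (Real.sqrt_pos.2 hr2).trans hρ.1) h fun ρ hρ hne => ?_
    have hρ0 : 0 < ρ := hρ
    by_cases h1 : ρ < t
    · have h1' : ρ ^ 2 < t ^ 2 := by gcongr
      rcases lt_or_gt_of_ne hne with h2 | h2
      · have h2' : ρ ^ 2 < t ^ 2 - η ^ 2 := (Real.lt_sqrt hρ0.le).1 h2
        rw [indicator_of_notMem (fun h => h2.not_gt h.1), invSqrtFar, if_pos (by linarith),
          sub_self, mul_zero]
      · have h2' : t ^ 2 - η ^ 2 < ρ ^ 2 := (Real.sqrt_lt' hρ0).1 h2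
        rw [indicator_of_mem (show ρ ∈ Ioo √(t ^ 2 - η ^ 2) t from ⟨h2, h1⟩), invSqrtFar,
          if_neg (by linarith), sub_zero, div_eq_mul_inv]
        congr 3; ring
    · have h1' : t ^ 2 ≤ ρ ^ 2 := by have := not_lt.1 h1; gcongr
      rw [indicator_of_notMem (fun h => h1 h.2), invSqrtFar,
        if_neg (by nlinarith), sub_zero, Real.sqrt_eq_zero_of_nonpos (by linarith), inv_zero,
        mul_zero]

lemma integrableOn_mul_invSqrtFar {g : ℝ → ℝ} (hg : IntegrableOn (fun ρ => ρ * g ρ) (Ioi 0))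
    (σ t : ℝ) {η : ℝ} (hη : 0 < η) :
    IntegrableOn (fun ρ => ρ * g ρ * invSqrtFar η (σ * (ρ ^ 2 - t ^ 2))) (Ioi 0) := by
  refine (hg.norm.mul_const η⁻¹).mono' (hg.aestronglyMeasurable.mul
    ((measurable_invSqrtFar η).comp (by fun_prop)).aestronglyMeasurable) (ae_of_all _ fun ρ => ?_)
  have h := invSqrtFar_mem hη (σ * (ρ ^ 2 - t ^ 2))
  rw [norm_mul, Real.norm_of_nonneg h.1]
  exact mul_le_mul_of_nonneg_left h.2 (norm_nonneg _)

/-- Absolute convergence of the Abel integral, and a bound for its singular part. -/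
lemma abelTransform_sub_far {σ : ℝ} (hσ : σ = 1 ∨ σ = -1) {g : ℝ → ℝ}
    (hg : IntegrableOn (fun ρ => ρ * g ρ) (Ioi 0)) {t η C : ℝ} (hη : 0 < η) (ht : η < t)
    (hC : ∀ ρ > 0, σ * (ρ ^ 2 - t ^ 2) ≤ η ^ 2 → 0 < σ * (ρ ^ 2 - t ^ 2) → |g ρ| ≤ C) :
    IntegrableOn (fun ρ => ρ * g ρ * (√(σ * (ρ ^ 2 - t ^ 2)))⁻¹) (Ioi 0) ∧
      |abelTransform σ g t - ∫ ρ in Ioi 0, ρ * g ρ * invSqrtFar η (σ * (ρ ^ 2 - t ^ 2))| ≤ C * η := by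
  have hfar := integrableOn_mul_invSqrtFar hg σ t hη
  obtain ⟨hn1, hn2⟩ := integral_mul_invSqrt_near hσ hη ht
  have hle : ∀ ρ ∈ Ioi (0 : ℝ), ‖ρ * g ρ * ((√(σ * (ρ ^ 2 - t ^ 2)))⁻¹ -
      invSqrtFar η (σ * (ρ ^ 2 - t ^ 2)))‖ ≤ C * (ρ * ((√(σ * (ρ ^ 2 - t ^ 2)))⁻¹ -
        invSqrtFar η (σ * (ρ ^ 2 - t ^ 2)))) := by
    intro ρ hρ
    have hρ0 : 0 < ρ := hρ
    by_cases h1 : η ^ 2 < σ * (ρ ^ 2 - t ^ 2)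
    · rw [invSqrtFar, if_pos h1]; simp
    · rw [invSqrtFar, if_neg h1, sub_zero]
      by_cases h2 : 0 < σ * (ρ ^ 2 - t ^ 2)
      · have h3 := hC ρ hρ (not_lt.1 h1) h2
        rw [mul_comm ρ, mul_assoc, norm_mul, Real.norm_of_nonneg (by positivity : 0 ≤ ρ * _)]
        exact mul_le_mul_of_nonneg_right h3 (by positivity)
      · rw [Real.sqrt_eq_zero_of_nonpos (not_lt.1 h2)]; simp
  have hmeas : AEStronglyMeasurable (fun ρ => ρ * g ρ * ((√(σ * (ρ ^ 2 - t ^ 2)))⁻¹ -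
      invSqrtFar η (σ * (ρ ^ 2 - t ^ 2)))) (volume.restrict (Ioi 0)) :=
    hg.aestronglyMeasurable.mul ((Measurable.aestronglyMeasurable (by fun_prop)).sub
      ((measurable_invSqrtFar η).comp (by fun_prop)).aestronglyMeasurable)
  have hnear : IntegrableOn (fun ρ => ρ * g ρ * ((√(σ * (ρ ^ 2 - t ^ 2)))⁻¹ -
      invSqrtFar η (σ * (ρ ^ 2 - t ^ 2)))) (Ioi 0) :=
    (hn1.const_mul C).mono' hmeas ((ae_restrict_iff' measurableSet_Ioi).2 (ae_of_all _ hle))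
  have hall : IntegrableOn (fun ρ => ρ * g ρ * (√(σ * (ρ ^ 2 - t ^ 2)))⁻¹) (Ioi 0) :=
    (hnear.add hfar).congr (ae_of_all _ fun ρ => by simp only [Pi.add_apply]; ring)
  refine ⟨hall, ?_⟩
  rw [abelTransform, ← integral_sub hall hfar, ← Real.norm_eq_abs]
  conv_rhs => rw [← hn2, ← integral_const_mul]
  refine norm_integral_le_of_norm_le (hn1.const_mul C) ?_
  refine (ae_restrict_iff' measurableSet_Ioi).2 (ae_of_all _ fun ρ hρ => ?_)
  rw [← mul_sub]
  exact hle ρ hρ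

lemma continuousAt_integral_invSqrtFar {σ : ℝ} (hσ : σ = 1 ∨ σ = -1) {g : ℝ → ℝ}
    (hg : IntegrableOn (fun ρ => ρ * g ρ) (Ioi 0)) {t η : ℝ} (hη : 0 < η) :
    ContinuousAt (fun t => ∫ ρ in Ioi 0, ρ * g ρ * invSqrtFar η (σ * (ρ ^ 2 - t ^ 2))) t := by
  refine tendsto_integral_filter_of_dominated_convergence (fun ρ => ‖ρ * g ρ‖ * η⁻¹)
    (Eventually.of_forall fun t => (integrableOn_mul_invSqrtFar hg σ t hη).aestronglyMeasurable)
    (Eventually.of_forall fun t => ae_of_all _ fun ρ => ?_) (hg.norm.mul_const _) ?_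
  · have h := invSqrtFar_mem hη (σ * (ρ ^ 2 - t ^ 2))
    rw [norm_mul, Real.norm_of_nonneg h.1]
    exact mul_le_mul_of_nonneg_left h.2 (norm_nonneg _)
  · have hne : ∀ᵐ ρ : ℝ, ρ ≠ √(t ^ 2 + σ * η ^ 2) := by simp [ae_iff]
    rw [ae_restrict_iff' measurableSet_Ioi]
    filter_upwards [hne] with ρ h1 h2
    refine Tendsto.const_mul _ (ContinuousAt.tendsto (f := fun t => invSqrtFar η
      (σ * (ρ ^ 2 - t ^ 2))) (ContinuousAt.comp (g := invSqrtFar η)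
        (continuousAt_invSqrtFar hη ?_) (by fun_prop)))
    intro h
    apply h1
    rw [show t ^ 2 + σ * η ^ 2 = ρ ^ 2 by rcases hσ with rfl | rfl <;> linarith,
      Real.sqrt_sq (le_of_lt h2)]

/-- Local boundedness makes the Abel integral converge absolutely and depend continuously on its
parameter. -/
theorem abelTransform_continuousAt {σ : ℝ} (hσ : σ = 1 ∨ σ = -1) {g : ℝ → ℝ}
    (hg : IntegrableOn (fun ρ => ρ * g ρ) (Ioi 0)) {t : ℝ} (ht : 0 < t)
    (hb : g =O[𝓝 t] fun _ => (1 : ℝ)) :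
    IntegrableOn (fun ρ => ρ * g ρ * (√(σ * (ρ ^ 2 - t ^ 2)))⁻¹) (Ioi 0) ∧
      ContinuousAt (abelTransform σ g) t := by
  obtain ⟨C, hC⟩ := hb.bound
  rw [Metric.eventually_nhds_iff] at hC
  obtain ⟨δ, hδ, hC⟩ := hC
  have hC0 : 0 ≤ C := (abs_nonneg (g t)).trans (by simpa using hC (show dist t t < δ by simpa using hδ))
  -- The condition `η² < t δ / 4` confines the zone `|ρ² - s²| ≤ η²` to the `δ`-neighbourhood of `t`
  -- where `|g| ≤ C`: if `|ρ - s| ≥ δ / 2`, the product with `ρ + s ≥ 3t / 4` would be too large. So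
  -- the truncated transforms, which are continuous, approximate within `C η` uniformly in `s`.
  have hbd : ∀ η : ℝ, 0 < η → η < t → η < δ → ∀ s, |s - t| < δ / 4 → |s - t| < t / 4 →
      η ^ 2 < t * δ / 4 → η < s →
      IntegrableOn (fun ρ => ρ * g ρ * (√(σ * (ρ ^ 2 - s ^ 2)))⁻¹) (Ioi 0) ∧
      |abelTransform σ g s - ∫ ρ in Ioi 0, ρ * g ρ * invSqrtFar η (σ * (ρ ^ 2 - s ^ 2))| ≤
        C * η := by
    intro η hη hηt hηδ s hs1 hs2 hη2 hηs
    refine abelTransform_sub_far hσ hg hη hηs fun ρ hρ h1 h2 => ?_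
    have h3 := hC (y := ρ) ?_
    · simpa using h3
    rw [abs_lt] at hs1 hs2
    have h4 : |ρ ^ 2 - s ^ 2| ≤ η ^ 2 := by
      rw [abs_le]
      rcases hσ with rfl | rfl <;> constructor <;> nlinarith
    have h5 : |ρ ^ 2 - s ^ 2| = |ρ - s| * (ρ + s) := by
      have h0 : 0 < ρ + s := by linarith
      rw [show ρ ^ 2 - s ^ 2 = (ρ - s) * (ρ + s) by ring, abs_mul, abs_of_pos h0]
    have h6 : |ρ - s| < δ / 2 := by
      by_contra! hcon
      have : δ / 2 * (3 / 4 * t) ≤ |ρ - s| * (ρ + s) := by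
        apply mul_le_mul hcon (by linarith) (by positivity) (abs_nonneg _)
      nlinarith
    rw [Real.dist_eq, abs_lt]
    rw [abs_lt] at h6
    constructor <;> linarith
  have hη : ∀ e > 0, ∃ η, 0 < η ∧ η < t / 2 ∧ η < δ ∧ η ^ 2 < t * δ / 4 ∧ C * η < e := by
    intro e he
    have h1 : Tendsto (fun η : ℝ => η ^ 2) (𝓝[>] 0) (𝓝 0) :=
      (Continuous.tendsto' (by fun_prop) _ _ (by simp)).mono_left nhdsWithin_le_nhds
    have h2 : Tendsto (fun η : ℝ => C * η) (𝓝[>] 0) (𝓝 0) :=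
      (Continuous.tendsto' (by fun_prop) _ _ (by simp)).mono_left nhdsWithin_le_nhds
    obtain ⟨η, h⟩ := ((h1.eventually_lt_const (by positivity : (0 : ℝ) < t * δ / 4)).and
      ((h2.eventually_lt_const he).and
        (Ioo_mem_nhdsGT (lt_min (half_pos ht) hδ) : ∀ᶠ η in 𝓝[>] (0 : ℝ), η ∈ Ioo 0 _))).exists
    exact ⟨η, h.2.2.1, h.2.2.2.trans_le (min_le_left _ _), h.2.2.2.trans_le (min_le_right _ _),
      h.1, h.2.1⟩
  constructor
  · obtain ⟨η, h1, h2, h3, h4, -⟩ := hη 1 one_pos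
    exact (hbd η h1 (by linarith) h3 t (by simp [hδ]) (by simp [ht]) h4 (by linarith)).1
  · refine continuousAt_of_locally_uniform_approx_of_continuousAt fun u hu => ?_
    obtain ⟨e, he, heu⟩ := Metric.mem_uniformity_dist.1 hu
    obtain ⟨η, h1, h2, h3, h4, h5⟩ := hη e he
    refine ⟨Metric.ball t (min (δ / 4) (t / 4)), Metric.ball_mem_nhds _ (by positivity), _,
      continuousAt_integral_invSqrtFar hσ hg h1, fun s hs => heu ?_⟩
    rw [Metric.mem_ball, Real.dist_eq, lt_min_iff] at hs
    rw [Real.dist_eq]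
    refine (hbd η h1 (by linarith) h3 s hs.1 hs.2 h4 ?_).2.trans_lt h5
    have := (abs_lt.1 hs.2).1
    linarith

end Abel

/-- Fubini for a nonnegative kernel `K` with known first marginal `κ`. -/
theorem setIntegral_kernel_swap {f : ℝ → ℝ} {K : ℝ → ℝ → ℝ} {κ : ℝ → ℝ} {S T : Set ℝ}
    (hS : MeasurableSet S) (hT : MeasurableSet T)
    (hf : AEStronglyMeasurable f (volume.restrict S)) (hK : Measurable (Function.uncurry K))
    (hK0 : ∀ x ∈ S, ∀ y ∈ T, 0 ≤ K x y)
    (hκ : ∀ x ∈ S, IntegrableOn (K x) T ∧ ∫ y in T, K x y = κ x)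
    (hfκ : IntegrableOn (fun x => f x * κ x) S) :
    IntegrableOn (fun y => ∫ x in S, f x * K x y) T ∧
      ∫ y in T, ∫ x in S, f x * K x y = ∫ x in S, f x * κ x := by
  have hint : Integrable (Function.uncurry fun x y => f x * K x y)
      ((volume.restrict S).prod (volume.restrict T)) := by
    rw [integrable_prod_iff]
    · refine ⟨(ae_restrict_iff' hS).2 (ae_of_all _ fun x hx => ((hκ x hx).1).const_mul (f x)), ?_⟩
      refine hfκ.norm.congr ((ae_restrict_iff' hS).2 (ae_of_all _ fun x hx => ?_))
      simp only [Function.uncurry, norm_mul]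
      have h0 : 0 ≤ᵐ[volume.restrict T] K x :=
        (ae_restrict_iff' hT).2 (ae_of_all _ fun y hy => hK0 x hx y hy)
      rw [integral_const_mul, ← (hκ x hx).2, Real.norm_of_nonneg (integral_nonneg_of_ae h0)]
      congr 1
      exact integral_congr_ae (h0.mono fun y hy => (Real.norm_of_nonneg hy).symm)
    · exact (hf.comp_fst).mul hK.aestronglyMeasurable
  refine ⟨hint.integral_prod_right, ?_⟩
  rw [← integral_integral_swap hint]
  refine setIntegral_congr_fun hS fun x hx => ?_
  rw [integral_const_mul, (hκ x hx).2]

/-- Restriction of an integral to the part of the domain where the integrand does not vanish. -/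
lemma integral_eq_of_vanishing {g h : ℝ → ℝ} {E S : Set ℝ} {c : ℝ} (hE : MeasurableSet E)
    (hS : MeasurableSet S) (hES : E ⊆ S) (h0 : ∀ x ∈ S \ E, g x = 0) (hgh : ∀ x ∈ E, h x = g x)
    (hh : IntegrableOn h E ∧ ∫ x in E, h x = c) : IntegrableOn g S ∧ ∫ x in S, g x = c := by
  refine ⟨(hh.1.congr_fun hgh hE).of_forall_sdiff_eq_zero hS h0, ?_⟩
  rw [← hh.2, setIntegral_congr_fun hE hgh]
  exact setIntegral_eq_of_subset_of_forall_sdiff_eq_zero hS hES h0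

/-! ### Fubini identities linking Abel and Poisson transforms -/

section Swaps

variable {N u : ℝ → ℝ} {M : ℝ}

/-- After exchanging integrals, `integral_poisson_div_sqrt_sq_sub_sq` evaluates the inner one: the
axis potential factors through the upper Abel transform and a one-dimensional Poisson kernel. -/
lemma integral_poisson_mul_abelTransform (hN : IntegrableOn N (Ioi 0)) {s : ℝ} (hs : 0 < s) :
    IntegrableOn (fun t => s / (s ^ 2 + t ^ 2) * abelTransform 1 N t) (Ioi 0) ∧
      ∫ t in Ioi 0, s / (s ^ 2 + t ^ 2) * abelTransform 1 N t =
        -(Real.pi / 2) * axisPotential N s := by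
  have h := setIntegral_kernel_swap (f := fun ρ => ρ * N ρ)
    (K := fun ρ t => s / (s ^ 2 + t ^ 2) * (√(1 * (ρ ^ 2 - t ^ 2)))⁻¹)
    (κ := fun ρ => Real.pi / 2 / √(ρ ^ 2 + s ^ 2)) (S := Ioi 0) (T := Ioi 0) measurableSet_Ioi
    measurableSet_Ioi (measurable_id.aestronglyMeasurable.mul hN.aestronglyMeasurable)
    (by unfold Function.uncurry; fun_prop) (fun x _ y _ => by positivity) ?_ ?_
  · have he : ∀ t, ∫ ρ in Ioi 0, ρ * N ρ * (s / (s ^ 2 + t ^ 2) * (√(1 * (ρ ^ 2 - t ^ 2)))⁻¹) =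
        s / (s ^ 2 + t ^ 2) * abelTransform 1 N t := fun t => by
      rw [abelTransform, ← integral_const_mul]
      congr 1; ext ρ; ring
    simp only [he] at h
    refine ⟨h.1, h.2.trans ?_⟩
    rw [axisPotential, neg_mul_neg, ← integral_const_mul]
    congr 1; ext ρ; ring
  · intro ρ hρ
    refine integral_eq_of_vanishing measurableSet_Ioo measurableSet_Ioi Ioo_subset_Ioi_self
      (fun t ht => ?_) (fun t _ => ?_) (integral_poisson_div_sqrt_sq_sub_sq hρ hs)
    · have ht0 : 0 < t := ht.1
      have hρ0 : 0 < ρ := hρ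
      have : ρ ≤ t := not_lt.1 fun h => ht.2 ⟨ht0, h⟩
      rw [Real.sqrt_eq_zero_of_nonpos (by nlinarith), inv_zero, mul_zero]
    · rw [one_mul, div_eq_mul_inv (s / _)]
  · refine (hN.norm.const_mul (Real.pi / 2)).mono' ?_ ?_
    · exact (measurable_id.aestronglyMeasurable.mul hN.aestronglyMeasurable).mul
        (Measurable.aestronglyMeasurable (by fun_prop))
    · refine (ae_restrict_iff' measurableSet_Ioi).2 (ae_of_all _ fun ρ hρ => ?_)
      have h := norm_axisPotential_integrand_le (N := N) hρ s
      calc ‖ρ * N ρ * (Real.pi / 2 / √(ρ ^ 2 + s ^ 2))‖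
          = Real.pi / 2 * ‖ρ * N ρ * (√(ρ ^ 2 + s ^ 2))⁻¹‖ := by
            rw [← Real.norm_of_nonneg (by positivity : 0 ≤ Real.pi / 2), ← norm_mul,
              Real.norm_of_nonneg (by positivity : 0 ≤ Real.pi / 2)]
            congr 1; ring
        _ ≤ Real.pi / 2 * ‖N ρ‖ := by gcongr; exact h

/-- The counterpart for the lower Abel transform, with `integral_Ioi_abel_kernel` as inner integral.
-/
lemma integral_kernel_mul_lower_abelTransform
    (hu : AEStronglyMeasurable u (volume.restrict (Ioi 0))) (hM : ∀ ρ > 0, |u ρ| ≤ M)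
    {w : ℝ} (hw : 0 < w) :
    IntegrableOn (fun t => t / (w ^ 2 + t ^ 2) ^ 2 * abelTransform (-1) u t) (Ioi 0) ∧
      ∫ t in Ioi 0, t / (w ^ 2 + t ^ 2) ^ 2 * abelTransform (-1) u t =
        Real.pi / (4 * w) * ∫ ρ in Ioi 0, ρ * u ρ * poissonKer ρ w := by
  have hker : ∀ ρ, ρ * u ρ * (Real.pi / 4 / √(ρ ^ 2 + w ^ 2) ^ 3) =
      Real.pi / (4 * w) * (ρ * u ρ * poissonKer ρ w) := fun ρ => by
    rw [poissonKer]; field_simp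
  have h := setIntegral_kernel_swap (f := fun ρ => ρ * u ρ)
    (K := fun ρ t => t / (w ^ 2 + t ^ 2) ^ 2 * (√(-1 * (ρ ^ 2 - t ^ 2)))⁻¹)
    (κ := fun ρ => Real.pi / 4 / √(ρ ^ 2 + w ^ 2) ^ 3) (S := Ioi 0) (T := Ioi 0) measurableSet_Ioi
    measurableSet_Ioi (measurable_id.aestronglyMeasurable.mul hu)
    (by unfold Function.uncurry; fun_prop)
    (fun x _ y hy => by have hy0 : 0 < y := hy; positivity) ?_ ?_
  · have he : ∀ t, ∫ ρ in Ioi 0, ρ * u ρ * (t / (w ^ 2 + t ^ 2) ^ 2 *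
        (√(-1 * (ρ ^ 2 - t ^ 2)))⁻¹) = t / (w ^ 2 + t ^ 2) ^ 2 * abelTransform (-1) u t :=
      fun t => by
        rw [abelTransform, ← integral_const_mul]
        congr 1; ext ρ; ring
    simp only [he] at h
    refine ⟨h.1, h.2.trans ?_⟩
    simp only [hker]
    rw [integral_const_mul]
  · intro ρ hρ
    have hρ0 : 0 < ρ := hρ
    refine integral_eq_of_vanishing measurableSet_Ioi measurableSet_Ioi (Ioi_subset_Ioi hρ0.le)
      (fun t ht => ?_) (fun t _ => ?_) (integral_Ioi_abel_kernel hρ hw)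
    · have ht0 : 0 < t := ht.1
      have : t ≤ ρ := not_lt.1 ht.2
      rw [Real.sqrt_eq_zero_of_nonpos (by nlinarith), inv_zero, mul_zero]
    · rw [div_eq_mul_inv (t / _)]; congr 3; ring
  · simp only [hker]
    exact (integrableOn_mul_poissonKer hu hM hw).const_mul _

/-- Integration by parts in Fubini form, since `t / (w² + t²)²` has antiderivative `-1 / (2 (w² +
t²))`. This makes primitives comparable with lower Abel transforms under the same kernel. -/
lemma integral_kernel_mul_primitive {Φ : ℝ → ℝ}
    (hΦ : ∀ w > 0, IntegrableOn (fun t => w / (w ^ 2 + t ^ 2) * Φ t) (Ioi 0)) {w : ℝ}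
    (hw : 0 < w) :
    IntegrableOn (fun t => t / (w ^ 2 + t ^ 2) ^ 2 * ∫ τ in Ioo 0 t, Φ τ) (Ioi 0) ∧
      ∫ t in Ioi 0, t / (w ^ 2 + t ^ 2) ^ 2 * ∫ τ in Ioo 0 t, Φ τ =
        1 / (2 * w) * ∫ t in Ioi 0, w / (w ^ 2 + t ^ 2) * Φ t := by
  have hker : ∀ τ, Φ τ * (1 / (2 * (w ^ 2 + τ ^ 2))) =
      1 / (2 * w) * (w / (w ^ 2 + τ ^ 2) * Φ τ) := fun τ => by field_simp
  have hm : AEStronglyMeasurable Φ (volume.restrict (Ioi 0)) := by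
    refine ((Measurable.aestronglyMeasurable (f := fun t : ℝ => (w ^ 2 + t ^ 2) / w)
      (by fun_prop)).mul (hΦ w hw).aestronglyMeasurable).congr (ae_of_all _ fun t => ?_)
    have : w ^ 2 + t ^ 2 ≠ 0 := by positivity
    simp only [Pi.mul_apply]
    field_simp
  have h := setIntegral_kernel_swap (f := Φ)
    (K := fun τ t => if τ < t then t / (w ^ 2 + t ^ 2) ^ 2 else 0)
    (κ := fun τ => 1 / (2 * (w ^ 2 + τ ^ 2))) (S := Ioi 0) (T := Ioi 0) measurableSet_Ioi
    measurableSet_Ioi hm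
    (Measurable.ite (measurableSet_lt measurable_fst measurable_snd) (by fun_prop)
      measurable_const)
    (fun x _ y hy => by have hy0 : 0 < y := hy; positivity) ?_ ?_
  · have he : ∀ t, ∫ τ in Ioi 0, Φ τ * (if τ < t then t / (w ^ 2 + t ^ 2) ^ 2 else 0) =
        t / (w ^ 2 + t ^ 2) ^ 2 * ∫ τ in Ioo 0 t, Φ τ := fun t => by
      rw [← integral_const_mul, setIntegral_eq_of_subset_of_forall_sdiff_eq_zero measurableSet_Ioi
        (show Ioo 0 t ⊆ Ioi 0 from fun x hx => hx.1) fun τ hτ => ?_]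
      · refine setIntegral_congr_fun measurableSet_Ioo fun τ hτ => ?_
        simp only [if_pos hτ.2, mul_comm]
      · rw [if_neg fun h => hτ.2 ⟨hτ.1, h⟩, mul_zero]
    simp only [he] at h
    refine ⟨h.1, h.2.trans ?_⟩
    simp only [hker]
    rw [integral_const_mul]
  · intro τ hτ
    have hτ0 : 0 < τ := hτ
    refine integral_eq_of_vanishing measurableSet_Ioi measurableSet_Ioi (Ioi_subset_Ioi hτ0.le)
      (fun t ht => if_neg ht.2) (fun t ht => (if_pos ht).symm)
      (integral_Ioi_poisson_kernel hτ0.le hw)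
  · simp only [hker]
    exact (hΦ w hw).const_mul _

/-- If the Poisson transform of `u` is the axis potential of `N` then the lower Abel transform of
`u` is the primitive of minus the upper Abel transform of `N`. -/
theorem lower_abelTransform_eq_primitive (hN : IntegrableOn N (Ioi 0))
    (hu : AEStronglyMeasurable u (volume.restrict (Ioi 0))) (hM : ∀ ρ > 0, |u ρ| ≤ M)
    (h : ∀ w > 0, ∫ ρ in Ioi 0, ρ * u ρ * poissonKer ρ w = axisPotential N w) :
    ∀ᵐ t : ℝ, t ∈ Ioi 0 →
      abelTransform (-1) u t = ∫ τ in Ioo 0 t, -abelTransform 1 N τ := by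
  have hΦ : ∀ w > 0, IntegrableOn (fun t => w / (w ^ 2 + t ^ 2) * -abelTransform 1 N t) (Ioi 0) ∧
      ∫ t in Ioi 0, w / (w ^ 2 + t ^ 2) * -abelTransform 1 N t =
        Real.pi / 2 * axisPotential N w := fun w hw => by
    obtain ⟨h1, h2⟩ := integral_poisson_mul_abelTransform hN hw
    simp only [mul_neg]
    exact ⟨h1.neg, by rw [integral_neg, h2]; ring⟩
  have hrpow : ∀ A > (0 : ℝ), ∀ t : ℝ, (t ^ 2 + A) ^ (-2 : ℝ) = 1 / (√A ^ 2 + t ^ 2) ^ 2 := by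
    intro A hA t
    rw [Real.rpow_neg (by positivity), Real.sq_sqrt hA.le, add_comm A, one_div]
    norm_num
  -- With `A = w²` and an extra factor `t`, the kernel `t / (w² + t²)²` is a Stieltjes kernel of
  -- exponent `2`. Both terms of the difference give `π / (4w)` times the axis potential at `w`.
  have hboth : ∀ A > (0 : ℝ), IntegrableOn (fun t => (t ^ 2 + A) ^ (-2 : ℝ) •
      (t * (abelTransform (-1) u t - ∫ τ in Ioo 0 t, -abelTransform 1 N τ))) (Ioi 0) ∧
      ∫ t in Ioi 0, (t ^ 2 + A) ^ (-2 : ℝ) •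
      (t * (abelTransform (-1) u t - ∫ τ in Ioo 0 t, -abelTransform 1 N τ)) = 0 := by
    intro A hA
    have hw := Real.sqrt_pos.2 hA
    obtain ⟨i1, e1⟩ := integral_kernel_mul_lower_abelTransform hu hM hw
    obtain ⟨i2, e2⟩ := integral_kernel_mul_primitive (fun w hw => (hΦ w hw).1) hw
    have he : ∀ t, (t ^ 2 + A) ^ (-2 : ℝ) •
        (t * (abelTransform (-1) u t - ∫ τ in Ioo 0 t, -abelTransform 1 N τ)) =
        t / (√A ^ 2 + t ^ 2) ^ 2 * abelTransform (-1) u t -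
          t / (√A ^ 2 + t ^ 2) ^ 2 * ∫ τ in Ioo 0 t, -abelTransform 1 N τ := fun t => by
      rw [hrpow A hA, smul_eq_mul]; ring
    simp only [he]
    refine ⟨i1.sub i2, ?_⟩
    rw [integral_sub i1 i2, e1, e2, h _ hw, (hΦ _ hw).2]
    field_simp
    ring
  filter_upwards [ae_eq_zero_of_stieltjes_eq_zero (ν := 2) two_pos (hboth 1 one_pos).1
    fun A hA => (hboth A hA).2] with t ht ht0
  exact sub_eq_zero.1 ((mul_eq_zero.1 (ht ht0)).resolve_left (ne_of_gt ht0))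

/-- The lower Abel transform of an absolutely continuous function as a primitive. -/
lemma lower_abelTransform_of_primitive {h : ℝ → ℝ} {c t : ℝ} (ht : 0 < t)
    (hh : IntegrableOn h (Ioo 0 t)) (hu : ∀ ρ ∈ Ioo 0 t, u ρ = c + ∫ r in Ioo 0 ρ, h r) :
    IntegrableOn (fun τ => c + τ * abelTransform (-1) (fun r => h r / r) τ) (Ioo 0 t) ∧
      abelTransform (-1) u t =
        ∫ τ in Ioo 0 t, (c + τ * abelTransform (-1) (fun r => h r / r) τ) := by
  have hfκ : IntegrableOn (fun r => h r * √(t ^ 2 - r ^ 2)) (Ioo 0 t) := by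
    refine (hh.norm.mul_const t).mono' (hh.aestronglyMeasurable.mul
      (Measurable.aestronglyMeasurable (by fun_prop))) (ae_of_all _ fun r => ?_)
    rw [norm_mul, Real.norm_of_nonneg (Real.sqrt_nonneg _)]
    refine mul_le_mul_of_nonneg_left (Real.sqrt_le_iff.2 ⟨ht.le, ?_⟩) (norm_nonneg _)
    nlinarith [sq_nonneg r]
  have hmain := integral_div_sqrt_sq_sub_upper le_rfl ht.le
  -- Both double integrals of `h` have the inner value `√(t² - r²)`: it is `∫ ρ / √(t² - ρ²) dρ` and
  -- also `∫ τ / √(τ² - r²) dτ`, each over `(r, t)`.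
  have hA := setIntegral_kernel_swap (f := h)
    (K := fun r ρ => if r < ρ then ρ * (√(-1 * (ρ ^ 2 - t ^ 2)))⁻¹ else 0)
    (κ := fun r => √(t ^ 2 - r ^ 2)) (S := Ioo 0 t) (T := Ioo 0 t) measurableSet_Ioo
    measurableSet_Ioo hh.aestronglyMeasurable
    (Measurable.ite (measurableSet_lt measurable_fst measurable_snd) (by fun_prop)
      measurable_const)
    (fun x _ y hy => by have hy0 : 0 < y := hy.1; positivity) ?_ hfκ
  · have hB := setIntegral_kernel_swap (f := h)
      (K := fun r τ => τ * (√(-1 * (r ^ 2 - τ ^ 2)))⁻¹)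
      (κ := fun r => √(t ^ 2 - r ^ 2)) (S := Ioo 0 t) (T := Ioo 0 t) measurableSet_Ioo
      measurableSet_Ioo hh.aestronglyMeasurable (by unfold Function.uncurry; fun_prop)
      (fun x _ y hy => by have hy0 : 0 < y := hy.1; positivity) ?_ hfκ
    · have heA : ∀ ρ ∈ Ioo 0 t, ∫ r in Ioo 0 t, h r *
          (if r < ρ then ρ * (√(-1 * (ρ ^ 2 - t ^ 2)))⁻¹ else 0) =
          ρ * (√(-1 * (ρ ^ 2 - t ^ 2)))⁻¹ * ∫ r in Ioo 0 ρ, h r := fun ρ hρ => by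
        rw [← integral_const_mul, setIntegral_eq_of_subset_of_forall_sdiff_eq_zero
          measurableSet_Ioo (show Ioo 0 ρ ⊆ Ioo 0 t from fun x hx => ⟨hx.1, hx.2.trans hρ.2⟩) fun r hr => ?_]
        · refine setIntegral_congr_fun measurableSet_Ioo fun r hr => ?_
          simp only [if_pos hr.2, mul_comm]
        · rw [if_neg fun h => hr.2 ⟨hr.1.1, h⟩, mul_zero]
      have heB : ∀ τ ∈ Ioo 0 t, ∫ r in Ioo 0 t, h r * (τ * (√(-1 * (r ^ 2 - τ ^ 2)))⁻¹) =
          τ * abelTransform (-1) (fun r => h r / r) τ := fun τ hτ => by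
        rw [abelTransform, ← integral_const_mul, setIntegral_eq_of_subset_of_forall_sdiff_eq_zero
          measurableSet_Ioi (show Ioo 0 t ⊆ Ioi 0 from fun x hx => hx.1) fun r hr => ?_]
        · refine setIntegral_congr_fun measurableSet_Ioo fun r hr => ?_
          have : r ≠ 0 := hr.1.ne'
          change h r * (τ * _) = τ * (r * (h r / r) * _)
          field_simp
        · have hr0 : 0 < r := hr.1
          have : t ≤ r := not_lt.1 fun h => hr.2 ⟨hr0, h⟩
          have hτ1 := hτ.1
          have hτ2 := hτ.2
          rw [Real.sqrt_eq_zero_of_nonpos (by nlinarith), inv_zero, mul_zero, mul_zero]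
      have iA := hA.1.congr_fun heA measurableSet_Ioo
      have iB := hB.1.congr_fun heB measurableSet_Ioo
      rw [setIntegral_congr_fun measurableSet_Ioo heA] at hA
      rw [setIntegral_congr_fun measurableSet_Ioo heB] at hB
      have ic : IntegrableOn (fun _ : ℝ => c) (Ioo 0 t) := by simp
      refine ⟨ic.add iB, ?_⟩
      have hvc : ∫ _ in Ioo 0 t, c = c * t := by
        simp [Real.volume_real_Ioo_of_le ht.le, mul_comm]
      rw [integral_add ic iB, hB.2, ← hA.2, hvc]
      refine (integral_eq_of_vanishing measurableSet_Ioo measurableSet_Ioi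
        (show Ioo 0 t ⊆ Ioi 0 from fun x hx => hx.1) (fun ρ hρ => ?_) (fun ρ hρ => ?_)
        ⟨(hmain.1.const_mul c).add iA, ?_⟩).2
      · have hρ0 : 0 < ρ := hρ.1
        have : t ≤ ρ := not_lt.1 fun h => hρ.2 ⟨hρ0, h⟩
        rw [Real.sqrt_eq_zero_of_nonpos (by nlinarith), inv_zero, mul_zero]
      · simp only [Pi.add_apply]
        rw [hu ρ hρ, show -1 * (ρ ^ 2 - t ^ 2) = t ^ 2 - ρ ^ 2 by ring]
        ring
      · simp only [Pi.add_apply]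
        rw [integral_add (hmain.1.const_mul c) iA, integral_const_mul, hmain.2]
        simp [Real.sqrt_sq ht.le]
    · intro r hr
      refine integral_eq_of_vanishing measurableSet_Ioo measurableSet_Ioo
        (Ioo_subset_Ioo_left hr.1.le) (fun τ hτ => ?_) (fun τ _ => ?_)
        (integral_div_sqrt_sq_sub_lower hr.1 hr.2.le)
      · have hτ0 : 0 < τ := hτ.1.1
        have : τ ≤ r := not_lt.1 fun h => hτ.2 ⟨h, hτ.1.2⟩
        rw [Real.sqrt_eq_zero_of_nonpos (by nlinarith), inv_zero, mul_zero]
      · rw [div_eq_mul_inv]; congr 3; ring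
  · intro r hr
    refine integral_eq_of_vanishing measurableSet_Ioo measurableSet_Ioo
      (Ioo_subset_Ioo_left hr.1.le) (fun ρ hρ => if_neg fun h => hρ.2 ⟨h, hρ.1.2⟩) (fun ρ hρ => ?_)
      (integral_div_sqrt_sq_sub_upper hr.1.le hr.2.le)
    rw [if_pos hρ.1, div_eq_mul_inv]; congr 3; ring

end Swaps

/-! ### Equality of the Dirichlet and Neumann densities -/

section Densities

variable {ρ₀ Uc M : ℝ} {N u Ur : ℝ → ℝ}

lemma integrableOn_id_mul (hN : IntegrableOn N (Ioi 0)) (hN0 : ∀ ρ, ρ₀ ≤ ρ → N ρ = 0) :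
    IntegrableOn (fun ρ => ρ * N ρ) (Ioi 0) := by
  refine (hN.norm.const_mul ρ₀).mono' (measurable_id.aestronglyMeasurable.mul
    hN.aestronglyMeasurable) ((ae_restrict_iff' measurableSet_Ioi).2 (ae_of_all _ fun ρ hρ => ?_))
  rw [norm_mul, Real.norm_of_nonneg (le_of_lt hρ)]
  rcases le_or_gt ρ₀ ρ with h | h
  · simp [hN0 ρ h]
  · gcongr

lemma upper_abelTransform_continuousAt (hN : IntegrableOn N (Ioi 0))
    (hN0 : ∀ ρ, ρ₀ ≤ ρ → N ρ = 0) (hNc : ContinuousOn N (Ioo 0 ρ₀)) {t : ℝ} (ht : t ∈ Ioo 0 ρ₀) :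
    IntegrableOn (fun ρ => ρ * N ρ * (√(1 * (ρ ^ 2 - t ^ 2)))⁻¹) (Ioi 0) ∧
      ContinuousAt (abelTransform 1 N) t :=
  abelTransform_continuousAt (Or.inl rfl) (integrableOn_id_mul hN hN0) ht.1
    ((hNc.continuousAt (isOpen_Ioo.mem_nhds ht)).tendsto.isBigO_one ℝ)

/-- Integrability of `Ur` is available only on `(0, a)` with `a < ρ₀`. For `t < a < ρ₀`, truncation
at `a` does not change the lower transform near `t`. -/
lemma lower_abelTransform_continuousAt (hUc : ContinuousOn Ur (Ioo 0 ρ₀))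
    (hUi : ∀ a ∈ Ioo 0 ρ₀, IntegrableOn Ur (Ioo 0 a)) {t : ℝ} (ht : t ∈ Ioo 0 ρ₀) :
    IntegrableOn (fun ρ => Ur ρ * (√(-1 * (ρ ^ 2 - t ^ 2)))⁻¹) (Ioo 0 t) ∧
      ContinuousAt (abelTransform (-1) fun r => Ur r / r) t := by
  obtain ⟨a, hta, ha⟩ := exists_between ht.2
  have ha0 : 0 < a := ht.1.trans hta
  set g : ℝ → ℝ := (Ioo 0 a).indicator fun r => Ur r / r with hg
  have hg1 : IntegrableOn (fun ρ => ρ * g ρ) (Ioi 0) := by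
    have h1 := ((integrable_indicator_iff measurableSet_Ioo).2 (hUi a ⟨ha0, ha⟩)).integrableOn
      (s := Ioi 0)
    refine h1.congr_fun (fun ρ hρ => ?_) measurableSet_Ioi
    have hρ0 : ρ ≠ 0 := ne_of_gt hρ
    by_cases h : ρ ∈ Ioo 0 a
    · rw [hg, indicator_of_mem h, indicator_of_mem h]; field_simp
    · rw [hg, indicator_of_notMem h, indicator_of_notMem h, mul_zero]
  have hgt : g =ᶠ[𝓝 t] fun r => Ur r / r := by
    filter_upwards [isOpen_Ioo.mem_nhds (⟨ht.1, hta⟩ : t ∈ Ioo 0 a)] with r hr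
    exact indicator_of_mem hr _
  have hgb : g =O[𝓝 t] fun _ => (1 : ℝ) := by
    have h1 : ContinuousAt (fun r => Ur r / r) t :=
      (hUc.continuousAt (isOpen_Ioo.mem_nhds ht)).div continuousAt_id ht.1.ne'
    exact (h1.tendsto.congr' hgt.symm).isBigO_one ℝ
  obtain ⟨h1, h2⟩ := abelTransform_continuousAt (σ := -1) (Or.inr rfl) hg1 ht.1 hgb
  constructor
  · refine (h1.mono_set (show Ioo 0 t ⊆ Ioi 0 from fun x hx => hx.1)).congr_fun
      (fun ρ hρ => ?_) measurableSet_Ioo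
    have hρ0 : ρ ≠ 0 := hρ.1.ne'
    have hm : ρ ∈ Ioo 0 a := ⟨hρ.1, hρ.2.trans hta⟩
    simp only [hg, indicator_of_mem hm]
    field_simp
  · refine h2.congr ?_
    filter_upwards [isOpen_Ioo.mem_nhds (⟨ht.1, hta⟩ : t ∈ Ioo 0 a)] with s hs
    refine setIntegral_congr_fun measurableSet_Ioi fun ρ hρ => ?_
    have hρ0 : 0 < ρ := hρ
    by_cases h : ρ ∈ Ioo 0 a
    · simp only [hg, indicator_of_mem h]
    · have hs1 := hs.1
      have hs2 : s < ρ := hs.2.trans_le (not_lt.1 fun h' => h ⟨hρ0, h'⟩)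
      simp only
      rw [Real.sqrt_eq_zero_of_nonpos (by nlinarith), inv_zero, mul_zero, mul_zero]

/-- The substitution `ρ = w x` turns the kernel into the fixed weight `x K(x, 1)` of mass one. -/
lemma tendsto_integral_poissonKer_zero (hu : AEStronglyMeasurable u (volume.restrict (Ioi 0)))
    (hM : ∀ ρ > 0, |u ρ| ≤ M) (h0 : Tendsto u (𝓝[>] 0) (𝓝 Uc)) :
    Tendsto (fun w => ∫ ρ in Ioi 0, ρ * u ρ * poissonKer ρ w) (𝓝[>] 0) (𝓝 Uc) := by
  have hscale : ∀ w > 0, ∫ ρ in Ioi 0, ρ * u ρ * poissonKer ρ w =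
      ∫ x in Ioi 0, u (w * x) * (x * poissonKer x 1) := by
    intro w hw
    have h := integral_comp_mul_left_Ioi (fun ρ => ρ * u ρ * poissonKer ρ w) 0 hw
    rw [mul_zero] at h
    have h2 : ∫ ρ in Ioi 0, ρ * u ρ * poissonKer ρ w =
        w • ∫ x in Ioi 0, (w * x) * u (w * x) * poissonKer (w * x) w := by
      rw [h, smul_smul, mul_inv_cancel₀ hw.ne', one_smul]
    rw [h2, ← integral_smul]
    refine setIntegral_congr_fun measurableSet_Ioi fun x _ => ?_
    have hs : √((w * x) ^ 2 + w ^ 2) = w * √(x ^ 2 + 1 ^ 2) := by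
      rw [show (w * x) ^ 2 + w ^ 2 = w ^ 2 * (x ^ 2 + 1 ^ 2) by ring,
        Real.sqrt_mul (by positivity), Real.sqrt_sq hw.le]
    have : √(x ^ 2 + 1 ^ 2) ≠ 0 := by positivity
    simp only [poissonKer, hs, smul_eq_mul]
    field_simp
  have h1 := integral_mul_poissonKer one_pos
  have hlim : Tendsto (fun w => ∫ x in Ioi 0, u (w * x) * (x * poissonKer x 1)) (𝓝[>] 0)
      (𝓝 (∫ x in Ioi 0, Uc * (x * poissonKer x 1))) := by
    refine tendsto_integral_filter_of_dominated_convergence (fun x => M * (x * poissonKer x 1))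
      ?_ ?_ (h1.1.const_mul M) ?_
    · filter_upwards [self_mem_nhdsWithin] with w hw
      have hw0 : 0 < w := hw
      have hq : Measure.QuasiMeasurePreserving (fun x => w * x) (volume.restrict (Ioi 0))
          (volume.restrict (Ioi 0)) := by
        refine ⟨by fun_prop, ?_⟩
        refine Measure.AbsolutelyContinuous.mk fun s hs h => ?_
        rw [Measure.map_apply (by fun_prop) hs, Measure.restrict_apply (by measurability)]
        rw [Measure.restrict_apply hs] at h
        have : (fun x => w * x) ⁻¹' s ∩ Ioi 0 = (fun x => w * x) ⁻¹' (s ∩ Ioi 0) := by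
          ext x; simp [hw0]
        rw [this, Real.volume_preimage_mul_left hw0.ne', h, mul_zero]
      exact (hu.comp_quasiMeasurePreserving hq).mul h1.1.aestronglyMeasurable
    · filter_upwards [self_mem_nhdsWithin] with w hw
      refine (ae_restrict_iff' measurableSet_Ioi).2 (ae_of_all _ fun x hx => ?_)
      have h2 := mul_nonneg (le_of_lt hx) (poissonKer_nonneg x one_pos)
      rw [norm_mul, Real.norm_of_nonneg h2]
      exact mul_le_mul_of_nonneg_right (hM _ (mul_pos hw (show 0 < x from hx))) h2
    · refine (ae_restrict_iff' measurableSet_Ioi).2 (ae_of_all _ fun x hx => ?_)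
      refine (h0.comp (tendsto_nhdsWithin_iff.2 ⟨?_, ?_⟩)).mul_const _
      · exact (Continuous.tendsto' (f := fun w : ℝ => w * x) (by fun_prop) 0 0
          (zero_mul x)).mono_left nhdsWithin_le_nhds
      · filter_upwards [self_mem_nhdsWithin] with w hw using mul_pos hw (show 0 < x from hx)
  rw [integral_const_mul, h1.2, mul_one] at hlim
  refine hlim.congr' ?_
  filter_upwards [self_mem_nhdsWithin] with w hw using (hscale w hw).symm

lemma tendsto_axisPotential_zero (hN : IntegrableOn N (Ioi 0)) :
    Tendsto (axisPotential N) (𝓝[>] 0) (𝓝 (-∫ ρ in Ioi 0, N ρ)) := by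
  refine Tendsto.neg (tendsto_integral_filter_of_dominated_convergence (fun ρ => |N ρ|)
    (Eventually.of_forall fun s => aestronglyMeasurable_axisPotential_integrand hN s)
    (Eventually.of_forall fun s => ?_) hN.norm ?_)
  · exact (ae_restrict_iff' measurableSet_Ioi).2 (ae_of_all _ fun ρ hρ =>
      norm_axisPotential_integrand_le hρ s)
  · refine (ae_restrict_iff' measurableSet_Ioi).2 (ae_of_all _ fun ρ hρ => ?_)
    have hρ0 : 0 < ρ := hρ
    have hc : ContinuousAt (fun s => ρ * N ρ * (√(ρ ^ 2 + s ^ 2))⁻¹) 0 := by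
      have : √(ρ ^ 2 + 0 ^ 2) ≠ 0 := by positivity
      fun_prop (disch := assumption)
    have h2 : ρ * N ρ * (√(ρ ^ 2 + 0 ^ 2))⁻¹ = N ρ := by
      rw [zero_pow two_ne_zero, add_zero, Real.sqrt_sq hρ0.le]; field_simp
    have := hc.tendsto
    simp only [h2] at this
    exact this.mono_left nhdsWithin_le_nhds

/-- The densities in terms of the Dirichlet and of the Neumann data agree. -/
theorem density_eq (hN : IntegrableOn N (Ioi 0)) (hN0 : ∀ ρ, ρ₀ ≤ ρ → N ρ = 0)
    (hNc : ContinuousOn N (Ioo 0 ρ₀)) (hUr : ContinuousOn Ur (Ioo 0 ρ₀))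
    (hUi : ∀ a ∈ Ioo 0 ρ₀, IntegrableOn Ur (Ioo 0 a))
    (hu : AEStronglyMeasurable u (volume.restrict (Ioi 0))) (hM : ∀ ρ > 0, |u ρ| ≤ M)
    (hud : ∀ ρ ∈ Ioo 0 ρ₀, u ρ = Uc + ∫ r in Ioo 0 ρ, Ur r)
    (h : ∀ w > 0, ∫ ρ in Ioi 0, ρ * u ρ * poissonKer ρ w = axisPotential N w) {t : ℝ}
    (ht : t ∈ Ioo 0 ρ₀) :
    Uc + t * abelTransform (-1) (fun r => Ur r / r) t = -abelTransform 1 N t := by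
  obtain ⟨a, hta, ha⟩ := exists_between ht.2
  have ha0 : 0 < a := ht.1.trans hta
  -- `Δ` is the difference of the two sides. Its primitive vanishes almost everywhere on `(0, a)`,
  -- hence everywhere by continuity, and `Δ` is continuous at `t`; the derivative of the primitive
  -- at `t` gives `Δ t = 0`.
  set Δ : ℝ → ℝ := fun τ => (Uc + τ * abelTransform (-1) (fun r => Ur r / r) τ) -
    -abelTransform 1 N τ with hΔ
  have hi1 : ∀ s ∈ Ioo 0 ρ₀, IntegrableOn
      (fun τ => Uc + τ * abelTransform (-1) (fun r => Ur r / r) τ) (Ioo 0 s) ∧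
      abelTransform (-1) u s =
        ∫ τ in Ioo 0 s, (Uc + τ * abelTransform (-1) (fun r => Ur r / r) τ) := fun s hs =>
    lower_abelTransform_of_primitive hs.1 (hUi s hs) fun ρ hρ => hud ρ ⟨hρ.1, hρ.2.trans hs.2⟩
  have hi2 : ∀ s ∈ Ioo 0 ρ₀, IntegrableOn (fun τ => -abelTransform 1 N τ) (Ioo 0 s) := by
    intro s hs
    have h1 := (integral_poisson_mul_abelTransform hN one_pos).1.mono_set
      (show Ioo 0 s ⊆ Ioi 0 from fun x hx => hx.1)
    have hm : ContinuousOn (abelTransform 1 N) (Ioo 0 s) := fun τ hτ =>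
      (upper_abelTransform_continuousAt hN hN0 hNc
        ⟨hτ.1, hτ.2.trans hs.2⟩).2.continuousWithinAt
    refine ((h1.norm.const_mul (1 + s ^ 2)).mono' (hm.aestronglyMeasurable measurableSet_Ioo)
      ((ae_restrict_iff' measurableSet_Ioo).2 (ae_of_all _ fun τ hτ => ?_))).neg
    rw [norm_mul, ← mul_assoc, Real.norm_of_nonneg (by positivity : 0 ≤ 1 / (1 ^ 2 + τ ^ 2))]
    refine le_mul_of_one_le_left (norm_nonneg _) ?_
    rw [mul_one_div, one_le_div (by positivity)]
    have := hτ.1; have := hτ.2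
    gcongr
    simp
  have hΔi : IntegrableOn Δ (Ioo 0 a) := (hi1 a ⟨ha0, ha⟩).1.sub (hi2 a ⟨ha0, ha⟩)
  have hΔi' : IntervalIntegrable Δ volume 0 a := by
    rw [intervalIntegrable_iff_integrableOn_Ioo_of_le ha0.le]; exact hΔi
  have hprim : ∀ᵐ s : ℝ, s ∈ Ioo 0 a → ∫ τ in (0 : ℝ)..s, Δ τ = 0 := by
    filter_upwards [lower_abelTransform_eq_primitive hN hu hM h] with s hs hs'
    have hsρ : s ∈ Ioo 0 ρ₀ := ⟨hs'.1, hs'.2.trans ha⟩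
    rw [intervalIntegral.integral_of_le hs'.1.le, integral_Ioc_eq_integral_Ioo,
      integral_sub (hi1 s hsρ).1 (hi2 s hsρ), ← (hi1 s hsρ).2, hs hs'.1, sub_self]
  have hcont : ContinuousOn (fun s => ∫ τ in (0 : ℝ)..s, Δ τ) (Ioo 0 a) := by
    refine (intervalIntegral.continuousOn_primitive_interval (f := Δ) (μ := volume)
      (a := 0) (b := a) (by rw [← intervalIntegrable_iff']; exact hΔi')).mono ?_
    rw [uIcc_of_le ha0.le]; exact Ioo_subset_Icc_self
  have hzero : EqOn (fun s => ∫ τ in (0 : ℝ)..s, Δ τ) (fun _ => 0) (Ioo 0 a) :=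
    Measure.eqOn_open_of_ae_eq ((ae_restrict_iff' measurableSet_Ioo).2 hprim) isOpen_Ioo hcont
      continuousOn_const
  have hmem : Ioo 0 a ∈ 𝓝 t := isOpen_Ioo.mem_nhds ⟨ht.1, hta⟩
  have hΔc : ContinuousAt Δ t :=
    (continuousAt_const.add (continuousAt_id.mul
      (lower_abelTransform_continuousAt hUr hUi ht).2)).sub
      (upper_abelTransform_continuousAt hN hN0 hNc ht).2.neg
  have hd := intervalIntegral.integral_hasDerivAt_right (f := Δ) (a := 0) (b := t)
    (hΔi'.mono_set (by rw [uIcc_of_le ha0.le, uIcc_of_le ht.1.le]; exact Icc_subset_Icc_right hta.le))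
    ⟨Ioo 0 a, hmem, hΔi.aestronglyMeasurable⟩ hΔc
  have hd0 : HasDerivAt (fun s => ∫ τ in (0 : ℝ)..s, Δ τ) 0 t :=
    (hasDerivAt_const t (0 : ℝ)).congr_of_eventuallyEq (hzero.eventuallyEq_of_mem hmem)
  exact sub_eq_zero.1 (hd.unique hd0)

/-- The value at `k = 0` comes from letting `w → 0` in the transform identity: the Poisson kernel
concentrates at the origin, where `u` tends to `Uc`, and the axis potential tends to `-∫ N`. -/
theorem density_eq_zero (hρ₀ : 0 < ρ₀) (hN : IntegrableOn N (Ioi 0))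
    (hUi : ∀ a ∈ Ioo 0 ρ₀, IntegrableOn Ur (Ioo 0 a))
    (hu : AEStronglyMeasurable u (volume.restrict (Ioi 0))) (hM : ∀ ρ > 0, |u ρ| ≤ M)
    (hud : ∀ ρ ∈ Ioo 0 ρ₀, u ρ = Uc + ∫ r in Ioo 0 ρ, Ur r)
    (h : ∀ w > 0, ∫ ρ in Ioi 0, ρ * u ρ * poissonKer ρ w = axisPotential N w) :
    Uc = -∫ ρ in Ioi 0, N ρ := by
  have ha : ρ₀ / 2 ∈ Ioo 0 ρ₀ := ⟨by positivity, by linarith⟩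
  have hint : IntervalIntegrable Ur volume 0 (ρ₀ / 2) := by
    rw [intervalIntegrable_iff_integrableOn_Ioo_of_le ha.1.le]; exact hUi _ ha
  have h0 : Tendsto u (𝓝[>] 0) (𝓝 Uc) := by
    have h1 := (intervalIntegral.continuousOn_primitive_interval (f := Ur) (μ := volume)
      (a := 0) (b := ρ₀ / 2) (by rw [← intervalIntegrable_iff']; exact hint)) 0 left_mem_uIcc
    rw [uIcc_of_le ha.1.le] at h1
    have h2 : Tendsto (fun s => Uc + ∫ r in (0 : ℝ)..s, Ur r) (𝓝[>] 0) (𝓝 (Uc + 0)) := by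
      refine Tendsto.const_add Uc ?_
      have := (h1.tendsto.mono_left (nhdsWithin_le_of_mem (Icc_mem_nhdsGT ha.1)))
      simpa using this
    rw [add_zero] at h2
    refine h2.congr' ?_
    filter_upwards [Ioo_mem_nhdsGT hρ₀] with s hs
    rw [hud s hs, intervalIntegral.integral_of_le hs.1.le, integral_Ioc_eq_integral_Ioo]
  refine tendsto_nhds_unique ((tendsto_integral_poissonKer_zero hu hM h0).congr' ?_)
    (tendsto_axisPotential_zero hN)
  filter_upwards [self_mem_nhdsWithin] with w hw using h w hw

end Densities

/-! ### Complex source points on the axis -/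

section ComplexRoot

lemma Complex.norm_cpow_one_half (z : ℂ) : ‖z ^ (1 / 2 : ℂ)‖ = √‖z‖ := by
  have h := Complex.norm_cpow_real z (1 / 2)
  push_cast at h
  rw [h, Real.sqrt_eq_rpow]

lemma Complex.cpow_one_half_sq (z : ℂ) : (z ^ (1 / 2 : ℂ)) ^ 2 = z := by
  have h := Complex.cpow_nat_inv_pow z (n := 2) two_ne_zero
  rwa [one_div]

lemma Complex.re_cpow_one_half_pos {z : ℂ} (hz : z ∈ Complex.slitPlane) :
    0 < (z ^ (1 / 2 : ℂ)).re := by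
  obtain ⟨h1, h2⟩ := Complex.mem_slitPlane_iff_arg.1 hz
  have h := Complex.cpow_ofReal_re z (1 / 2)
  push_cast at h
  rw [h]
  have h3 := Complex.neg_pi_lt_arg z
  have h4 := lt_of_le_of_ne (Complex.arg_le_pi z) h1
  exact mul_pos (Real.rpow_pos_of_pos (norm_pos_iff.2 h2) _)
    (Real.cos_pos_of_mem_Ioo ⟨by linarith, by linarith⟩)

lemma Complex.hasDerivAt_cpow_one_half_inv {z : ℂ} (hz : z ∈ Complex.slitPlane) :
    HasDerivAt (fun z : ℂ => z ^ (1 / 2 : ℂ)) (1 / (2 * z ^ (1 / 2 : ℂ))) z := by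
  have hz0 := Complex.slitPlane_ne_zero hz
  refine ((hasDerivAt_id z).cpow_const hz).congr_deriv ?_
  have hs : z ^ (1 / 2 : ℂ) ≠ 0 := by simp [Complex.cpow_eq_zero_iff, hz0]
  simp only [id]
  rw [Complex.cpow_sub _ _ hz0, Complex.cpow_one]
  nth_rewrite 2 [← Complex.cpow_one_half_sq z]
  field_simp

/-- The squared distance `(it - ζ)² + ρ²` between the point `(ρ, ζ)` and the complex source point
`it` of the axis. -/
noncomputable def sourceDistSq (p : ℝ × ℝ) (t : ℝ) : ℂ :=
  (Complex.I * (t : ℂ) - (p.2 : ℂ)) ^ 2 + (p.1 : ℂ) ^ 2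

variable {ρ ζ t : ℝ}

lemma sourceDistSq_re : (sourceDistSq (ρ, ζ) t).re = ρ ^ 2 + ζ ^ 2 - t ^ 2 := by
  simp [sourceDistSq, pow_two]; ring

lemma sourceDistSq_im : (sourceDistSq (ρ, ζ) t).im = -(2 * ζ * t) := by
  simp [sourceDistSq, pow_two]; ring

/-- The squared modulus is `(ρ² - t²)² + ζ⁴ + 2 ζ² (ρ² + t²)`, which yields this bound and the next
one. -/
lemma sq_le_norm_sourceDistSq : ζ ^ 2 ≤ ‖sourceDistSq (ρ, ζ) t‖ := by
  have h := Complex.sq_norm (sourceDistSq (ρ, ζ) t)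
  rw [Complex.normSq_apply, sourceDistSq_re, sourceDistSq_im] at h
  refine le_of_sq_le_sq ?_ (norm_nonneg _)
  rw [h]
  nlinarith [sq_nonneg (ρ ^ 2 - t ^ 2), mul_nonneg (sq_nonneg ζ) (sq_nonneg ρ),
    mul_nonneg (sq_nonneg ζ) (sq_nonneg t)]

lemma abs_le_norm_sourceDistSq : |ρ ^ 2 - t ^ 2| ≤ ‖sourceDistSq (ρ, ζ) t‖ := by
  have h := Complex.sq_norm (sourceDistSq (ρ, ζ) t)
  rw [Complex.normSq_apply, sourceDistSq_re, sourceDistSq_im] at h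
  refine le_of_sq_le_sq ?_ (norm_nonneg _)
  rw [h, sq_abs]
  nlinarith [sq_nonneg (ζ ^ 2), mul_nonneg (sq_nonneg ζ) (sq_nonneg ρ),
    mul_nonneg (sq_nonneg ζ) (sq_nonneg t)]

lemma sourceDistSq_mem_slitPlane (hρ : 0 < ρ) (h : ζ ≠ 0 ∨ t ^ 2 < ρ ^ 2) :
    sourceDistSq (ρ, ζ) t ∈ Complex.slitPlane := by
  rw [Complex.mem_slitPlane_iff, sourceDistSq_re, sourceDistSq_im]
  rcases h with h | h
  · by_cases ht : t = 0
    · left; subst ht; nlinarith [sq_nonneg ζ, pow_pos hρ 2]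
    · right; simp [h, ht]
  · left; nlinarith [sq_nonneg ζ]

/-- The kernel of the representation formula. -/
noncomputable def sourceKer (p : ℝ × ℝ) (t : ℝ) : ℂ := (sourceDistSq p t ^ (1 / 2 : ℂ))⁻¹

lemma measurable_sourceKer : Measurable (Function.uncurry sourceKer) := by
  unfold Function.uncurry sourceKer sourceDistSq
  fun_prop

lemma norm_sourceKer (p : ℝ × ℝ) : ‖sourceKer p t‖ = (√‖sourceDistSq p t‖)⁻¹ := by
  rw [sourceKer, norm_inv, Complex.norm_cpow_one_half]

lemma norm_sourceKer_le (hζ : ζ ≠ 0) : ‖sourceKer (ρ, ζ) t‖ ≤ |ζ|⁻¹ := by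
  rw [norm_sourceKer]
  refine inv_anti₀ (abs_pos.2 hζ) ?_
  rw [← Real.sqrt_sq_eq_abs]
  exact Real.sqrt_le_sqrt sq_le_norm_sourceDistSq

lemma continuousAt_sourceKer {p : ℝ × ℝ} (hρ : 0 < p.1) (h : p.2 ≠ 0 ∨ t ^ 2 < p.1 ^ 2) :
    ContinuousAt (fun p => sourceKer p t) p := by
  have hm := sourceDistSq_mem_slitPlane (ζ := p.2) hρ h
  have hne : sourceDistSq p t ^ (1 / 2 : ℂ) ≠ 0 := by
    simp [Complex.cpow_eq_zero_iff, Complex.slitPlane_ne_zero hm]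
  refine ContinuousAt.inv₀ (ContinuousAt.cpow ?_ continuousAt_const hm) hne
  unfold sourceDistSq
  fun_prop

lemma sourceKer_neg_snd : sourceKer (ρ, -ζ) t = sourceKer (ρ, ζ) (-t) := by
  simp only [sourceKer, sourceDistSq]
  congr 3
  push_cast
  ring

/-- The Poisson transform, at axis points, of the potential of a complex source point. -/
lemma integral_sourceKer_mul_poissonKer (hζ : 0 < ζ) (ht : t ≠ 0) {w : ℝ} (hw : 0 < w) :
    ∫ ρ in Ioi 0, ((ρ * poissonKer ρ w : ℝ) : ℂ) * sourceKer (ρ, ζ) t =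
      1 / (((ζ + w : ℝ) : ℂ) - Complex.I * t) := by
  set b : ℂ := (ζ : ℂ) - Complex.I * t with hb
  have hbre : b.re = ζ := by simp [hb]
  have hbim : b.im = -t := by simp [hb]
  have hdist : ∀ ρ : ℝ, sourceDistSq (ρ, ζ) t = (ρ : ℂ) ^ 2 + b ^ 2 := fun ρ => by
    simp only [sourceDistSq, hb]; ring
  set S : ℝ → ℂ := fun ρ => sourceDistSq (ρ, ζ) t ^ (1 / 2 : ℂ) with hS
  set R : ℝ → ℝ := fun ρ => √(ρ ^ 2 + w ^ 2) with hR
  have hRpos : ∀ ρ, 0 < R ρ := fun ρ => by simp only [hR]; positivity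
  have hR2 : ∀ ρ, R ρ ^ 2 = ρ ^ 2 + w ^ 2 := fun ρ => Real.sq_sqrt (by positivity)
  have hslit : ∀ ρ : ℝ, sourceDistSq (ρ, ζ) t ∈ Complex.slitPlane := fun ρ => by
    rw [Complex.mem_slitPlane_iff, sourceDistSq_re, sourceDistSq_im]
    right; simp [hζ.ne', ht]
  have hS2 : ∀ ρ, S ρ ^ 2 = (ρ : ℂ) ^ 2 + b ^ 2 := fun ρ => by
    rw [← hdist]; exact Complex.cpow_one_half_sq _
  have hSre : ∀ ρ, 0 < (S ρ).re := fun ρ => Complex.re_cpow_one_half_pos (hslit ρ)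
  have hS0 : ∀ ρ, S ρ ≠ 0 := fun ρ h => by have := hSre ρ; simp [h] at this
  -- Of the two roots `±b`, the branch with positive real part is `b`, because `Re b = ζ > 0`.
  have hSat0 : S 0 = b := by
    have h := hS2 0
    rw [Complex.ofReal_zero, zero_pow two_ne_zero, zero_add] at h
    rcases sq_eq_sq_iff_eq_or_eq_neg.1 h with h | h
    · exact h
    · have := hSre 0
      rw [h, Complex.neg_re, hbre] at this
      linarith
  have hbw1 : b - w ≠ 0 := fun h => ht (by
    have := congrArg Complex.im h; simp [hbim] at this; exact this)
  have hbw2 : b + w ≠ 0 := fun h => by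
    have := congrArg Complex.re h; simp [hbre] at this; linarith
  have hwb : (w : ℂ) ^ 2 - b ^ 2 ≠ 0 := by
    rw [show (w : ℂ) ^ 2 - b ^ 2 = -((b - w) * (b + w)) by ring]
    exact neg_ne_zero.2 (mul_ne_zero hbw1 hbw2)
  have hRc : ∀ ρ, (R ρ : ℂ) ≠ 0 := fun ρ => by exact_mod_cast (hRpos ρ).ne'
  have hdS : ∀ ρ : ℝ, HasDerivAt S (ρ / S ρ) ρ := fun ρ => by
    have h1 : HasDerivAt (fun x : ℂ => x ^ 2 + b ^ 2) (2 * (ρ : ℂ)) (ρ : ℂ) := by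
      simpa using (hasDerivAt_pow 2 (ρ : ℂ)).add_const (b ^ 2)
    have h2 := (HasDerivAt.comp (h₂ := fun z : ℂ => z ^ (1 / 2 : ℂ)) (ρ : ℂ)
      (Complex.hasDerivAt_cpow_one_half_inv (by rw [← hdist]; exact hslit ρ)) h1).comp_ofReal
    have h3 : (fun y : ℝ => ((fun z : ℂ => z ^ (1 / 2 : ℂ)) ∘ fun x : ℂ => x ^ 2 + b ^ 2) y) = S := by
      ext y; simp only [Function.comp, hS, hdist]
    rw [h3] at h2
    refine h2.congr_deriv ?_
    rw [← hdist ρ]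
    change 1 / (2 * S ρ) * (2 * (ρ : ℂ)) = _
    have := hS0 ρ
    field_simp
  have hdR : ∀ ρ : ℝ, HasDerivAt (fun ρ => ((R ρ)⁻¹ : ℝ)) (-(ρ * (R ρ ^ 3)⁻¹)) ρ := fun ρ => by
    have := hasDerivAt_inv_sqrt_add_sq_pow (c := w ^ 2) (z := ρ) (by positivity) 1
    simp only [pow_one] at this
    have he : (fun ρ => ((R ρ)⁻¹ : ℝ)) = fun x => (√(w ^ 2 + x ^ 2))⁻¹ := by
      ext x; simp only [hR, add_comm]
    rw [he]
    refine this.congr_deriv ?_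
    simp only [hR, add_comm (ρ ^ 2)]
    push_cast
    ring
  -- An explicit antiderivative: `(S / R)' = ρ (R² - S²) / (S R³)` and `R² - S² = w² - b²` is
  -- constant. It is nonzero because `t ≠ 0` makes `b` non-real.
  have hder : ∀ ρ : ℝ, HasDerivAt (fun ρ => (w : ℂ) / ((w : ℂ) ^ 2 - b ^ 2) *
      (S ρ * ((R ρ)⁻¹ : ℝ))) (((ρ * poissonKer ρ w : ℝ) : ℂ) * sourceKer (ρ, ζ) t) ρ := fun ρ => by
    refine (((hdS ρ).mul (hdR ρ).ofReal_comp).const_mul _).congr_deriv ?_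
    rw [sourceKer, poissonKer]
    change _ = ((ρ * (w / R ρ ^ 3) : ℝ) : ℂ) * (S ρ)⁻¹
    have h1 := hS0 ρ
    have h2 := hRc ρ
    have h3 : (R ρ : ℂ) ^ 2 = ρ ^ 2 + w ^ 2 := by exact_mod_cast congrArg Complex.ofReal (hR2 ρ)
    have h4 : ((w : ℂ) ^ 2 - b ^ 2) = R ρ ^ 2 - S ρ ^ 2 := by rw [h3, hS2]; ring
    rw [h4] at hwb ⊢
    push_cast
    field_simp
    ring
  have hRtop : Tendsto R atTop atTop := Real.tendsto_sqrt_atTop.comp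
    (tendsto_atTop_add_const_right _ _ (tendsto_pow_atTop two_ne_zero))
  -- `(S / R - 1) R (S + R) = S² - R²` is constant, and `|S + R| ≥ R` since `Re S > 0`.
  have hlim1 : Tendsto (fun ρ => S ρ * ((R ρ)⁻¹ : ℝ)) atTop (𝓝 1) := by
    rw [tendsto_iff_norm_sub_tendsto_zero]
    refine squeeze_zero (fun _ => norm_nonneg _) (fun ρ => ?_)
      ((tendsto_const_nhds (x := ‖b ^ 2 - (w : ℂ) ^ 2‖)).div_atTop
        ((tendsto_pow_atTop two_ne_zero).comp hRtop))
    have h1 : (S ρ * ((R ρ)⁻¹ : ℝ) - 1) * (R ρ * (S ρ + R ρ)) = b ^ 2 - (w : ℂ) ^ 2 := by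
      have h3 : (R ρ : ℂ) ^ 2 = ρ ^ 2 + w ^ 2 := by exact_mod_cast congrArg Complex.ofReal (hR2 ρ)
      have : (S ρ * ((R ρ)⁻¹ : ℝ) - 1) * (R ρ * (S ρ + R ρ)) = S ρ ^ 2 - (R ρ : ℂ) ^ 2 := by
        have := hRc ρ
        push_cast
        field_simp
        ring
      rw [this, h3, hS2]; ring
    have h2 : R ρ ≤ ‖S ρ + R ρ‖ := by
      refine le_trans ?_ (Complex.re_le_norm _)
      rw [Complex.add_re, Complex.ofReal_re]
      linarith [hSre ρ]
    rw [Function.comp, le_div_iff₀ (pow_pos (hRpos ρ) 2), ← h1, norm_mul, norm_mul,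
      Complex.norm_real, Real.norm_of_nonneg (hRpos ρ).le]
    have := hRpos ρ
    rw [pow_two]
    gcongr
  have hlim := hlim1.const_mul ((w : ℂ) / ((w : ℂ) ^ 2 - b ^ 2))
  have hint : IntegrableOn (fun ρ : ℝ => ((ρ * poissonKer ρ w : ℝ) : ℂ) * sourceKer (ρ, ζ) t)
      (Ioi 0) := by
    refine ((integral_mul_poissonKer hw).1.mul_const |ζ|⁻¹).mono'
      (((integral_mul_poissonKer hw).1.ofReal (𝕜 := ℂ)).aestronglyMeasurable.mul
        (measurable_sourceKer.comp (by fun_prop : Measurable fun ρ : ℝ =>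
          ((ρ, ζ), t))).aestronglyMeasurable) ?_
    refine (ae_restrict_iff' measurableSet_Ioi).2 (ae_of_all _ fun ρ hρ => ?_)
    have h2 := mul_nonneg (le_of_lt hρ) (poissonKer_nonneg ρ hw)
    rw [norm_mul, Complex.norm_real, Real.norm_of_nonneg h2]
    exact mul_le_mul_of_nonneg_left (norm_sourceKer_le hζ.ne') h2
  rw [integral_Ioi_of_hasDerivAt_of_tendsto (hder 0).continuousAt.continuousWithinAt
    (fun ρ _ => hder ρ) hint hlim, hSat0]
  have hR0 : R 0 = w := by simp [hR, Real.sqrt_sq hw.le]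
  have hw0 : (w : ℂ) ≠ 0 := by exact_mod_cast hw.ne'
  rw [hR0, show ((ζ + w : ℝ) : ℂ) - Complex.I * t = b + w by rw [hb]; push_cast; ring]
  push_cast
  field_simp
  ring

end ComplexRoot

/-! ### Superposition of complex sources -/

section Representation

variable {ρ₀ M : ℝ} {N : ℝ → ℝ}

/-- The density of the representation formula in terms of the Neumann data `N`. -/
noncomputable def axisDensity (N : ℝ → ℝ) (t : ℝ) : ℝ := -abelTransform 1 N |t|

lemma axisDensity_eq_zero (hN0 : ∀ ρ, ρ₀ ≤ ρ → N ρ = 0) {t : ℝ} (ht : ρ₀ ≤ |t|) :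
    axisDensity N t = 0 := by
  rw [axisDensity, neg_eq_zero]
  refine setIntegral_eq_zero_of_forall_eq_zero fun ρ hρ => ?_
  have hρ0 : 0 < ρ := hρ
  rcases le_or_gt ρ |t| with h | h
  · have := abs_nonneg t
    rw [Real.sqrt_eq_zero_of_nonpos (by nlinarith), inv_zero, mul_zero]
  · rw [hN0 ρ (ht.trans h.le), mul_zero, zero_mul]

/-- Integrability against the weight `1 / (1 + t²)` is already known, and that weight is bounded
below on the support `|t| ≤ ρ₀`; evenness handles `t < 0`. -/
lemma integrable_axisDensity (hN : IntegrableOn N (Ioi 0)) (hN0 : ∀ ρ, ρ₀ ≤ ρ → N ρ = 0) :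
    Integrable (axisDensity N) := by
  have h1 := (integral_poisson_mul_abelTransform hN one_pos).1
  have hle : ∀ t ∈ Ioi (0 : ℝ), axisDensity N t =
      -((1 ^ 2 + t ^ 2) / 1 * (1 / (1 ^ 2 + t ^ 2) * abelTransform 1 N t)) := fun t ht => by
    have : (1 : ℝ) ^ 2 + t ^ 2 ≠ 0 := by positivity
    rw [axisDensity, abs_of_pos ht]
    field_simp
  have hm : AEStronglyMeasurable (axisDensity N) (volume.restrict (Ioi 0)) := by
    refine (((Measurable.aestronglyMeasurable (f := fun t : ℝ => (1 ^ 2 + t ^ 2) / 1)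
      (by fun_prop)).mul h1.aestronglyMeasurable).neg).congr
      ((ae_restrict_iff' measurableSet_Ioi).2 (ae_of_all _ fun t ht => (hle t ht).symm))
  have hpos : IntegrableOn (axisDensity N) (Ioi 0) := by
    refine (h1.norm.const_mul (1 + ρ₀ ^ 2)).mono' hm
      ((ae_restrict_iff' measurableSet_Ioi).2 (ae_of_all _ fun t ht => ?_))
    have ht0 : 0 < t := ht
    rcases le_or_gt ρ₀ t with h | h
    · rw [axisDensity_eq_zero hN0 (by rwa [abs_of_pos ht0]), norm_zero]
      positivity
    · rw [hle t ht, norm_neg, norm_mul]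
      refine mul_le_mul_of_nonneg_right ?_ (norm_nonneg _)
      rw [Real.norm_of_nonneg (by positivity), div_one, one_pow]
      gcongr
  have hG := (integrable_indicator_iff measurableSet_Ioi).2 hpos
  refine (hG.add hG.comp_neg).congr ?_
  have hne : ∀ᵐ t : ℝ, t ≠ 0 := by simp [ae_iff]
  filter_upwards [hne] with t ht
  have heven : axisDensity N (-t) = axisDensity N t := by simp [axisDensity]
  rcases lt_or_gt_of_ne ht with h | h
  · simp [indicator, h, h.le, heven]
  · simp [indicator, h, h.le]

/-- The density is even, and averaging `1 / (s - it)` over `±t` gives the real kernel `s / (s² +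
t²)`, to which `integral_poisson_mul_abelTransform` applies. -/
lemma integral_axisDensity_div (hN : IntegrableOn N (Ioi 0)) (hN0 : ∀ ρ, ρ₀ ≤ ρ → N ρ = 0)
    {s : ℝ} (hs : 0 < s) :
    ∫ t, (axisDensity N t : ℂ) * (1 / ((s : ℂ) - Complex.I * t)) =
      (Real.pi * axisPotential N s : ℝ) := by
  set f : ℝ → ℂ := fun t => (axisDensity N t : ℂ) * (1 / ((s : ℂ) - Complex.I * t)) with hf
  have hne : ∀ t : ℝ, (s : ℂ) - Complex.I * t ≠ 0 := fun t h => by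
    have := congrArg Complex.re h
    simp at this
    exact hs.ne' this
  have hfi : Integrable f := by
    refine ((integrable_axisDensity hN hN0).norm.mul_const (1 / s)).mono'
      ((integrable_axisDensity hN hN0).ofReal.aestronglyMeasurable.mul
        (Measurable.aestronglyMeasurable (by fun_prop))) (ae_of_all _ fun t => ?_)
    rw [hf, norm_mul, Complex.norm_real, norm_div, norm_one]
    gcongr
    refine le_trans ?_ (Complex.re_le_norm _)
    simp
  have h2 : ∫ t, (f t + f (-t)) = (∫ t, f t) + ∫ t, f t := by
    rw [integral_add hfi hfi.comp_neg, integral_neg_eq_self]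
  have h3 : ∀ t, f t + f (-t) =
      ((-2 * (s / (s ^ 2 + |t| ^ 2) * abelTransform 1 N |t|) : ℝ) : ℂ) := fun t => by
    have h4 := hne t
    have h5 := hne (-t)
    have h6 : (s : ℂ) ^ 2 + (t : ℂ) ^ 2 = (s - Complex.I * t) * (s - Complex.I * (-t : ℝ)) := by
      push_cast
      linear_combination (t : ℂ) ^ 2 * Complex.I_sq
    simp only [hf, axisDensity, abs_neg, sq_abs]
    push_cast at h5 h6 ⊢
    have key : ∀ a b c A : ℂ, a ≠ 0 → b ≠ 0 → c = (a + b) / 2 →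
        -A * (1 / a) + -A * (1 / b) = -2 * (c / (a * b) * A) := by
      rintro a b c A ha hb rfl
      field_simp
      ring
    rw [h6]
    exact key _ _ _ _ h4 h5 (by ring)
  simp only [h3] at h2
  rw [integral_complex_ofReal, integral_comp_abs (f := fun t => -2 * (s / (s ^ 2 + t ^ 2) *
    abelTransform 1 N t)), integral_const_mul, (integral_poisson_mul_abelTransform hN hs).2] at h2
  have h7 : (2 : ℂ) * ∫ t, f t = 2 * ((Real.pi * axisPotential N s : ℝ) : ℂ) := by
    rw [two_mul, ← h2]
    push_cast
    ring
  exact mul_left_cancel₀ two_ne_zero h7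

/-- The superposition of complex source points with density `axisDensity N`. -/
noncomputable def sourcePotential (N : ℝ → ℝ) (p : ℝ × ℝ) : ℂ :=
  ∫ t, (axisDensity N t : ℂ) * sourceKer p t

lemma measurable_sourceKer_right (p : ℝ × ℝ) : Measurable (sourceKer p) := by
  unfold sourceKer sourceDistSq
  fun_prop

lemma aestronglyMeasurable_source (hN : IntegrableOn N (Ioi 0)) (hN0 : ∀ ρ, ρ₀ ≤ ρ → N ρ = 0)
    (p : ℝ × ℝ) :
    AEStronglyMeasurable (fun t => (axisDensity N t : ℂ) * sourceKer p t) volume :=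
  (integrable_axisDensity hN hN0).ofReal.aestronglyMeasurable.mul
    (measurable_sourceKer_right p).aestronglyMeasurable

lemma integrable_source_of_bound (hN : IntegrableOn N (Ioi 0)) (hN0 : ∀ ρ, ρ₀ ≤ ρ → N ρ = 0)
    {p : ℝ × ℝ} {C : ℝ} (hC : ∀ t, |t| < ρ₀ → ‖sourceKer p t‖ ≤ C) :
    Integrable fun t => (axisDensity N t : ℂ) * sourceKer p t := by
  refine ((integrable_axisDensity hN hN0).norm.mul_const C).mono'
    (aestronglyMeasurable_source hN hN0 p) (ae_of_all _ fun t => ?_)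
  rw [norm_mul, Complex.norm_real]
  rcases lt_or_ge |t| ρ₀ with h | h
  · exact mul_le_mul_of_nonneg_left (hC t h) (norm_nonneg _)
  · simp [axisDensity_eq_zero hN0 h]

lemma continuousAt_sourcePotential (hN : IntegrableOn N (Ioi 0)) (hN0 : ∀ ρ, ρ₀ ≤ ρ → N ρ = 0)
    {p : ℝ × ℝ} (hp : 0 < p.1) (hp2 : p.2 ≠ 0) : ContinuousAt (sourcePotential N) p := by
  have hp2' : 0 < |p.2| := abs_pos.2 hp2
  refine tendsto_integral_filter_of_dominated_convergence
    (fun t => ‖axisDensity N t‖ * (|p.2| / 2)⁻¹)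
    (Eventually.of_forall fun q => aestronglyMeasurable_source hN hN0 q) ?_
    ((integrable_axisDensity hN hN0).norm.mul_const _) ?_
  · filter_upwards [(continuous_snd.abs.tendsto p).eventually_const_lt (half_lt_self hp2')]
      with q hq
    refine ae_of_all _ fun t => ?_
    rw [norm_mul, Complex.norm_real]
    refine mul_le_mul_of_nonneg_left ?_ (norm_nonneg _)
    have h0 : 0 < |p.2| / 2 := by positivity
    exact (norm_sourceKer_le (abs_pos.1 (h0.trans hq))).trans (inv_anti₀ h0 hq.le)
  · exact ae_of_all _ fun t => (continuousAt_sourceKer hp (Or.inl hp2)).tendsto.const_mul _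

/-- For `|t| < ρ₀ ≤ ρ` the kernel at height zero dominates the kernel at every height, so
convergence of the integral on the plane is itself the domination. This covers the rim `ρ = ρ₀`. -/
lemma tendsto_sourcePotential_plane (hN : IntegrableOn N (Ioi 0))
    (hN0 : ∀ ρ, ρ₀ ≤ ρ → N ρ = 0) {ρ : ℝ} (hρ0 : 0 < ρ) (hρ : ρ₀ ≤ ρ)
    (hi : Integrable fun t => (axisDensity N t : ℂ) * sourceKer (ρ, 0) t) :
    Tendsto (fun ζ => sourcePotential N (ρ, ζ)) (𝓝[>] 0) (𝓝 (sourcePotential N (ρ, 0))) := by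
  refine tendsto_integral_filter_of_dominated_convergence _
    (Eventually.of_forall fun ζ => aestronglyMeasurable_source hN hN0 (ρ, ζ)) ?_ hi.norm ?_
  · refine Eventually.of_forall fun ζ => ae_of_all _ fun t => ?_
    rcases lt_or_ge |t| ρ₀ with h | h
    · rw [norm_mul, norm_mul, norm_sourceKer, norm_sourceKer]
      have h1 : 0 < ρ ^ 2 - t ^ 2 := by
        have := sq_lt_sq' (neg_lt_of_abs_lt (h.trans_le hρ)) (lt_of_abs_lt (h.trans_le hρ))
        linarith
      have h2 : sourceDistSq (ρ, 0) t = ((ρ ^ 2 - t ^ 2 : ℝ) : ℂ) := by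
        apply Complex.ext
        · rw [sourceDistSq_re, Complex.ofReal_re]; ring
        · rw [sourceDistSq_im, Complex.ofReal_im]; ring
      have h3 := abs_le_norm_sourceDistSq (ρ := ρ) (ζ := ζ) (t := t)
      rw [h2, Complex.norm_real (ρ ^ 2 - t ^ 2), Real.norm_eq_abs (ρ ^ 2 - t ^ 2)]
      have h4 : 0 < |ρ ^ 2 - t ^ 2| := abs_pos.2 h1.ne'
      gcongr
    · simp [axisDensity_eq_zero hN0 h]
  · refine ae_of_all _ fun t => ?_
    rcases lt_or_ge |t| ρ₀ with h | h
    · refine Tendsto.const_mul _ ?_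
      have h1 : t ^ 2 < ρ ^ 2 :=
        sq_lt_sq' (neg_lt_of_abs_lt (h.trans_le hρ)) (lt_of_abs_lt (h.trans_le hρ))
      have h2 : ContinuousAt (fun ζ : ℝ => sourceKer (ρ, ζ) t) 0 :=
        ContinuousAt.comp (f := fun ζ : ℝ => (ρ, ζ)) (g := fun p => sourceKer p t)
          (continuousAt_sourceKer hρ0 (Or.inr h1)) (by fun_prop)
      exact h2.tendsto.mono_left nhdsWithin_le_nhds
    · simp [axisDensity_eq_zero hN0 h]

lemma sourcePotential_neg_snd (ρ ζ : ℝ) :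
    sourcePotential N (ρ, -ζ) = sourcePotential N (ρ, ζ) := by
  rw [sourcePotential, sourcePotential,
    ← integral_neg_eq_self fun t => (axisDensity N t : ℂ) * sourceKer (ρ, ζ) t]
  congr 1
  ext t
  rw [sourceKer_neg_snd, show axisDensity N (-t) = axisDensity N t by simp [axisDensity]]

/-- The Poisson transform of the source potential at the level `ζ`. -/
lemma integral_sourcePotential_mul_poissonKer (hN : IntegrableOn N (Ioi 0))
    (hN0 : ∀ ρ, ρ₀ ≤ ρ → N ρ = 0) {ζ w : ℝ} (hζ : 0 < ζ) (hw : 0 < w) :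
    IntegrableOn (fun ρ : ℝ => ((ρ * poissonKer ρ w : ℝ) : ℂ) * sourcePotential N (ρ, ζ)) (Ioi 0) ∧
      ∫ ρ in Ioi 0, ((ρ * poissonKer ρ w : ℝ) : ℂ) * sourcePotential N (ρ, ζ) =
        (Real.pi * axisPotential N (ζ + w) : ℝ) := by
  have hF := integrable_axisDensity hN hN0
  have hk := (integral_mul_poissonKer hw).1
  have hint : Integrable (Function.uncurry fun ρ t : ℝ => ((ρ * poissonKer ρ w : ℝ) : ℂ) *
      ((axisDensity N t : ℂ) * sourceKer (ρ, ζ) t)) ((volume.restrict (Ioi 0)).prod volume) := by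
    refine ((hk.norm.mul_prod hF.norm).mul_const |ζ|⁻¹).mono' ?_ (ae_of_all _ fun q => ?_)
    · refine (hk.ofReal (𝕜 := ℂ)).aestronglyMeasurable.comp_fst.mul
        ((hF.ofReal (𝕜 := ℂ)).aestronglyMeasurable.comp_snd.mul ?_)
      exact (measurable_sourceKer.comp (by fun_prop : Measurable fun q : ℝ × ℝ =>
        ((q.1, ζ), q.2))).aestronglyMeasurable
    · simp only [Function.uncurry, norm_mul, Complex.norm_real]
      rw [← mul_assoc]
      exact mul_le_mul_of_nonneg_left (norm_sourceKer_le hζ.ne') (by positivity)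
  have he : ∀ ρ : ℝ, ∫ t, ((ρ * poissonKer ρ w : ℝ) : ℂ) *
      ((axisDensity N t : ℂ) * sourceKer (ρ, ζ) t) =
      ((ρ * poissonKer ρ w : ℝ) : ℂ) * sourcePotential N (ρ, ζ) := fun ρ => by
    rw [integral_const_mul, sourcePotential]
  refine ⟨hint.integral_prod_left.congr (ae_of_all _ fun ρ => he ρ), ?_⟩
  simp only [← he]
  rw [integral_integral_swap hint, ← integral_axisDensity_div hN hN0 (add_pos hζ hw)]
  refine integral_congr_ae ?_
  have hne : ∀ᵐ t : ℝ, t ≠ 0 := by simp [ae_iff]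
  filter_upwards [hne] with t ht
  rw [← integral_sourceKer_mul_poissonKer hζ ht hw, ← integral_const_mul]
  congr 1
  ext ρ
  ring

/-- A function with the same Poisson transform as the source potential agrees with it. -/
theorem eq_sourcePotential (hN : IntegrableOn N (Ioi 0)) (hN0 : ∀ ρ, ρ₀ ≤ ρ → N ρ = 0)
    {g : ℝ → ℝ} {ζ : ℝ} (hζ : 0 < ζ) (hg : ContinuousOn g (Ioi 0)) (hM : ∀ ρ > 0, |g ρ| ≤ M)
    (h : ∀ w > 0, ∫ ρ in Ioi 0, ρ * g ρ * poissonKer ρ w = axisPotential N (ζ + w))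
    {ρ : ℝ} (hρ : 0 < ρ) : (g ρ : ℂ) = 1 / Real.pi * sourcePotential N (ρ, ζ) := by
  -- `poissonKer x w = w (x² + w²)^(-3/2)`, so with `A = w²` the Poisson transform is a Stieltjes
  -- transform of exponent `3/2`.
  have hrpow : ∀ A > (0 : ℝ), ∀ x : ℝ,
      (x ^ 2 + A) ^ (-(3 / 2) : ℝ) = 1 / √A * poissonKer x √A := by
    intro A hA x
    have h1 : 0 < √(x ^ 2 + A) := by positivity
    have h2 : (x ^ 2 + A) ^ (3 / 2 : ℝ) = √(x ^ 2 + A) ^ 3 := by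
      rw [Real.sqrt_eq_rpow, ← Real.rpow_mul_natCast (by positivity)]
      norm_num
    rw [Real.rpow_neg (by positivity), h2, poissonKer, Real.sq_sqrt hA.le]
    have := Real.sqrt_pos.2 hA
    field_simp
  have hboth : ∀ A > (0 : ℝ), IntegrableOn (fun x : ℝ => (x ^ 2 + A) ^ (-(3 / 2) : ℝ) •
      ((x : ℂ) * ((g x : ℂ) - 1 / Real.pi * sourcePotential N (x, ζ)))) (Ioi 0) ∧
      ∫ x : ℝ in Ioi 0, (x ^ 2 + A) ^ (-(3 / 2) : ℝ) •
      ((x : ℂ) * ((g x : ℂ) - 1 / Real.pi * sourcePotential N (x, ζ))) = 0 := by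
    intro A hA
    have hw := Real.sqrt_pos.2 hA
    obtain ⟨i1, e1⟩ := integral_sourcePotential_mul_poissonKer hN hN0 hζ hw
    have i2 : Integrable (fun x : ℝ => ((x * g x * poissonKer x √A : ℝ) : ℂ))
        (volume.restrict (Ioi 0)) := (integrableOn_mul_poissonKer (hg.aestronglyMeasurable measurableSet_Ioi) hM
      hw).ofReal (𝕜 := ℂ)
    have i3 := i1.const_mul (1 / (Real.pi : ℂ))
    have he : ∀ x : ℝ, (x ^ 2 + A) ^ (-(3 / 2) : ℝ) •
        ((x : ℂ) * ((g x : ℂ) - 1 / Real.pi * sourcePotential N (x, ζ))) =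
        ((1 / √A : ℝ) : ℂ) * (((x * g x * poissonKer x √A : ℝ) : ℂ) - 1 / Real.pi *
          (((x * poissonKer x √A : ℝ) : ℂ) * sourcePotential N (x, ζ))) := fun x => by
      rw [hrpow A hA, Complex.real_smul]; push_cast; ring
    simp only [he]
    refine ⟨(i2.sub i3).const_mul _, ?_⟩
    have hπ : (Real.pi : ℂ) ≠ 0 := by exact_mod_cast Real.pi_ne_zero
    rw [integral_const_mul, integral_sub i2 i3, integral_const_mul, e1,
      integral_complex_ofReal, h _ hw]
    push_cast
    field_simp
    simp
  have hae := ae_eq_zero_of_stieltjes_eq_zero (ν := 3 / 2) (by positivity) (hboth 1 one_pos).1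
    fun A hA => (hboth A hA).2
  have heq : EqOn (fun x => (g x : ℂ)) (fun x => 1 / Real.pi * sourcePotential N (x, ζ))
      (Ioi 0) := by
    refine Measure.eqOn_open_of_ae_eq (μ := volume) ((ae_restrict_iff' measurableSet_Ioi).2 ?_)
      isOpen_Ioi
      (Complex.continuous_ofReal.comp_continuousOn hg) (continuousOn_const.mul fun x hx => ?_)
    · filter_upwards [hae] with x hx hx0
      have hxc : (x : ℂ) ≠ 0 := by exact_mod_cast (ne_of_gt hx0)
      exact sub_eq_zero.1 ((mul_eq_zero.1 (hx hx0)).resolve_left hxc)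
    · exact (ContinuousAt.comp (f := fun x : ℝ => (x, ζ)) (continuousAt_sourcePotential hN hN0
        (p := (x, ζ)) hx hζ.ne') (by fun_prop)).continuousWithinAt
  exact heq hρ

end Representation

/-- Boundary values from one side of the disk are continuous. -/
lemma continuousOn_of_tendsto_upper {f : ℝ × ℝ → ℝ} {g : ℝ → ℝ} {s : Set ℝ}
    (h : ∀ ρ ∈ s, Tendsto f (𝓝[{p | 0 < p.2}] (ρ, 0)) (𝓝 (g ρ))) : ContinuousOn g s := by
  have hcl : ∀ ρ : ℝ, (ρ, (0 : ℝ)) ∈ closure {p : ℝ × ℝ | 0 < p.2} := fun ρ => by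
    refine mem_closure_of_tendsto (b := 𝓝[>] (0 : ℝ)) (f := fun ε => (ρ, ε)) ?_
      self_mem_nhdsWithin
    exact (Continuous.tendsto' (by fun_prop) _ _ rfl).mono_left nhdsWithin_le_nhds
  have h1 : ContinuousOn (extendFrom {p : ℝ × ℝ | 0 < p.2} f) ((fun ρ => (ρ, 0)) '' s) := by
    refine continuousOn_extendFrom ?_ ?_
    · rintro _ ⟨ρ, -, rfl⟩
      exact hcl ρ
    · rintro _ ⟨ρ, hρ, rfl⟩
      exact ⟨_, h ρ hρ⟩
  refine (h1.comp (f := fun ρ : ℝ => (ρ, (0 : ℝ))) (s := s) (by fun_prop)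
    (mapsTo_image _ _)).congr fun ρ hρ => ?_
  exact (extendFrom_eq (hcl ρ) (h ρ hρ)).symm

/-! ### Assembly of the theorem -/

theorem mainTheorem3 (ρ₀ : ℝ) (hρ₀ : 0 < ρ₀) (U : ℝ × ℝ → ℝ)
    -- `U` is continuous on `𝒟` and solves the equation in `𝒟` away from the rim
    (hcont : ContinuousOn U (exteriorDisk ρ₀))
    (hU : IsAxisymmetricHarmonicOn U (exteriorDisk ρ₀ \ {(ρ₀, 0)}))
    -- regularity on the rotation axis: `U_ρ(+0, ζ) = 0` for `ζ ≠ 0`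
    (haxis : ∀ ζ : ℝ, ζ ≠ 0 →
      Tendsto (partialRho U) (𝓝[{p | 0 < p.1}] ((0 : ℝ), ζ)) (𝓝 0))
    -- `U → 0` as `ρ² + ζ² → ∞`
    (hdecay : Tendsto U
      (comap (fun p : ℝ × ℝ => p.1 ^ 2 + p.2 ^ 2) atTop ⊓ 𝓟 (exteriorDisk ρ₀)) (𝓝 0))
    -- equatorial symmetry
    (hsymm : ∀ p ∈ exteriorDisk ρ₀, U (p.1, p.2) = U (p.1, -p.2))
    -- the boundary values `U(+i0)`, `U_ρ(ρ + i0)`, `U_ζ(ρ + i0)` on the upper side of the disk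
    (Uc : ℝ) (Ur Uz : ℝ → ℝ)
    (hUc : Tendsto U (𝓝[{p | 0 < p.1 ∧ 0 < p.2}] ((0 : ℝ), (0 : ℝ))) (𝓝 Uc))
    (hUr : ∀ ρ ∈ Ioo 0 ρ₀, Tendsto (partialRho U) (𝓝[{p | 0 < p.2}] (ρ, (0 : ℝ))) (𝓝 (Ur ρ)))
    (hUz : ∀ ρ ∈ Ioo 0 ρ₀, Tendsto (partialZeta U) (𝓝[{p | 0 < p.2}] (ρ, (0 : ℝ))) (𝓝 (Uz ρ)))
    (hUr_int : ∀ a ∈ Ioo 0 ρ₀, IntervalIntegrable Ur volume 0 a)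
    (hUz_int : IntervalIntegrable Uz volume 0 ρ₀) :
    -- the integrals in the two expressions for the density converge absolutely
    (∀ k₂ : ℝ, |k₂| < ρ₀ →
      IntervalIntegrable (fun ρ => Ur ρ / √(k₂ ^ 2 - ρ ^ 2)) volume 0 |k₂| ∧
      IntervalIntegrable (fun ρ => ρ * Uz ρ / √(ρ ^ 2 - k₂ ^ 2)) volume |k₂| ρ₀) ∧
    ∃ D : ℂ → ℂ,
      (∀ k₂ : ℝ, |k₂| < ρ₀ → D (Complex.I * k₂) = (dirichletDensity Uc Ur k₂ : ℂ)) ∧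
      (∀ k₂ : ℝ, |k₂| < ρ₀ → D (Complex.I * k₂) = (neumannDensity ρ₀ Uz k₂ : ℂ)) ∧
      (∀ p ∈ exteriorDisk ρ₀, p ≠ (ρ₀, 0) → ImagSegmentIntegrable ρ₀ (reprIntegrand D p)) ∧
      -- the representation holds on `𝒟`, at the rim whenever the integral converges there
      (∀ p ∈ exteriorDisk ρ₀, ImagSegmentIntegrable ρ₀ (reprIntegrand D p) →
        (U p : ℂ) = -(1 / (4 * (Real.pi : ℂ) * Complex.I)) *
          imagSegmentIntegral ρ₀ (reprIntegrand D p)) := by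
  -- Outside the disk the normal derivative is zero by symmetry. The value of `N` at `ρ₀` is
  -- immaterial.
  set N : ℝ → ℝ := fun ρ => if ρ < ρ₀ then Uz ρ else 0 with hNdef
  have hN0 : ∀ ρ, ρ₀ ≤ ρ → N ρ = 0 := fun ρ hρ => if_neg (not_lt.2 hρ)
  have hNUz : ∀ ρ ∈ Ioo 0 ρ₀, N ρ = Uz ρ := fun ρ hρ => if_pos hρ.2
  have hNint : IntegrableOn N (Ioi 0) := by
    have h1 : IntegrableOn Uz (Ioo 0 ρ₀) :=
      (intervalIntegrable_iff_integrableOn_Ioo_of_le hρ₀.le).1 hUz_int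
    exact (h1.congr_fun (fun ρ hρ => (hNUz ρ hρ).symm)
      measurableSet_Ioo).of_forall_sdiff_eq_zero measurableSet_Ioi fun ρ hρ =>
        hN0 ρ (not_lt.1 fun h => hρ.2 ⟨hρ.1, h⟩)
  have hNc : ContinuousOn N (Ioo 0 ρ₀) := (continuousOn_of_tendsto_upper hUz).congr hNUz
  have hUrc : ContinuousOn Ur (Ioo 0 ρ₀) := continuousOn_of_tendsto_upper hUr
  have hUri : ∀ a ∈ Ioo 0 ρ₀, IntegrableOn Ur (Ioo 0 a) := fun a ha =>
    (intervalIntegrable_iff_integrableOn_Ioo_of_le ha.1.le).1 (hUr_int a ha)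
  have hJ := isOn_ofFun_upper hρ₀ hU
  obtain ⟨M, hM⟩ := exists_bound_upper hρ₀ hcont hU haxis hdecay hUc hUz
  have hlev : ∀ ε > 0, ∀ w > 0,
      ∫ ρ in Ioi 0, ρ * U (ρ, ε) * poissonKer ρ w = axisPotential N (ε + w) := fun ε hε w hw =>
    integral_level_poissonKer (J := PartialJet.ofFun U) hρ₀ hε hw hJ
      (fun p h1 h2 => hU.2 p (upper_subset_exteriorDisk_diff_rim hρ₀ ⟨h1, h2⟩)) hM
      (fun ρ hρ hne => by
        rcases lt_or_gt_of_ne hne with h | h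
        · rw [hNUz ρ ⟨hρ, h⟩]
          exact hUz ρ ⟨hρ, h⟩
        · rw [hN0 ρ h.le]
          exact (tendsto_partialZeta_outside hρ₀ hU hsymm h).mono_left nhdsWithin_le_nhds)
      hNint (tendsto_level_atTop hdecay hε)
  have hvert : ∀ ρ, 0 < ρ → ρ₀ ≤ ρ → Tendsto (fun ε => U (ρ, ε)) (𝓝[>] 0) (𝓝 (U (ρ, 0))) := by
    intro ρ hρ hρ'
    refine (hcont (ρ, 0) (mem_exteriorDisk.2 ⟨hρ, Or.inr hρ'⟩)).tendsto.comp
      (tendsto_nhdsWithin_iff.2 ⟨?_, ?_⟩)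
    · exact (Continuous.tendsto' (by fun_prop) _ _ rfl).mono_left nhdsWithin_le_nhds
    · exact Eventually.of_forall fun ε => mem_exteriorDisk.2 ⟨hρ, Or.inr hρ'⟩
  set u : ℝ → ℝ := fun ρ => if ρ < ρ₀ then Uc + ∫ r in Ioo 0 ρ, Ur r else U (ρ, 0) with hu
  have hud : ∀ ρ ∈ Ioo 0 ρ₀, u ρ = Uc + ∫ r in Ioo 0 ρ, Ur r := fun ρ hρ => if_pos hρ.2
  have hulim : ∀ ρ > 0, Tendsto (fun ε => U (ρ, ε)) (𝓝[>] 0) (𝓝 (u ρ)) := by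
    intro ρ hρ
    rcases lt_or_ge ρ ρ₀ with h | h
    · rw [hud ρ ⟨hρ, h⟩, ← integral_Ioc_eq_integral_Ioo, ← intervalIntegral.integral_of_le hρ.le]
      exact tendsto_disk_values hρ₀ hU hUc hUr hUr_int ⟨hρ, h⟩
    · rw [hu]
      simp only [if_neg (not_lt.2 h)]
      exact hvert ρ hρ h
  obtain ⟨hum, huM, hbd⟩ := integral_boundary_poissonKer hJ.cf hM hulim hNint hlev
  have hupper : ∀ k : ℝ, |k| < ρ₀ → IntegrableOn (fun ρ => ρ * Uz ρ / √(ρ ^ 2 - k ^ 2))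
      (Ioo |k| ρ₀) ∧ ∫ ρ in Ioo |k| ρ₀, ρ * Uz ρ / √(ρ ^ 2 - k ^ 2) = abelTransform 1 N |k| := by
    intro k hk
    have hk0 := abs_nonneg k
    have hsub : Ioo |k| ρ₀ ⊆ Ioi 0 := fun ρ hρ => hk0.trans_lt hρ.1
    have he : ∀ ρ ∈ Ioo |k| ρ₀, ρ * N ρ * (√(1 * (ρ ^ 2 - |k| ^ 2)))⁻¹ =
        ρ * Uz ρ / √(ρ ^ 2 - k ^ 2) := fun ρ hρ => by
      rw [hNUz ρ ⟨hk0.trans_lt hρ.1, hρ.2⟩, one_mul, sq_abs, div_eq_mul_inv]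
    constructor
    · refine IntegrableOn.congr_fun ?_ he measurableSet_Ioo
      -- At `k = 0` the kernel `ρ / √(ρ²)` is `1`, and integrability is that of `Uz` itself; the
      -- continuity lemma for Abel transforms needs a positive parameter.
      rcases hk0.eq_or_lt with h | h
      · refine (hNint.mono_set hsub).congr_fun (fun ρ hρ => ?_) measurableSet_Ioo
        have hρ0 : 0 < ρ := hsub hρ
        rw [← h, zero_pow two_ne_zero, sub_zero, one_mul, Real.sqrt_sq hρ0.le]
        field_simp
      · exact (upper_abelTransform_continuousAt hNint hN0 hNc ⟨h, hk⟩).1.mono_set hsub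
    · rw [← setIntegral_congr_fun measurableSet_Ioo he, abelTransform]
      refine (setIntegral_eq_of_subset_of_forall_sdiff_eq_zero measurableSet_Ioi hsub
        fun ρ hρ => ?_).symm
      have hρ0 : 0 < ρ := hρ.1
      rcases le_or_gt ρ |k| with h | h
      · rw [Real.sqrt_eq_zero_of_nonpos (by nlinarith), inv_zero, mul_zero]
      · rw [hN0 ρ (not_lt.1 fun h' => hρ.2 ⟨h, h'⟩), mul_zero, zero_mul]
  have hlower : ∀ k : ℝ, 0 < |k| → |k| < ρ₀ → IntegrableOn (fun ρ => Ur ρ / √(k ^ 2 - ρ ^ 2))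
      (Ioo 0 |k|) ∧ ∫ ρ in Ioo 0 |k|, Ur ρ / √(k ^ 2 - ρ ^ 2) =
        abelTransform (-1) (fun r => Ur r / r) |k| := by
    intro k hk0 hk
    have hsub : Ioo 0 |k| ⊆ Ioi 0 := fun ρ hρ => hρ.1
    have he : ∀ ρ, Ur ρ * (√(-1 * (ρ ^ 2 - |k| ^ 2)))⁻¹ = Ur ρ / √(k ^ 2 - ρ ^ 2) := fun ρ => by
      rw [sq_abs, div_eq_mul_inv]; congr 3; ring
    constructor
    · exact (lower_abelTransform_continuousAt hUrc hUri ⟨hk0, hk⟩).1.congr_fun (fun ρ _ => he ρ)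
        measurableSet_Ioo
    · rw [abelTransform, setIntegral_eq_of_subset_of_forall_sdiff_eq_zero measurableSet_Ioi hsub
        fun ρ hρ => ?_]
      · refine setIntegral_congr_fun measurableSet_Ioo fun ρ hρ => ?_
        have hρ0 : ρ ≠ 0 := hρ.1.ne'
        rw [← he, mul_div_cancel₀ _ hρ0]
      · have hρ0 : 0 < ρ := hρ.1
        have : |k| ≤ ρ := not_lt.1 fun h => hρ.2 ⟨hρ0, h⟩
        rw [Real.sqrt_eq_zero_of_nonpos (by nlinarith), inv_zero, mul_zero]
  have hneu : ∀ k : ℝ, |k| < ρ₀ → -4 * axisDensity N k = neumannDensity ρ₀ Uz k := fun k hk => by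
    rw [neumannDensity, intervalIntegral.integral_of_le hk.le, integral_Ioc_eq_integral_Ioo,
      (hupper k hk).2, axisDensity]
    ring
  have hdir : ∀ k : ℝ, |k| < ρ₀ → -4 * axisDensity N k = dirichletDensity Uc Ur k := by
    intro k hk
    rw [dirichletDensity, axisDensity]
    rcases (abs_nonneg k).eq_or_lt with h | h
    · rw [← h, zero_mul, add_zero, density_eq_zero hρ₀ hNint hUri hum huM hud hbd, abelTransform]
      congr 2
      refine setIntegral_congr_fun measurableSet_Ioi fun ρ hρ => ?_
      have hρ0 : 0 < ρ := hρ
      rw [zero_pow two_ne_zero, sub_zero, one_mul, Real.sqrt_sq hρ0.le]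
      field_simp
    · rw [intervalIntegral.integral_of_le h.le, integral_Ioc_eq_integral_Ioo, (hlower k h hk).2,
        density_eq hNint hN0 hNc hUrc hUri hum huM hud hbd ⟨h, hk⟩]
  -- The witness for `D` is `-4` times the density at the imaginary part of its argument. The `-4`
  -- cancels the prefactor `-1 / (4πi)`, with `dk = i dk₂`, down to `1 / π`.
  have hker : ∀ (p : ℝ × ℝ) (k : ℝ), reprIntegrand
      (fun z => ((-4 * axisDensity N z.im : ℝ) : ℂ)) p (Complex.I * k) * Complex.I =
      -4 * Complex.I * ((axisDensity N k : ℂ) * sourceKer p k) := fun p k => by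
    have : (Complex.I * (k : ℂ)).im = k := by simp
    rw [reprIntegrand, this, sourceKer, sourceDistSq, div_eq_mul_inv]
    push_cast
    ring
  have hsupp : ∀ (p : ℝ × ℝ), ∀ k ∉ Ioc (-ρ₀) ρ₀,
      (axisDensity N k : ℂ) * sourceKer p k = 0 := fun p k hk => by
    rw [axisDensity_eq_zero hN0 (le_of_not_gt fun h => hk
      ⟨neg_lt_of_abs_lt h, (lt_of_abs_lt h).le⟩), Complex.ofReal_zero, zero_mul]
  have hle : -ρ₀ ≤ ρ₀ := by linarith
  -- The density vanishes for `|t| ≥ ρ₀`, so convergence on the segment is convergence over all of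
  -- `ℝ`.
  have hseg : ∀ p : ℝ × ℝ, ImagSegmentIntegrable ρ₀ (reprIntegrand
      (fun z => ((-4 * axisDensity N z.im : ℝ) : ℂ)) p) ↔
      Integrable fun t => (axisDensity N t : ℂ) * sourceKer p t := fun p => by
    have hc : (-4 * Complex.I : ℂ) ≠ 0 := by simp
    rw [ImagSegmentIntegrable, intervalIntegrable_iff_integrableOn_Ioc_of_le hle]
    simp only [hker]
    rw [IntegrableOn, integrable_const_mul_iff hc.isUnit]
    exact ⟨fun h => IntegrableOn.integrable_of_forall_notMem_eq_zero h (hsupp p),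
      fun h => h.integrableOn⟩
  have hval : ∀ p : ℝ × ℝ, -(1 / (4 * (Real.pi : ℂ) * Complex.I)) *
      imagSegmentIntegral ρ₀ (reprIntegrand (fun z => ((-4 * axisDensity N z.im : ℝ) : ℂ)) p) =
      1 / Real.pi * sourcePotential N p := fun p => by
    rw [imagSegmentIntegral, intervalIntegral.integral_of_le hle]
    simp only [hker]
    rw [integral_const_mul, setIntegral_eq_integral_of_forall_compl_eq_zero (hsupp p),
      sourcePotential]
    have hπ : (Real.pi : ℂ) ≠ 0 := by exact_mod_cast Real.pi_ne_zero
    have hI := Complex.I_ne_zero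
    field_simp
  have hpos : ∀ ρ ζ : ℝ, 0 < ρ → 0 < ζ → (U (ρ, ζ) : ℂ) = 1 / Real.pi * sourcePotential N (ρ, ζ) :=
    fun ρ ζ hρ hζ => eq_sourcePotential (g := fun ρ => U (ρ, ζ)) hNint hN0 hζ
      (hJ.cf.comp (by fun_prop) fun r hr => ⟨hr, hζ⟩) (fun r hr => hM _ hr hζ) (hlev ζ hζ) hρ
  refine ⟨fun k hk => ⟨?_, ?_⟩, fun z => ((-4 * axisDensity N z.im : ℝ) : ℂ), fun k hk => ?_,
    fun k hk => ?_, fun p hp hne => ?_, fun p hp hi => ?_⟩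
  · rcases (abs_nonneg k).eq_or_lt with h | h
    · rw [← h]
    · rw [intervalIntegrable_iff_integrableOn_Ioo_of_le h.le]
      exact (hlower k h hk).1
  · rw [intervalIntegrable_iff_integrableOn_Ioo_of_le hk.le]
    exact (hupper k hk).1
  · rw [← hdir k hk]; simp
  · rw [← hneu k hk]; simp
  · obtain ⟨ρ, ζ⟩ := p
    rw [hseg]
    obtain ⟨hρ, h⟩ := mem_exteriorDisk.1 hp
    by_cases hζ : ζ = 0
    · subst hζ
      have hρ' : ρ₀ < ρ := lt_of_le_of_ne (h.resolve_left fun h => h rfl) fun h => hne (by rw [h])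
      refine integrable_source_of_bound hNint hN0 (C := (√(ρ ^ 2 - ρ₀ ^ 2))⁻¹) fun t ht => ?_
      rw [norm_sourceKer]
      have h1 : t ^ 2 ≤ ρ₀ ^ 2 := sq_le_sq' (neg_lt_of_abs_lt ht).le (lt_of_abs_lt ht).le
      have h2 : 0 < ρ ^ 2 - ρ₀ ^ 2 := by nlinarith
      refine inv_anti₀ (Real.sqrt_pos.2 h2) (Real.sqrt_le_sqrt ?_)
      exact (by linarith : ρ ^ 2 - ρ₀ ^ 2 ≤ ρ ^ 2 - t ^ 2).trans
        ((le_abs_self _).trans abs_le_norm_sourceDistSq)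
    · exact integrable_source_of_bound hNint hN0 fun t _ => norm_sourceKer_le hζ
  · rw [hval]
    rw [hseg] at hi
    obtain ⟨ρ, ζ⟩ := p
    obtain ⟨hρ, h⟩ := mem_exteriorDisk.1 hp
    -- The formula is proved for `ζ > 0`. Below the plane both sides are even in `ζ`; on it, `ρ ≥
    -- ρ₀` and both sides are limits from above.
    rcases lt_trichotomy ζ 0 with hζ | hζ | hζ
    · have h1 : U (ρ, ζ) = U (ρ, -ζ) := hsymm (ρ, ζ) hp
      rw [h1, hpos ρ (-ζ) hρ (neg_pos.2 hζ), sourcePotential_neg_snd]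
    · subst hζ
      have hρ' : ρ₀ ≤ ρ := h.resolve_left fun h => h rfl
      refine tendsto_nhds_unique
        ((Complex.continuous_ofReal.tendsto _).comp (hvert ρ hρ hρ'))
        (((tendsto_sourcePotential_plane hNint hN0 hρ hρ' hi).const_mul
          (1 / (Real.pi : ℂ))).congr' ?_)
      filter_upwards [self_mem_nhdsWithin] with ε hε using (hpos ρ ε hρ hε).symm
    · exact hpos ρ ζ hρ hζ
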